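/- **Setting.** Let $\Omega$ be a finite set with a distinguished element $0\in\Omega$, and let $\ell\ge 1$, $0\le i\le \ell-1$, $\delta>0$, $\epsilon_{pe}\in(0,1)$. An *instance* consists of an energy function $E:\Omega\to[0,\infty)$; inverse temperatures $0=\beta_0\le\beta_1\le\dots\le\beta_\ell$ such that, with $Z_j=\sum_{\sigma}e^{-\beta_jE(\sigma)}$, the ratios $\alpha_j=Z_{j+1}/Z_j$ satisfy $\alpha_j\ge\frac12$ for $0\le j\le\ell-1$; for each $1\le j\le \ell-1$ an ergodic Markov chain $P_j$ on $\Omega$ that is reversible with respect to the Boltzmann distribution $\pi_j(\sigma)=e^{-\beta_jE(\sigma)}/Z_j$ and whose spectral gap $1-\max\{|\mu|:\mu\neq1\text{ an eigenvalue of }P_j\}$ is at least $\delta$ (the gap is $1$ if $|\Omega|=1$); and for each such $j$ a unitary $U_j$ on $\mathbb C^\Omega\otimes\mathbb C^\Omega$ with $U_j|x\rangle|0\rangle=\sum_y\sqrt{P_j(x,y)}\,|x\rangle|y\rangle$ for all $x\in\Omega$. The quantum walk is $W(P_j)=R_{\mathcal B_j}R_{\mathcal A}$, where $R_{\mathcal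 A},R_{\mathcal B_j}$ are the reflections about $\mathcal A=\mathrm{span}\{|x\rangle|0\rangle:x\in\Omega\}$ and $\mathcal B_j=U_j^\dagger SU_j\mathcal A$, with $S$ the swap of the two registers. Let $V_i=\sum_\sigma|\sigma\rangle\langle\sigma|\otimes\begin{pmatrix}\sqrt{y_i(\sigma)}&\sqrt{1-y_i(\sigma)}\\-\sqrt{1-y_i(\sigma)}&\sqrt{y_i(\sigma)}\end{pmatrix}$ with $y_i(\sigma)=e^{-(\beta_{i+1}-\beta_i)E(\sigma)}$. A *scheme* is a quantum circuit on two registers with basis $\Omega$, a qubit and a finite ancilla register, started in a fixed computational basis state. Its gates are controlled walks $W(P_j)$ with $1\le j\le\ell-1$, the rotation $V_i$, and unitaries that do not depend on the instance; at the end the circuit is measured in the computational basis and a fixed function of the outcome is output as the estimate $Q_i''$. **Lemma.** There is a universal constant $C>0$ such that for all $\Omega$, $0\in\Omega$, $\ell$, $i$, $\delta$, $\epsilon_{pe}$ as above there is a scheme that does not depend on the instance, such that for every instance its estimate satisfies $$\Pr\big[(1-\epsilon_{pe})\alpha_i\le Q_i''\le(1+\epsilon_{pe})\alpha_i\big]\ge\tfrac34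 ,$$ and that uses at most $$C\left(\frac{\ell}{\sqrt\delta}\log^2\ell+\frac1{\epsilon_{pe}\sqrt\delta}\log\frac1{\epsilon_{pe}}\right)$$ controlled walk operators from $\{W(P_1),\dots,W(P_{\ell-1})\}$ and at most $C/\epsilon_{pe}$ rotations $V_i$. -/

import Mathlib

noncomputable section

namespace QPartition

/-! ### Gibbs distributions along a cooling schedule, and the Markov chains -/

/-- The Gibbs partition function at inverse temperature `b`. -/
def partitionFn {Ω : Type*} [Fintype Ω] (E : Ω → ℝ) (b : ℝ) : ℝ :=
  ∑ s, Real.exp (-b * E s)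

/-- The Boltzmann distribution at inverse temperature `b`. -/
def boltzmann {Ω : Type*} [Fintype Ω] (E : Ω → ℝ) (b : ℝ) (s : Ω) : ℝ :=
  Real.exp (-b * E s) / partitionFn E b

/-- The absolute spectral gap of a reversible ergodic chain: one minus the largest modulus of an
eigenvalue other than `1` (all eigenvalues are real; the gap is `1` on a one-point space). -/
def spectralGap {Ω : Type*} [Fintype Ω] [DecidableEq Ω] (P : Matrix Ω Ω ℝ) : ℝ :=
  1 - sSup {r : ℝ | ∃ μ : ℝ, Module.End.HasEigenvalue (Matrix.toLin' P) μ ∧ μ ≠ 1 ∧ r = |μ|}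

/-! ### Quantum walks -/

/-- The Hilbert space of two registers with basis `Ω`. -/
abbrev TwoReg (Ω : Type*) [Fintype Ω] : Type _ := EuclideanSpace ℂ (Ω × Ω)

/-- `U` is a quantum update for `P` with reference state `z`: a unitary with
`U |x⟩|z⟩ = |x⟩|p_x⟩`, where `|p_x⟩ = ∑ y, √(P x y) |y⟩`. -/
def IsQuantumUpdate {Ω : Type*} [Fintype Ω] [DecidableEq Ω] (z : Ω) (P : Matrix Ω Ω ℝ)
    (U : TwoReg Ω ≃ₗᵢ[ℂ] TwoReg Ω) : Prop :=
  ∀ x : Ω, U (EuclideanSpace.single (x, z) 1) =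
    WithLp.toLp 2 (fun q : Ω × Ω => if q.1 = x then ((Real.sqrt (P x q.2) : ℝ) : ℂ) else 0)

/-- The swap of the two registers. -/
def swapReg (Ω : Type*) [Fintype Ω] : TwoReg Ω ≃ₗᵢ[ℂ] TwoReg Ω :=
  LinearIsometryEquiv.piLpCongrLeft 2 ℂ ℂ (Equiv.prodComm Ω Ω)

/-- The space `𝒜`, spanned by the vectors `|x⟩|z⟩`. -/
def spaceA {Ω : Type*} [Fintype Ω] [DecidableEq Ω] (z : Ω) : Submodule ℂ (TwoReg Ω) :=
  Submodule.span ℂ (Set.range fun x : Ω => EuclideanSpace.single (x, z) (1 : ℂ))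

/-- The space `ℬ = U† S U 𝒜`. -/
def spaceB {Ω : Type*} [Fintype Ω] [DecidableEq Ω] (z : Ω)
    (U : TwoReg Ω ≃ₗᵢ[ℂ] TwoReg Ω) : Submodule ℂ (TwoReg Ω) :=
  (spaceA z).map ((U.trans ((swapReg Ω).trans U.symm)).toLinearEquiv : TwoReg Ω →ₗ[ℂ] TwoReg Ω)

/-- The quantum walk `W = R_ℬ R_𝒜` (first reflect about `𝒜`, then about `ℬ`). -/
def walkOp {Ω : Type*} [Fintype Ω] [DecidableEq Ω] (z : Ω)
    (U : TwoReg Ω ≃ₗᵢ[ℂ] TwoReg Ω) : TwoReg Ω ≃ₗᵢ[ℂ] TwoReg Ω :=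
  (spaceA z).reflection.trans (spaceB z U).reflection

/-! ### Problem instances -/

/-- The data of an instance. Only `beta 0, …, beta ℓ` and `chain j`, `update j` for
`1 ≤ j < ℓ` are relevant. -/
structure AnnealingData (Ω : Type*) [Fintype Ω] where
  /-- energy function -/
  energy : Ω → ℝ
  /-- inverse temperatures `β_j = 1 / (k T_j)` -/
  beta : ℕ → ℝ
  /-- transition matrices of the Markov chains `P_j` -/
  chain : ℕ → Matrix Ω Ω ℝ
  /-- quantum updates of the chains -/
  update : ℕ → (TwoReg Ω ≃ₗᵢ[ℂ] TwoReg Ω)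

namespace AnnealingData

variable {Ω : Type*} [Fintype Ω]

/-- The ratio `α_j = Z_{j+1} / Z_j`. -/
def ratio (I : AnnealingData Ω) (j : ℕ) : ℝ :=
  partitionFn I.energy (I.beta (j + 1)) / partitionFn I.energy (I.beta j)

/-- `y_j(s) = exp (-(β_{j+1} - β_j) E(s))`. -/
def yval (I : AnnealingData Ω) (j : ℕ) (s : Ω) : ℝ :=
  Real.exp (-(I.beta (j + 1) - I.beta j) * I.energy s)

/-- The standing assumptions. The energy is nonnegative, so that `0 < y_j ≤ 1`; the initial
temperature is infinite and the temperatures decrease; the ratios are at least `1/2`; the chains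
`P_1, …, P_{ℓ-1}` are ergodic and reversible with respect to the Boltzmann distributions, with
spectral gaps at least `δ`. -/
structure Admissible [DecidableEq Ω] (I : AnnealingData Ω) (z : Ω) (ℓ : ℕ) (δ : ℝ) : Prop where
  energy_nonneg : ∀ s, 0 ≤ I.energy s
  beta_zero : I.beta 0 = 0
  beta_mono : ∀ j < ℓ, I.beta j ≤ I.beta (j + 1)
  ratio_ge : ∀ j < ℓ, 1 / 2 ≤ I.ratio j
  stochastic : ∀ j, 1 ≤ j → j < ℓ → I.chain j ∈ Matrix.rowStochastic ℝ Ω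
  ergodic : ∀ j, 1 ≤ j → j < ℓ → (I.chain j).IsPrimitive
  reversible : ∀ j, 1 ≤ j → j < ℓ → ∀ x y,
    boltzmann I.energy (I.beta j) x * I.chain j x y =
      boltzmann I.energy (I.beta j) y * I.chain j y x
  gap_ge : ∀ j, 1 ≤ j → j < ℓ → δ ≤ spectralGap (I.chain j)
  isUpdate : ∀ j, 1 ≤ j → j < ℓ → IsQuantumUpdate z (I.chain j) (I.update j)

end AnnealingData

/-! ### Quantum circuits with black-box access to the walks and to the rotation `V_i` -/

/-- Computational basis: two `Ω`-registers, one qubit, and an ancilla register. -/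
abbrev Conf (Ω K : Type*) : Type _ := (Ω × Ω) × (Fin 2 × K)

/-- Gates of a circuit: instance-independent unitaries, controlled walks
(for the chains `P_1, …, P_{ℓ-1}` only), and the rotation `V_i`. -/
inductive Gate (Ω : Type*) [Fintype Ω] (K : Type) [Fintype K] (ℓ : ℕ) : Type _ where
  | free (F : EuclideanSpace ℂ (Conf Ω K) ≃ₗᵢ[ℂ] EuclideanSpace ℂ (Conf Ω K))
  | walk (j : ℕ) (one_le : 1 ≤ j) (lt : j < ℓ)
  | rot

/-- The controlled version of an operator `W` on the two `Ω`-registers: it applies `W` if the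
qubit is `1` and does nothing if the qubit is `0`. -/
def controlled {Ω : Type*} [Fintype Ω] {K : Type} [Fintype K]
    (W : TwoReg Ω ≃ₗᵢ[ℂ] TwoReg Ω) (ψ : EuclideanSpace ℂ (Conf Ω K)) :
    EuclideanSpace ℂ (Conf Ω K) :=
  WithLp.toLp 2 fun c : Conf Ω K =>
    if c.2.1 = 1 then W (WithLp.toLp 2 fun q : Ω × Ω => ψ (q, c.2)) c.1 else ψ c

/-- The rotation matrix with first row `√y, √(1-y)` and second row `-√(1-y), √y`. -/
def rotMatrix (y : ℝ) : Matrix (Fin 2) (Fin 2) ℝ :=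
  !![Real.sqrt y, Real.sqrt (1 - y); -Real.sqrt (1 - y), Real.sqrt y]

/-- The unitary `V = ∑ s, |s⟩⟨s| ⊗ rotMatrix (y s)` on the first `Ω`-register and the qubit. -/
def rotation {Ω : Type*} [Fintype Ω] {K : Type} [Fintype K]
    (y : Ω → ℝ) (ψ : EuclideanSpace ℂ (Conf Ω K)) : EuclideanSpace ℂ (Conf Ω K) :=
  WithLp.toLp 2 fun c : Conf Ω K =>
    ∑ b : Fin 2, ((rotMatrix (y c.1.1) c.2.1 b : ℝ) : ℂ) * ψ (c.1, (b, c.2.2))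

namespace Gate

variable {Ω : Type*} [Fintype Ω] {K : Type} [Fintype K] {ℓ : ℕ}

/-- `1` for a controlled walk and `0` for any other gate. -/
def walkCost : Gate Ω K ℓ → ℕ
  | free _ => 0
  | walk _ _ _ => 1
  | rot => 0

/-- `1` for the rotation `V_i` and `0` for any other gate. -/
def rotCost : Gate Ω K ℓ → ℕ
  | free _ => 0
  | walk _ _ _ => 0
  | rot => 1

/-- The action of a gate on the instance `I`, the rotation being `V_i`. -/
def act [DecidableEq Ω] (I : AnnealingData Ω) (z : Ω) (i : ℕ) :
    Gate Ω K ℓ → EuclideanSpace ℂ (Conf Ω K) → EuclideanSpace ℂ (Conf Ω K)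
  | free F, ψ => F ψ
  | walk j _ _, ψ => controlled (walkOp z (I.update j)) ψ
  | rot, ψ => rotation (I.yval i) ψ

end Gate

/-- An estimation scheme: an ancilla register, an initial basis state, a list of gates (applied
from the head of the list on), and a real number attached to every outcome of the final
measurement in the computational basis. -/
structure Scheme (Ω : Type*) [Fintype Ω] (ℓ : ℕ) where
  Anc : Type
  [fintypeAnc : Fintype Anc]
  [decEqAnc : DecidableEq Anc]
  init : Conf Ω Anc
  gates : List (Gate Ω Anc ℓ)
  output : Conf Ω Anc → ℝ

attribute [instance] Scheme.fintypeAnc Scheme.decEqAnc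

namespace Scheme

variable {Ω : Type*} [Fintype Ω] {ℓ : ℕ}

/-- The number of controlled walks in the circuit. -/
def walkCount (A : Scheme Ω ℓ) : ℕ := (A.gates.map Gate.walkCost).sum

/-- The number of rotations `V_i` in the circuit. -/
def rotCount (A : Scheme Ω ℓ) : ℕ := (A.gates.map Gate.rotCost).sum

/-- The state before the final measurement. -/
def finalState [DecidableEq Ω] (A : Scheme Ω ℓ) (I : AnnealingData Ω) (z : Ω) (i : ℕ) :
    EuclideanSpace ℂ (Conf Ω A.Anc) :=
  A.gates.foldl (fun ψ g => g.act I z i ψ) (EuclideanSpace.single A.init 1)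

open Classical in
/-- The probability that the estimate output by the scheme lies in the set `S`. -/
def prob [DecidableEq Ω] (A : Scheme Ω ℓ) (I : AnnealingData Ω) (z : Ω) (i : ℕ)
    (S : Set ℝ) : ℝ :=
  ∑ c ∈ Finset.univ.filter (fun c => A.output c ∈ S), ‖A.finalState I z i c‖ ^ 2

end Scheme

end QPartition

end

/-!
Encode `π_j` by the state `√π_j = ∑ x, √(π_j x) |x⟩`, which the walk `W = W(P_j)` fixes after `|x⟩`
is identified with `|x⟩|0⟩`. On the complement `S` of this state in `𝒜`, the operator `W + W⁻¹` is
twice the compression of `W` to `𝒜`, so it preserves `S`, and the spectral gap gives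
`‖W v - v‖ ≥ 2 √δ ‖v‖`. Hence every `v ∈ S` has the form `y - W y` with `2 √δ ‖y‖ ≤ ‖v‖`, and by
telescoping the average of the first `T ≥ 2 / √δ` powers of `W` at least halves the norm on `S`.
This average is normal, so its `r`-th power contracts by `2⁻ʳ` although `S` is not invariant under
`W`, and it gives access to the phase shifts at `√π_j` up to an error `2 · 2⁻ʳ`.

As `α_j ≥ 1/2`, the squared overlap of `√π_j` and `√π_{j+1}` is at least `1/2`. A step of the `π/3`
fixed-point search cubes the failure probability, so `O(log ℓ)` phase shifts suffice to move from
`√π_j` to `√π_{j+1}` with an error of order `1/ℓ`. In this way `√π_i` is prepared from the uniform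
state `√π_0`.

The rotation `V_i` turns `√π_i` into a state `ψ` in which the bit `0` has probability `α_i`, and the
Grover iterate `g` satisfies `(g + g⁻¹) ψ = 2 (1 - 2 α_i) ψ`. If the amplitudes `a k` vary slowly,
`∑ k, a k |k⟩ gᵏ ψ` is therefore nearly an eigenvector of the self-adjoint part of the cyclic shift
of `k`, for the eigenvalue `1 - 2 α_i`. Measuring `k` in the eigenbasis of this operator estimates
`α_i`, and tent-shaped amplitudes of width `O(1/ε)` reach the precision `ε`.
-/

noncomputable section

namespace QPartition

open scoped ComplexConjugate

section Hilbert

theorem exists_linearIsometryEquiv_comp_eq {𝕜 X H : Type*} [RCLike 𝕜] [NormedAddCommGroup X]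
    [InnerProductSpace 𝕜 X] [NormedAddCommGroup H] [InnerProductSpace 𝕜 H] [FiniteDimensional 𝕜 H]
    (f g : X →ₗᵢ[𝕜] H) : ∃ F : H ≃ₗᵢ[𝕜] H, ∀ x, F (f x) = g x := by
  let k : LinearMap.range f.toLinearMap →ₗᵢ[𝕜] H := g.comp f.equivRange.symm.toLinearIsometry
  refine ⟨k.extend.toLinearIsometryEquiv rfl, fun x => ?_⟩
  calc k.extend (f x) = k (f.equivRange x) := k.extend_apply (f.equivRange x)
    _ = g x := by simp [k]

variable {X : Type*} [NormedAddCommGroup X] [InnerProductSpace ℂ X]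

theorem norm_add_sub_one_smul_starProjection (K : Submodule ℂ X) [K.HasOrthogonalProjection]
    (ω : Circle) (x : X) : ‖x + ((ω : ℂ) - 1) • K.starProjection x‖ = ‖x‖ := by
  have hK : K.starProjection (x + ((ω : ℂ) - 1) • K.starProjection x)
      = (ω : ℂ) • K.starProjection x := by
    rw [map_add, map_smul, Submodule.starProjection_eq_self_iff.2 (K.starProjection_apply_mem x)]
    module
  have hKo : Kᗮ.starProjection (x + ((ω : ℂ) - 1) • K.starProjection x)
      = Kᗮ.starProjection x := by
    rw [map_add, map_smul, Submodule.starProjection_orthogonal_apply_eq_zero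
      (K.starProjection_apply_mem x), smul_zero, add_zero]
  rw [← sq_eq_sq₀ (norm_nonneg _) (norm_nonneg _), K.norm_sq_eq_add_norm_sq_starProjection, hK,
    hKo, norm_smul, Circle.norm_coe, one_mul, ← K.norm_sq_eq_add_norm_sq_starProjection]

/-- Multiplication by the phase `ω` on the line spanned by `s`, identity on its complement. It
generalizes the reflection in `s`, which is the case `ω = -1`. -/
def phaseShift (s : X) (ω : Circle) : X ≃ₗᵢ[ℂ] X :=
  LinearIsometryEquiv.ofSurjective
    { toLinearMap := LinearMap.id + ((ω : ℂ) - 1) • ((ℂ ∙ s).starProjection : X →ₗ[ℂ] X)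
      norm_map' := norm_add_sub_one_smul_starProjection _ ω }
    fun x => ⟨x + (conj (ω : ℂ) - 1) • (ℂ ∙ s).starProjection x, by
      have hidem := Submodule.starProjection_eq_self_iff.2
        ((ℂ ∙ s).starProjection_apply_mem x)
      have hω : (ω : ℂ) * conj (ω : ℂ) = 1 := by simp [Complex.mul_conj]
      change x + (conj (ω : ℂ) - 1) • (ℂ ∙ s).starProjection x
        + ((ω : ℂ) - 1) • (ℂ ∙ s).starProjection
          (x + (conj (ω : ℂ) - 1) • (ℂ ∙ s).starProjection x) = x
      rw [map_add, map_smul, hidem]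
      match_scalars
      · rfl
      · linear_combination hω⟩

theorem phaseShift_apply {s : X} (hs : ‖s‖ = 1) (ω : Circle) (x : X) :
    phaseShift s ω x = x + (((ω : ℂ) - 1) * inner ℂ s x) • s := by
  change x + ((ω : ℂ) - 1) • (ℂ ∙ s).starProjection x = _
  rw [Submodule.starProjection_unit_singleton ℂ hs, smul_smul]

theorem conj_phaseShift_apply {s : X} (hs : ‖s‖ = 1) (ω : Circle) (U : X ≃ₗᵢ[ℂ] X) (x : X) :
    (U * phaseShift s ω * U⁻¹) x = x + (((ω : ℂ) - 1) * inner ℂ (U s) x) • U s := by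
  simp [phaseShift_apply hs, LinearIsometryEquiv.inner_map_eq_flip]

/-- The sixth root of unity `exp (iπ/3)`, the phase of the fixed-point search. -/
def sixthRoot : Circle := Circle.exp (Real.pi / 3)

theorem sixthRoot_coe :
    (sixthRoot : ℂ) = ((1 / 2 : ℝ) : ℂ) + ((Real.sqrt 3 / 2 : ℝ) : ℂ) * Complex.I := by
  rw [sixthRoot, Circle.coe_exp, Complex.exp_mul_I, ← Complex.ofReal_cos, ← Complex.ofReal_sin,
    Real.cos_pi_div_three, Real.sin_pi_div_three]

theorem normSq_ofReal_add_sixthRoot (x : ℝ) :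
    Complex.normSq ((x : ℂ) + sixthRoot) = x ^ 2 + x + 1 := by
  have h : (x : ℂ) + sixthRoot
      = ((x + 1 / 2 : ℝ) : ℂ) + ((Real.sqrt 3 / 2 : ℝ) : ℂ) * Complex.I := by
    rw [sixthRoot_coe]; push_cast; ring
  rw [h, Complex.normSq_add_mul_I, div_pow, Real.sq_sqrt (by norm_num)]
  ring

theorem sixthRoot_sq : (sixthRoot : ℂ) ^ 2 = sixthRoot - 1 := by
  have h : ((Real.sqrt 3 : ℝ) : ℂ) ^ 2 = 3 := by
    rw [← Complex.ofReal_pow, Real.sq_sqrt (by norm_num)]; norm_num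
  rw [sixthRoot_coe]
  push_cast
  linear_combination (1 / 4 : ℂ) * Complex.I ^ 2 * h + (3 / 4 : ℂ) * Complex.I_sq

/-- The step `U ↦ U R_s U⁻¹ R_t U` of Grover's fixed-point search, with `R` the phase shift by
`exp (iπ/3)`. -/
def fixedPointStep (s t : X) (U : X ≃ₗᵢ[ℂ] X) : X ≃ₗᵢ[ℂ] X :=
  U * phaseShift s sixthRoot * U⁻¹ * phaseShift t sixthRoot * U

theorem inner_fixedPointStep {s t : X} (hs : ‖s‖ = 1) (ht : ‖t‖ = 1) (U : X ≃ₗᵢ[ℂ] X) :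
    inner ℂ t (fixedPointStep s t U s)
      = inner ℂ t (U s) * (sixthRoot * (((1 - ‖inner ℂ t (U s)‖ ^ 2 : ℝ) : ℂ) + sixthRoot)) := by
  have hUs : inner ℂ (U s) (U s) = (1 : ℂ) := by
    rw [inner_self_eq_norm_sq_to_K, U.norm_map, hs]; simp
  have htt : inner ℂ t t = (1 : ℂ) := by rw [inner_self_eq_norm_sq_to_K, ht]; simp
  have hconj : inner ℂ (U s) t = conj (inner ℂ t (U s)) := (inner_conj_symm _ _).symm
  have hstep : fixedPointStep s t U s
      = (U * phaseShift s sixthRoot * U⁻¹) (phaseShift t sixthRoot (U s)) := rfl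
  rw [hstep, conj_phaseShift_apply hs, phaseShift_apply ht, ← Complex.normSq_eq_norm_sq]
  simp only [inner_add_right, inner_smul_right, hUs, htt, hconj, Complex.ofReal_sub,
    Complex.ofReal_one, ← Complex.mul_conj]
  set a := inner ℂ t (U s)
  linear_combination -(a * (1 - conj a * a)) * sixthRoot_sq

theorem one_sub_norm_inner_fixedPointStep {s t : X} (hs : ‖s‖ = 1) (ht : ‖t‖ = 1)
    (U : X ≃ₗᵢ[ℂ] X) :
    1 - ‖inner ℂ t (fixedPointStep s t U s)‖ ^ 2 = (1 - ‖inner ℂ t (U s)‖ ^ 2) ^ 3 := by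
  rw [inner_fixedPointStep hs ht, norm_mul, norm_mul, Circle.norm_coe, one_mul, mul_pow,
    ← Complex.normSq_eq_norm_sq (_ + _), normSq_ofReal_add_sixthRoot]
  ring

/-- The `m`-th iterate of the fixed-point search from `s` to `t`. -/
def fixedPoint (s t : X) (m : ℕ) : X ≃ₗᵢ[ℂ] X := (fixedPointStep s t)^[m] 1

theorem one_sub_norm_inner_fixedPoint {s t : X} (hs : ‖s‖ = 1) (ht : ‖t‖ = 1) (m : ℕ) :
    1 - ‖inner ℂ t (fixedPoint s t m s)‖ ^ 2 = (1 - ‖inner ℂ t s‖ ^ 2) ^ 3 ^ m := by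
  induction m with
  | zero => simp [fixedPoint]
  | succ m ih =>
    rw [fixedPoint, Function.iterate_succ_apply', one_sub_norm_inner_fixedPointStep hs ht,
      ← fixedPoint, ih, ← pow_mul, ← pow_succ]

theorem exists_circle_norm_sub_smul_sq_le {x t : X} (hx : ‖x‖ = 1) (ht : ‖t‖ = 1) {η : ℝ}
    (h : 1 - ‖inner ℂ t x‖ ^ 2 ≤ η) : ∃ c : Circle, ‖x - c • t‖ ^ 2 ≤ 2 * η := by
  obtain ⟨c, hc, hca⟩ := RCLike.exists_norm_eq_mul_self (inner ℂ x t)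
  refine ⟨⟨c, mem_sphere_zero_iff_norm.2 hc⟩, ?_⟩
  have hre : RCLike.re (inner ℂ x (c • t)) = ‖inner ℂ t x‖ := by
    rw [inner_smul_right, ← hca, norm_inner_symm]; simp
  have hle : ‖inner ℂ t x‖ ≤ 1 := by simpa [hx, ht] using norm_inner_le_norm (𝕜 := ℂ) t x
  have hexp : ‖x - c • t‖ ^ 2 = 2 - 2 * ‖inner ℂ t x‖ := by
    rw [norm_sub_sq (𝕜 := ℂ), hre, norm_smul, hc, hx, ht]; ring
  change ‖x - c • t‖ ^ 2 ≤ 2 * η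
  nlinarith [norm_nonneg (inner ℂ t x)]

end Hilbert

section Blocks

variable {C I J : Type*} [Fintype C] [Fintype I] [Fintype J]

/-- The decomposition of a register `C ≃ I × J` into blocks indexed by `I`. -/
def blocks (e : C ≃ I × J) :
    EuclideanSpace ℂ C ≃ₗᵢ[ℂ] PiLp 2 fun _ : I => EuclideanSpace ℂ J :=
  (LinearIsometryEquiv.piLpCongrLeft 2 ℂ ℂ (e.trans (Equiv.sigmaEquivProd I J).symm)).trans
    (LinearIsometryEquiv.piLpCurry ℂ 2 fun _ _ => ℂ)

/-- The `i`-th block of a vector. -/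
def slice (e : C ≃ I × J) (i : I) : EuclideanSpace ℂ C →ₗ[ℂ] EuclideanSpace ℂ J where
  toFun ψ := blocks e ψ i
  map_add' ψ φ := by simp
  map_smul' c ψ := by simp

@[simp] theorem slice_apply (e : C ≃ I × J) (i : I) (ψ : EuclideanSpace ℂ C) (j : J) :
    slice e i ψ j = ψ (e.symm (i, j)) := rfl

theorem norm_sq_eq_sum_slice (e : C ≃ I × J) (ψ : EuclideanSpace ℂ C) :
    ‖ψ‖ ^ 2 = ∑ i, ‖slice e i ψ‖ ^ 2 := by
  rw [← (blocks e).norm_map ψ, PiLp.norm_sq_eq_of_L2]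
  rfl

/-- The block-diagonal unitary with blocks `U i`. -/
def blockIso (e : C ≃ I × J) (U : I → (EuclideanSpace ℂ J ≃ₗᵢ[ℂ] EuclideanSpace ℂ J)) :
    EuclideanSpace ℂ C ≃ₗᵢ[ℂ] EuclideanSpace ℂ C :=
  (blocks e).trans ((LinearIsometryEquiv.piLpCongrRight 2 U).trans (blocks e).symm)

theorem blockIso_apply (e : C ≃ I × J) (U : I → (EuclideanSpace ℂ J ≃ₗᵢ[ℂ] EuclideanSpace ℂ J))
    (ψ : EuclideanSpace ℂ C) (c : C) :
    blockIso e U ψ c = U (e c).1 (slice e (e c).1 ψ) (e c).2 := by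
  simp only [blockIso, blocks, slice]
  simp [Sigma.uncurry]

theorem slice_blockIso (e : C ≃ I × J) (U : I → (EuclideanSpace ℂ J ≃ₗᵢ[ℂ] EuclideanSpace ℂ J))
    (ψ : EuclideanSpace ℂ C) (i : I) : slice e i (blockIso e U ψ) = U i (slice e i ψ) := by
  ext j
  simp [blockIso_apply]

theorem blockIso_mul (e : C ≃ I × J) (U V : I → (EuclideanSpace ℂ J ≃ₗᵢ[ℂ] EuclideanSpace ℂ J)) :
    blockIso e (U * V) = blockIso e U * blockIso e V := by
  ext ψ c
  simp [blockIso_apply, slice_blockIso]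

theorem blockIso_one (e : C ≃ I × J) :
    blockIso e (1 : I → (EuclideanSpace ℂ J ≃ₗᵢ[ℂ] EuclideanSpace ℂ J)) = 1 := by
  ext ψ c
  simp [blockIso_apply]

theorem blockIso_inv (e : C ≃ I × J) (U : I → (EuclideanSpace ℂ J ≃ₗᵢ[ℂ] EuclideanSpace ℂ J)) :
    blockIso e U⁻¹ = (blockIso e U)⁻¹ := by
  rw [eq_inv_iff_mul_eq_one, ← blockIso_mul, inv_mul_cancel, blockIso_one]

/-- The diagonal unitary with phases `φ`. -/
def diagIso (φ : C → Circle) : EuclideanSpace ℂ C ≃ₗᵢ[ℂ] EuclideanSpace ℂ C :=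
  LinearIsometry.toLinearIsometryEquiv
    { toFun := fun ψ => WithLp.toLp 2 fun c => (φ c : ℂ) * ψ c
      map_add' := fun ψ χ => by ext c; simp [mul_add]
      map_smul' := fun r ψ => by ext c; simp [mul_left_comm]
      norm_map' := fun ψ => by simp [EuclideanSpace.norm_eq, Circle.norm_coe] } rfl

@[simp] theorem diagIso_apply (φ : C → Circle) (ψ : EuclideanSpace ℂ C) (c : C) :
    diagIso φ ψ c = (φ c : ℂ) * ψ c := rfl

end Blocks

section Averaging

variable {E : Type*} [NormedAddCommGroup E] [InnerProductSpace ℂ E]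

/-- Unitaries as elements of the endomorphism algebra, where they can be averaged. -/
def toEnd : (E ≃ₗᵢ[ℂ] E) →* Module.End ℂ E where
  toFun W := W.toLinearEquiv.toLinearMap
  map_one' := rfl
  map_mul' _ _ := rfl

@[simp] theorem toEnd_apply (W : E ≃ₗᵢ[ℂ] E) (x : E) : toEnd W x = W x := rfl

theorem toEnd_pow_apply_of_fixed {W : E ≃ₗᵢ[ℂ] E} {x : E} (h : W x = x) (k : ℕ) :
    (toEnd W ^ k) x = x := by
  rw [Module.End.coe_pow]
  exact Function.iterate_fixed h k

theorem norm_toEnd_pow_apply (W : E ≃ₗᵢ[ℂ] E) (k : ℕ) (x : E) : ‖(toEnd W ^ k) x‖ = ‖x‖ := by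
  rw [← map_pow, toEnd_apply, LinearIsometryEquiv.norm_map]

theorem inner_toEnd_pow (W : E ≃ₗᵢ[ℂ] E) (k : ℕ) (x y : E) :
    inner ℂ ((toEnd W ^ k) x) y = inner ℂ x ((toEnd W⁻¹ ^ k) y) := by
  rw [← map_pow, ← map_pow, inv_pow, toEnd_apply, toEnd_apply,
    LinearIsometryEquiv.inner_map_eq_flip, LinearIsometryEquiv.coe_inv]

theorem commute_toEnd_inv (W : E ≃ₗᵢ[ℂ] E) : Commute (toEnd W) (toEnd W⁻¹) := by
  rw [commute_iff_eq, ← map_mul, ← map_mul, mul_inv_cancel, inv_mul_cancel]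

/-- The average of the first `T` powers of `W`, an approximation of the projection to the fixed
space of `W`. -/
def average (W : E ≃ₗᵢ[ℂ] E) (T : ℕ) : Module.End ℂ E :=
  (T : ℂ)⁻¹ • ∑ k ∈ Finset.range T, toEnd W ^ k

theorem inner_average (W : E ≃ₗᵢ[ℂ] E) (T : ℕ) (x y : E) :
    inner ℂ (average W T x) y = inner ℂ x (average W⁻¹ T y) := by
  simp [average, inner_toEnd_pow, mul_comm]

theorem commute_average_inv (W : E ≃ₗᵢ[ℂ] E) (T : ℕ) :
    Commute (average W T) (average W⁻¹ T) :=
  (Commute.sum_left _ _ _ fun k _ => Commute.sum_right _ _ _ fun l _ =>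
    (commute_toEnd_inv W).pow_pow k l).smul_right _ |>.smul_left _

theorem norm_average_sub_apply_le (W : E ≃ₗᵢ[ℂ] E) (T : ℕ) (y : E) :
    ‖average W T (y - W y)‖ ≤ (T : ℝ)⁻¹ * (2 * ‖y‖) := by
  have htelescope : (∑ k ∈ Finset.range T, toEnd W ^ k) (y - W y) = y - (toEnd W ^ T) y := by
    have h := congrArg (fun A : Module.End ℂ E => A y) (geom_sum_mul_neg (toEnd W) T)
    simpa only [Module.End.mul_apply, LinearMap.sub_apply, Module.End.one_apply, toEnd_apply]
      using h
  rw [average, LinearMap.smul_apply, htelescope, norm_smul, norm_inv, Complex.norm_natCast]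
  gcongr
  calc ‖y - (toEnd W ^ T) y‖ ≤ ‖y‖ + ‖(toEnd W ^ T) y‖ := norm_sub_le _ _
    _ = 2 * ‖y‖ := by rw [norm_toEnd_pow_apply]; ring

theorem norm_apply_sub_sq (W : E ≃ₗᵢ[ℂ] E) (x : E) :
    ‖W x - x‖ ^ 2 = RCLike.re (inner ℂ x ((2 : ℂ) • x - (W x + W⁻¹ x))) := by
  have hadj : inner ℂ x (W⁻¹ x) = inner ℂ (W x) x := by
    rw [LinearIsometryEquiv.inner_map_eq_flip, LinearIsometryEquiv.coe_inv]
  have hself : RCLike.re (inner ℂ x ((2 : ℂ) • x)) = 2 * ‖x‖ ^ 2 := by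
    rw [two_smul, inner_add_right, map_add, inner_self_eq_norm_sq, two_mul]
  rw [norm_sub_sq (𝕜 := ℂ), W.norm_map, inner_sub_right, inner_add_right, hadj, map_sub, map_add,
    hself, inner_re_symm x (W x)]
  ring

theorem norm_pow_apply_le_of_normal {K L : Module.End ℂ E} {S : Submodule ℂ E} {c : ℝ}
    (hc : 0 ≤ c) (hadj : ∀ x y, inner ℂ (K x) y = inner ℂ x (L y)) (hcomm : Commute K L)
    (hS : ∀ v ∈ S, (L * K) v ∈ S) (hK : ∀ v ∈ S, ‖K v‖ ≤ c * ‖v‖) (r : ℕ) {v : E} (hv : v ∈ S) :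
    ‖(K ^ r) v‖ ≤ c ^ r * ‖v‖ := by
  have hsq (x : E) : ‖x‖ ^ 2 = ‖inner ℂ x x‖ := by rw [inner_self_eq_norm_sq_to_K]; simp
  have hLK (x : E) (hx : x ∈ S) : ‖(L * K) x‖ ≤ c ^ 2 * ‖x‖ := by
    have h : ‖(L * K) x‖ * ‖(L * K) x‖ ≤ (c ^ 2 * ‖x‖) * ‖(L * K) x‖ := calc
      ‖(L * K) x‖ * ‖(L * K) x‖ = ‖inner ℂ (K ((L * K) x)) (K x)‖ := by
        rw [← sq, hsq, hadj]; rfl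
      _ ≤ ‖K ((L * K) x)‖ * ‖K x‖ := norm_inner_le_norm _ _
      _ ≤ (c * ‖(L * K) x‖) * (c * ‖x‖) := by
        gcongr
        exacts [hK _ (hS x hx), hK x hx]
      _ = (c ^ 2 * ‖x‖) * ‖(L * K) x‖ := by ring
    rcases (norm_nonneg ((L * K) x)).eq_or_lt with h0 | hpos
    · rw [← h0]; positivity
    · exact le_of_mul_le_mul_right h hpos
  have hpow (n : ℕ) : ((L * K) ^ n) v ∈ S ∧ ‖((L * K) ^ n) v‖ ≤ (c ^ 2) ^ n * ‖v‖ := by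
    induction n with
    | zero => simpa using hv
    | succ n ih =>
      rw [pow_succ', Module.End.mul_apply]
      refine ⟨hS _ ih.1, (hLK _ ih.1).trans ?_⟩
      calc c ^ 2 * ‖((L * K) ^ n) v‖ ≤ c ^ 2 * ((c ^ 2) ^ n * ‖v‖) := by gcongr; exact ih.2
        _ = (c ^ 2) ^ (n + 1) * ‖v‖ := by ring
  have hadj_pow (n : ℕ) (x y : E) : inner ℂ ((K ^ n) x) y = inner ℂ x ((L ^ n) y) := by
    induction n generalizing x y with
    | zero => simp
    | succ n ih =>
      rw [pow_succ', Module.End.mul_apply, hadj, ih, pow_succ, Module.End.mul_apply]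
  refine (sq_le_sq₀ (norm_nonneg _) (by positivity)).1 ?_
  calc ‖(K ^ r) v‖ ^ 2 = ‖inner ℂ v (((L * K) ^ r) v)‖ := by
        rw [hsq, hadj_pow, hcomm.symm.mul_pow]; rfl
    _ ≤ ‖v‖ * ‖((L * K) ^ r) v‖ := norm_inner_le_norm _ _
    _ ≤ ‖v‖ * ((c ^ 2) ^ r * ‖v‖) := by gcongr; exact (hpow r).2
    _ = (c ^ r * ‖v‖) ^ 2 := by ring

section InvariantSubspace

variable {W : E ≃ₗᵢ[ℂ] E} {S : Submodule ℂ E}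

theorem toEnd_pow_add_inv_mem (hS : ∀ v ∈ S, W v + W⁻¹ v ∈ S) (n : ℕ) :
    ∀ v ∈ S, (toEnd W ^ n) v + (toEnd W⁻¹ ^ n) v ∈ S := by
  induction n using Nat.twoStepInduction with
  | zero => intro v hv; simpa using S.add_mem hv hv
  | one => intro v hv; simpa using hS v hv
  | more n ih ih' =>
    intro v hv
    convert S.sub_mem (ih' _ (hS v hv)) (ih v hv) using 1
    simp only [pow_succ, Module.End.mul_apply, toEnd_apply, map_add,
      LinearIsometryEquiv.coe_inv, W.apply_symm_apply, W.symm_apply_apply]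
    abel

theorem toEnd_inv_pow_mul_pow_add_mem (hS : ∀ v ∈ S, W v + W⁻¹ v ∈ S) (j k : ℕ) {v : E}
    (hv : v ∈ S) :
    (toEnd W⁻¹ ^ j * toEnd W ^ k + toEnd W⁻¹ ^ k * toEnd W ^ j) v ∈ S := by
  wlog hjk : j ≤ k generalizing j k
  · rw [add_comm]
    exact this k j (le_of_not_ge hjk)
  obtain ⟨n, rfl⟩ := Nat.exists_eq_add_of_le hjk
  have hcancel : toEnd W⁻¹ ^ j * toEnd W ^ j = 1 := by
    rw [← map_pow, ← map_pow, ← map_mul, inv_pow, inv_mul_cancel, map_one]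
  rw [pow_add, ← mul_assoc, hcancel, one_mul, add_comm j n, pow_add, mul_assoc, hcancel, mul_one]
  exact toEnd_pow_add_inv_mem hS n v hv

theorem average_inv_mul_average_mem (hS : ∀ v ∈ S, W v + W⁻¹ v ∈ S) (T : ℕ) {v : E}
    (hv : v ∈ S) : (average W⁻¹ T * average W T) v ∈ S := by
  have hsymm : average W⁻¹ T * average W T = (2⁻¹ * ((T : ℂ)⁻¹ * (T : ℂ)⁻¹)) •
      ∑ j ∈ Finset.range T, ∑ k ∈ Finset.range T,
        (toEnd W⁻¹ ^ j * toEnd W ^ k + toEnd W⁻¹ ^ k * toEnd W ^ j) := by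
    simp only [Finset.sum_add_distrib]
    rw [Finset.sum_comm (f := fun j k => toEnd W⁻¹ ^ k * toEnd W ^ j), ← two_smul ℂ, smul_smul,
      average, average, smul_mul_smul_comm, Finset.sum_mul_sum]
    congr 1
    ring
  simp only [hsymm, LinearMap.smul_apply, LinearMap.sum_apply]
  exact S.smul_mem _ (S.sum_mem fun j _ => S.sum_mem fun k _ =>
    toEnd_inv_pow_mul_pow_add_mem hS j k hv)

variable {δ : ℝ} [FiniteDimensional ℂ S]

theorem exists_mem_eq_two_smul_sub (hδ : 0 < δ) (hS : ∀ v ∈ S, W v + W⁻¹ v ∈ S)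
    (hgap : ∀ v ∈ S, 4 * δ * ‖v‖ ^ 2 ≤ ‖W v - v‖ ^ 2) {v : E} (hv : v ∈ S) :
    ∃ w ∈ S, v = (2 : ℂ) • w - (W w + W⁻¹ w) := by
  let D : S →ₗ[ℂ] S := ((2 : ℂ) • (1 : Module.End ℂ E) - (toEnd W + toEnd W⁻¹)).restrict
    fun x hx => S.sub_mem (S.smul_mem 2 hx) (hS x hx)
  have hD (x : S) : (D x : E) = (2 : ℂ) • (x : E) - (W x + W⁻¹ x) := rfl
  have hinj : Function.Injective D := by
    rw [← LinearMap.ker_eq_bot, LinearMap.ker_eq_bot']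
    intro x hx
    have hle : 4 * δ * ‖(x : E)‖ ^ 2 ≤ 0 := by
      have h := hgap x x.2
      rwa [norm_apply_sub_sq, ← hD, hx, ZeroMemClass.coe_zero, inner_zero_right, map_zero] at h
    have hx0 : ‖(x : E)‖ ^ 2 = 0 := by nlinarith [sq_nonneg ‖(x : E)‖]
    exact Subtype.ext (norm_eq_zero.1 (pow_eq_zero_iff two_ne_zero |>.1 hx0))
  obtain ⟨w, hw⟩ := LinearMap.injective_iff_surjective.1 hinj ⟨v, hv⟩
  exact ⟨w, w.2, by rw [← hD, hw]⟩

theorem exists_eq_sub_apply (hδ : 0 < δ) (hS : ∀ v ∈ S, W v + W⁻¹ v ∈ S)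
    (hgap : ∀ v ∈ S, 4 * δ * ‖v‖ ^ 2 ≤ ‖W v - v‖ ^ 2) {v : E} (hv : v ∈ S) :
    ∃ y, v = y - W y ∧ 2 * Real.sqrt δ * ‖y‖ ≤ ‖v‖ := by
  obtain ⟨w, hwS, hw⟩ := exists_mem_eq_two_smul_sub hδ hS hgap hv
  have hWy : W (w - W⁻¹ w) = W w - w := by simp
  refine ⟨w - W⁻¹ w, by rw [hWy, hw]; module, ?_⟩
  have hy : ‖w - W⁻¹ w‖ = ‖W w - w‖ := by rw [← W.norm_map, hWy]
  have hle : ‖W w - w‖ ^ 2 ≤ ‖w‖ * ‖v‖ := by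
    rw [norm_apply_sub_sq, ← hw]
    exact (RCLike.re_le_norm _).trans (norm_inner_le_norm _ _)
  have hwv : 4 * δ * ‖w‖ ≤ ‖v‖ := by
    rcases (norm_nonneg w).eq_or_lt with h0 | hpos
    · rw [← h0]; simp
    · exact le_of_mul_le_mul_right (by nlinarith [hgap w hwS]) hpos
  refine (sq_le_sq₀ (by positivity) (norm_nonneg _)).1 ?_
  rw [hy, mul_pow, mul_pow, Real.sq_sqrt hδ.le]
  nlinarith [norm_nonneg v]

theorem norm_average_apply_le (hδ : 0 < δ) (hS : ∀ v ∈ S, W v + W⁻¹ v ∈ S)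
    (hgap : ∀ v ∈ S, 4 * δ * ‖v‖ ^ 2 ≤ ‖W v - v‖ ^ 2) {T : ℕ} (hT : 2 ≤ T * Real.sqrt δ)
    {v : E} (hv : v ∈ S) : ‖average W T v‖ ≤ 1 / 2 * ‖v‖ := by
  obtain ⟨y, rfl, hy⟩ := exists_eq_sub_apply hδ hS hgap hv
  have hTpos : (0 : ℝ) < T := by
    by_contra h
    nlinarith [Real.sqrt_nonneg δ]
  refine (norm_average_sub_apply_le W T y).trans ?_
  rw [inv_mul_le_iff₀ hTpos]
  have h : (2 * ‖y‖) * 2 ≤ (2 * ‖y‖) * (T * Real.sqrt δ) := by gcongr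
  nlinarith

theorem norm_average_pow_apply_le (hδ : 0 < δ) (hS : ∀ v ∈ S, W v + W⁻¹ v ∈ S)
    (hgap : ∀ v ∈ S, 4 * δ * ‖v‖ ^ 2 ≤ ‖W v - v‖ ^ 2) {T : ℕ} (hT : 2 ≤ T * Real.sqrt δ)
    (r : ℕ) {v : E} (hv : v ∈ S) : ‖(average W T ^ r) v‖ ≤ (1 / 2) ^ r * ‖v‖ :=
  norm_pow_apply_le_of_normal (by norm_num) (inner_average W T) (commute_average_inv W T)
    (fun _ => average_inv_mul_average_mem hS T) (fun _ => norm_average_apply_le hδ hS hgap hT) r hv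

end InvariantSubspace

end Averaging

section Discriminant

variable {Ω : Type*}

/-- The discriminant of a chain, the symmetric matrix with entries `√(P x y) √(P y x)`. For a
reversible chain it is similar to `P`. -/
def discriminant (P : Matrix Ω Ω ℝ) : Matrix Ω Ω ℝ :=
  Matrix.of fun x y => Real.sqrt (P x y) * Real.sqrt (P y x)

theorem discriminant_isHermitian (P : Matrix Ω Ω ℝ) : (discriminant P).IsHermitian := by
  ext x y
  simp [discriminant, mul_comm]

variable [Fintype Ω]

theorem sum_sq_mulVec_le_of_isHermitian {A : Matrix Ω Ω ℝ} (hA : A.IsHermitian) {c : ℝ}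
    {f : Ω → ℝ} (h : ∀ (μ : ℝ) (v : Ω → ℝ), v ≠ 0 → A.mulVec v = μ • v → c < |μ| → v ⬝ᵥ f = 0) :
    ∑ x, A.mulVec f x ^ 2 ≤ c ^ 2 * ∑ x, f x ^ 2 := by
  classical
  set b := hA.eigenvectorBasis
  have hinner (i : Ω) (g : Ω → ℝ) : b.repr (WithLp.toLp 2 g) i = (b i).ofLp ⬝ᵥ g := by
    rw [b.repr_apply_apply, EuclideanSpace.inner_eq_star_dotProduct, dotProduct_comm]; rfl
  have hparseval (g : Ω → ℝ) : ∑ x, g x ^ 2 = ∑ i, ((b i).ofLp ⬝ᵥ g) ^ 2 := by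
    have hnorm := congrArg (· ^ 2) (b.repr.norm_map (WithLp.toLp 2 g))
    simp only [EuclideanSpace.norm_sq_eq, Real.norm_eq_abs, sq_abs, hinner] at hnorm
    exact hnorm.symm
  have hcoef (i : Ω) : (b i).ofLp ⬝ᵥ A.mulVec f = hA.eigenvalues i * ((b i).ofLp ⬝ᵥ f) := by
    rw [Matrix.dotProduct_mulVec, ← Matrix.mulVec_transpose,
      ← Matrix.conjTranspose_eq_transpose_of_trivial, hA.eq, hA.mulVec_eigenvectorBasis,
      smul_dotProduct, smul_eq_mul]
  rw [hparseval, hparseval f, Finset.mul_sum]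
  refine Finset.sum_le_sum fun i _ => ?_
  rw [hcoef, mul_pow]
  rcases le_or_gt |hA.eigenvalues i| c with hle | hlt
  · gcongr ?_ * _
    exact sq_le_sq' (abs_le.1 hle).1 (abs_le.1 hle).2
  · have hne : (b i).ofLp ≠ 0 := fun h0 => b.orthonormal.ne_zero i (by ext x; simp [h0])
    rw [h _ _ hne (hA.mulVec_eigenvectorBasis i) hlt]
    simp

variable [DecidableEq Ω]

theorem abs_le_of_le_spectralGap {P : Matrix Ω Ω ℝ} {δ : ℝ} (h : δ ≤ spectralGap P) {μ : ℝ}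
    (hμ : Module.End.HasEigenvalue (Matrix.toLin' P) μ) (hμ1 : μ ≠ 1) : |μ| ≤ 1 - δ := by
  have hfin : {r : ℝ | ∃ μ : ℝ, Module.End.HasEigenvalue (Matrix.toLin' P) μ ∧ μ ≠ 1 ∧
      r = |μ|}.Finite := by
    refine ((Module.End.finite_hasEigenvalue (Matrix.toLin' P)).image abs).subset ?_
    rintro r ⟨μ, hμ, -, rfl⟩
    exact ⟨μ, hμ, rfl⟩
  have hle := le_csSup hfin.bddAbove ⟨μ, hμ, hμ1, rfl⟩
  unfold spectralGap at h
  linarith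

theorem spectralGap_le_one (P : Matrix Ω Ω ℝ) : spectralGap P ≤ 1 := by
  refine sub_le_self _ (Real.sSup_nonneg ?_)
  rintro r ⟨μ, -, -, rfl⟩
  exact abs_nonneg μ

theorem apply_eq_of_mulVec_eq_self {P : Matrix Ω Ω ℝ} (hP : P ∈ Matrix.rowStochastic ℝ Ω)
    (hprim : P.IsPrimitive) {g : Ω → ℝ} (hg : P.mulVec g = g) (x y : Ω) : g x = g y := by
  obtain ⟨k, -, hk⟩ := hprim.exists_pos_pow
  have hgk (n : ℕ) : (P ^ n).mulVec g = g := by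
    induction n with
    | zero => simp
    | succ n ih => rw [pow_succ, ← Matrix.mulVec_mulVec, hg, ih]
  obtain ⟨m, -, hm⟩ := Finset.exists_max_image Finset.univ g ⟨x, Finset.mem_univ x⟩
  have hmean : ∑ w, (P ^ k) m w * g w = g m := congrFun (hgk k) m
  have hsum : ∑ w, (P ^ k) m w * (g m - g w) = 0 := by
    simp only [mul_sub, Finset.sum_sub_distrib, ← Finset.sum_mul, hmean,
      Matrix.sum_row_of_mem_rowStochastic (pow_mem hP k), one_mul, sub_self]
  have hmax (w : Ω) : g w = g m := by
    have hw := (Finset.sum_eq_zero_iff_of_nonneg fun w _ =>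
      mul_nonneg (hk m w).le (sub_nonneg.2 (hm w (Finset.mem_univ w)))).1 hsum w (Finset.mem_univ w)
    exact (sub_eq_zero.1 ((mul_eq_zero.1 hw).resolve_left (hk m w).ne')).symm
  rw [hmax x, hmax y]

section Reversible

variable {P : Matrix Ω Ω ℝ} {p : Ω → ℝ}

theorem discriminant_apply_of_reversible (hP : P ∈ Matrix.rowStochastic ℝ Ω) (hp : ∀ x, 0 < p x)
    (hrev : ∀ x y, p x * P x y = p y * P y x) (x y : Ω) :
    discriminant P x y = Real.sqrt (p x) * P x y / Real.sqrt (p y) := by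
  have hPxy : 0 ≤ P x y := Matrix.nonneg_of_mem_rowStochastic hP
  have hPyx : P y x = p x * P x y / p y := by rw [hrev x y, mul_div_cancel_left₀ _ (hp y).ne']
  rw [discriminant, Matrix.of_apply, hPyx, Real.sqrt_div (mul_nonneg (hp x).le hPxy),
    Real.sqrt_mul (hp x).le]
  linear_combination (Real.sqrt (p x) / Real.sqrt (p y)) * Real.mul_self_sqrt hPxy

theorem mulVec_div_sqrt_of_discriminant (hP : P ∈ Matrix.rowStochastic ℝ Ω) (hp : ∀ x, 0 < p x)
    (hrev : ∀ x y, p x * P x y = p y * P y x) {μ : ℝ} {v : Ω → ℝ}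
    (hv : (discriminant P).mulVec v = μ • v) :
    (P.mulVec fun x => v x / Real.sqrt (p x)) = μ • fun x => v x / Real.sqrt (p x) := by
  have hsqrt (x : Ω) : Real.sqrt (p x) ≠ 0 := (Real.sqrt_pos.2 (hp x)).ne'
  ext x
  have hvx := congrFun hv x
  simp only [Matrix.mulVec, dotProduct, Pi.smul_apply, smul_eq_mul,
    discriminant_apply_of_reversible hP hp hrev] at hvx ⊢
  rw [← mul_div_assoc, ← hvx, Finset.sum_div]
  refine Finset.sum_congr rfl fun y _ => ?_
  field_simp [hsqrt x, hsqrt y]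

theorem sum_sq_discriminant_mulVec_le {δ : ℝ} (hP : P ∈ Matrix.rowStochastic ℝ Ω)
    (hprim : P.IsPrimitive) (hp : ∀ x, 0 < p x) (hrev : ∀ x y, p x * P x y = p y * P y x)
    (hδ : δ ≤ spectralGap P) (f : Ω → ℝ) (hf : ∑ x, Real.sqrt (p x) * f x = 0) :
    ∑ x, (discriminant P).mulVec f x ^ 2 ≤ (1 - δ) ^ 2 * ∑ x, f x ^ 2 := by
  refine sum_sq_mulVec_le_of_isHermitian (discriminant_isHermitian P) fun μ v hv hDv hμ => ?_
  have hsqrt (x : Ω) : Real.sqrt (p x) ≠ 0 := (Real.sqrt_pos.2 (hp x)).ne'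
  have hPv := mulVec_div_sqrt_of_discriminant hP hp hrev hDv
  have heig : Module.End.HasEigenvalue (Matrix.toLin' P) μ := by
    refine Module.End.hasEigenvalue_of_hasEigenvector (x := fun x => v x / Real.sqrt (p x))
      ⟨Module.End.mem_eigenspace_iff.2 hPv, fun h0 => hv ?_⟩
    ext x
    simpa [hsqrt x] using congrFun h0 x
  obtain rfl : μ = 1 := by
    by_contra hμ1
    exact (abs_le_of_le_spectralGap hδ heig hμ1).not_gt hμ
  have hconst := apply_eq_of_mulVec_eq_self hP hprim (hPv.trans (one_smul ℝ _))
  obtain ⟨x₀, -⟩ := Function.ne_iff.1 hv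
  have hvx (x : Ω) : v x = v x₀ / Real.sqrt (p x₀) * Real.sqrt (p x) := by
    rw [← hconst x x₀, div_mul_cancel₀ _ (hsqrt x)]
  calc v ⬝ᵥ f = ∑ x, v x₀ / Real.sqrt (p x₀) * (Real.sqrt (p x) * f x) :=
        Finset.sum_congr rfl fun x _ => by rw [hvx x, mul_assoc]
    _ = 0 := by rw [← Finset.mul_sum, hf, mul_zero]

end Reversible

end Discriminant

section ReflectionWalk

variable {E : Type*} [NormedAddCommGroup E] [InnerProductSpace ℂ E] {A : Submodule ℂ E}
  {X : E ≃ₗᵢ[ℂ] E}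

theorem norm_starProjection_sub_sq [A.HasOrthogonalProjection] (x : E) :
    ‖A.starProjection x - x‖ ^ 2 = ‖x‖ ^ 2 - ‖A.starProjection x‖ ^ 2 := by
  have h := A.norm_sq_eq_add_norm_sq_starProjection x
  rw [Submodule.starProjection_orthogonal_val, norm_sub_rev] at h
  linarith

section Apply

variable [A.HasOrthogonalProjection]

/-- The product of the reflections about `A` and about `X A`. -/
def reflectionWalk (A : Submodule ℂ E) [A.HasOrthogonalProjection] (X : E ≃ₗᵢ[ℂ] E) :
    E ≃ₗᵢ[ℂ] E :=
  (A.map (X.toLinearEquiv : E →ₗ[ℂ] E)).reflection * A.reflection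

theorem reflectionWalk_apply_of_mem (hX : Function.Involutive X) {x : E} (hx : x ∈ A) :
    reflectionWalk A X x = X (A.reflection (X x)) := by
  rw [reflectionWalk, LinearIsometryEquiv.coe_mul, Function.comp_apply,
    Submodule.reflection_map_apply, Submodule.reflection_mem_subspace_eq_self hx,
    X.symm_apply_eq.2 (hX x).symm]

theorem reflectionWalk_inv_apply (hX : Function.Involutive X) (x : E) :
    (reflectionWalk A X)⁻¹ x = A.reflection (X (A.reflection (X x))) := by
  rw [reflectionWalk, mul_inv_rev, Submodule.reflection_inv, Submodule.reflection_inv,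
    LinearIsometryEquiv.coe_mul, Function.comp_apply, Submodule.reflection_map_apply,
    X.symm_apply_eq.2 (hX x).symm]

theorem reflectionWalk_add_inv_apply_of_mem (hX : Function.Involutive X) {x : E} (hx : x ∈ A) :
    reflectionWalk A X x + (reflectionWalk A X)⁻¹ x
      = (2 : ℂ) • A.starProjection (X (A.reflection (X x))) := by
  rw [reflectionWalk_apply_of_mem hX hx, reflectionWalk_inv_apply hX]
  generalize X (A.reflection (X x)) = y
  rw [A.reflection_apply, two_smul, two_smul]
  abel

theorem reflectionWalk_add_inv_apply_mem (hX : Function.Involutive X) {s : E} (hs : s ∈ A)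
    (hXs : X s = s) {x : E} (hx : x ∈ A ⊓ (ℂ ∙ s)ᗮ) :
    reflectionWalk A X x + (reflectionWalk A X)⁻¹ x ∈ A ⊓ (ℂ ∙ s)ᗮ := by
  have hAs : A.reflection s = s := Submodule.reflection_mem_subspace_eq_self hs
  rw [reflectionWalk_add_inv_apply_of_mem hX hx.1]
  refine Submodule.smul_mem _ _ ⟨Submodule.starProjection_apply_mem _ _,
    Submodule.mem_orthogonal_singleton_iff_inner_right.2 ?_⟩
  calc inner ℂ s (A.starProjection (X (A.reflection (X x))))
      = inner ℂ s (X (A.reflection (X x))) := by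
        rw [← Submodule.inner_starProjection_left_eq_right,
          Submodule.starProjection_eq_self_iff.2 hs]
    _ = inner ℂ (X (A.reflection (X s))) (X (A.reflection (X x))) := by rw [hXs, hAs, hXs]
    _ = inner ℂ s x := by simp only [LinearIsometryEquiv.inner_map_map]
    _ = 0 := Submodule.mem_orthogonal_singleton_iff_inner_right.1 hx.2

theorem norm_reflectionWalk_apply_sub_sq (hX : Function.Involutive X) {x : E} (hx : x ∈ A) :
    ‖reflectionWalk A X x - x‖ ^ 2 = 4 * (‖x‖ ^ 2 - ‖A.starProjection (X x)‖ ^ 2) := by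
  have htwo : A.reflection (X x) - X x = (2 : ℂ) • (A.starProjection (X x) - X x) := by
    rw [Submodule.reflection_apply, two_smul, two_smul]
    abel
  have hnorm : ‖reflectionWalk A X x - x‖ = ‖A.reflection (X x) - X x‖ := by
    rw [reflectionWalk_apply_of_mem hX hx, ← X.norm_map (A.reflection (X x) - X x), map_sub, hX]
  rw [hnorm, htwo, norm_smul, mul_pow, norm_starProjection_sub_sq, X.norm_map]
  norm_num

end Apply

theorem norm_average_reflectionWalk_pow_apply_le [FiniteDimensional ℂ A]
    (hX : Function.Involutive X) {s : E} (hs : s ∈ A) (hXs : X s = s) {δ : ℝ} (hδ : 0 < δ)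
    (hδ1 : δ ≤ 1)
    (hD : ∀ v ∈ A, inner ℂ s v = 0 → ‖A.starProjection (X v)‖ ^ 2 ≤ (1 - δ) ^ 2 * ‖v‖ ^ 2)
    {T : ℕ} (hT : 2 ≤ T * Real.sqrt δ) (r : ℕ) {v : E} (hv : v ∈ A) (hsv : inner ℂ s v = 0) :
    ‖(average (reflectionWalk A X) T ^ r) v‖ ≤ (1 / 2) ^ r * ‖v‖ := by
  refine norm_average_pow_apply_le (S := A ⊓ (ℂ ∙ s)ᗮ) hδ
    (fun _ => reflectionWalk_add_inv_apply_mem hX hs hXs) (fun x hx => ?_) hT r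
    ⟨hv, Submodule.mem_orthogonal_singleton_iff_inner_right.2 hsv⟩
  rw [norm_reflectionWalk_apply_sub_sq hX hx.1]
  nlinarith [hD x hx.1 (Submodule.mem_orthogonal_singleton_iff_inner_right.1 hx.2),
    mul_nonneg (mul_nonneg hδ.le (sub_nonneg.2 hδ1)) (sq_nonneg ‖x‖)]

end ReflectionWalk

section Walk

variable {Ω : Type*}

/-- The coherent encoding `∑ x, √(p x) |x⟩` of a distribution. -/
def qsample (p : Ω → ℝ) : EuclideanSpace ℂ Ω := WithLp.toLp 2 fun x => ((Real.sqrt (p x) : ℝ) : ℂ)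

@[simp] theorem qsample_apply (p : Ω → ℝ) (x : Ω) : qsample p x = (Real.sqrt (p x) : ℂ) := rfl

variable [Fintype Ω]

/-- The component of a state along `|z⟩` in the second register. -/
def restrictA (z : Ω) (ψ : TwoReg Ω) : EuclideanSpace ℂ Ω := WithLp.toLp 2 fun x => ψ (x, z)

@[simp] theorem restrictA_apply (z : Ω) (ψ : TwoReg Ω) (x : Ω) : restrictA z ψ x = ψ (x, z) := rfl

theorem swapReg_apply (ψ : TwoReg Ω) (q : Ω × Ω) : swapReg Ω ψ q = ψ (q.2, q.1) := rfl

/-- The unitary `U† S U`, which maps `𝒜` to `ℬ`. -/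
def updateSwap (U : TwoReg Ω ≃ₗᵢ[ℂ] TwoReg Ω) : TwoReg Ω ≃ₗᵢ[ℂ] TwoReg Ω :=
  U⁻¹ * swapReg Ω * U

theorem updateSwap_apply (U : TwoReg Ω ≃ₗᵢ[ℂ] TwoReg Ω) (ψ : TwoReg Ω) :
    updateSwap U ψ = U.symm (swapReg Ω (U ψ)) := rfl

theorem updateSwap_involutive (U : TwoReg Ω ≃ₗᵢ[ℂ] TwoReg Ω) :
    Function.Involutive (updateSwap U) := by
  intro ψ
  rw [updateSwap_apply, updateSwap_apply, LinearIsometryEquiv.apply_symm_apply,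
    LinearIsometryEquiv.symm_apply_eq]
  ext q
  simp only [swapReg_apply]

theorem inner_qsample (p : Ω → ℝ) (v : EuclideanSpace ℂ Ω) :
    inner ℂ (qsample p) v = ∑ x, (Real.sqrt (p x) : ℂ) * v x := by
  simp [PiLp.inner_apply, mul_comm]

variable [DecidableEq Ω] (z : Ω)

/-- The embedding `v ↦ v ⊗ |z⟩` onto `𝒜`. -/
def inA : EuclideanSpace ℂ Ω →ₗᵢ[ℂ] TwoReg Ω where
  toFun v := WithLp.toLp 2 fun q => if q.2 = z then v q.1 else 0
  map_add' v w := by ext q; by_cases h : q.2 = z <;> simp [h]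
  map_smul' c v := by ext q; by_cases h : q.2 = z <;> simp [h]
  norm_map' v := by
    rw [← sq_eq_sq₀ (norm_nonneg _) (norm_nonneg _)]
    simp only [EuclideanSpace.norm_sq_eq, Fintype.sum_prod_type, LinearMap.coe_mk, AddHom.coe_mk]
    refine Finset.sum_congr rfl fun x _ => ?_
    rw [Finset.sum_eq_single z] <;> simp +contextual

@[simp] theorem inA_apply (v : EuclideanSpace ℂ Ω) (q : Ω × Ω) :
    inA z v q = if q.2 = z then v q.1 else 0 := rfl

theorem inA_eq_sum (v : EuclideanSpace ℂ Ω) :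
    inA z v = ∑ x, v x • EuclideanSpace.single (x, z) (1 : ℂ) := by
  ext ⟨x, y⟩
  simp only [inA_apply, WithLp.ofLp_sum, Finset.sum_apply, PiLp.smul_apply,
    PiLp.single_apply, Prod.mk.injEq, smul_eq_mul, mul_ite, mul_one, mul_zero]
  rw [Finset.sum_eq_single x] <;> simp +contextual [eq_comm]

theorem inA_mem_spaceA (v : EuclideanSpace ℂ Ω) : inA z v ∈ spaceA z := by
  rw [inA_eq_sum]
  exact Submodule.sum_mem _ fun x _ => Submodule.smul_mem _ _ (Submodule.subset_span ⟨x, rfl⟩)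

theorem starProjection_spaceA (ψ : TwoReg Ω) :
    (spaceA z).starProjection ψ = inA z (restrictA z ψ) := by
  refine Submodule.eq_starProjection_of_mem_of_inner_eq_zero (inA_mem_spaceA z _) fun w hw => ?_
  induction hw using Submodule.span_induction with
  | mem w hw =>
    obtain ⟨x, rfl⟩ := hw
    simp [EuclideanSpace.inner_single_right]
  | zero => simp
  | add u w _ _ hu hw => rw [inner_add_right, hu, hw, add_zero]
  | smul c w _ hw => rw [inner_smul_right, hw, mul_zero]

theorem eq_inA_restrictA {ψ : TwoReg Ω} (h : ψ ∈ spaceA z) : ψ = inA z (restrictA z ψ) := by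
  rw [← starProjection_spaceA, Submodule.starProjection_eq_self_iff.2 h]

theorem walkOp_eq_reflectionWalk (U : TwoReg Ω ≃ₗᵢ[ℂ] TwoReg Ω) :
    walkOp z U = reflectionWalk (spaceA z) (updateSwap U) := rfl

variable {z} {P : Matrix Ω Ω ℝ} {U : TwoReg Ω ≃ₗᵢ[ℂ] TwoReg Ω}

theorem update_inA (hU : IsQuantumUpdate z P U) (v : EuclideanSpace ℂ Ω) :
    U (inA z v) = WithLp.toLp 2 fun q : Ω × Ω => v q.1 * (Real.sqrt (P q.1 q.2) : ℂ) := by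
  rw [inA_eq_sum, map_sum]
  simp only [map_smul, hU _]
  ext ⟨x, y⟩
  simp only [WithLp.ofLp_sum, Finset.sum_apply, PiLp.smul_apply, smul_eq_mul, mul_ite, mul_zero]
  rw [Finset.sum_eq_single x] <;> simp +contextual [eq_comm]

theorem restrictA_updateSwap_inA (hU : IsQuantumUpdate z P U) (v : EuclideanSpace ℂ Ω) (x : Ω) :
    restrictA z (updateSwap U (inA z v)) x = ∑ y, ((discriminant P x y : ℝ) : ℂ) * v y := by
  have hinner : restrictA z (updateSwap U (inA z v)) x
      = inner ℂ (EuclideanSpace.single (x, z) (1 : ℂ)) (updateSwap U (inA z v)) := by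
    simp [EuclideanSpace.inner_single_left]
  rw [hinner, updateSwap_apply, ← U.inner_map_map, LinearIsometryEquiv.apply_symm_apply, hU x,
    update_inA hU, PiLp.inner_apply, Fintype.sum_prod_type, Finset.sum_eq_single x]
  · refine Finset.sum_congr rfl fun y _ => ?_
    simp [swapReg_apply, discriminant]
    ring
  · intro y _ hy
    simp [hy]
  · simp

variable {p : Ω → ℝ}

theorem norm_sq_restrictA_updateSwap_le (hU : IsQuantumUpdate z P U) {δ : ℝ}
    (hP : P ∈ Matrix.rowStochastic ℝ Ω) (hprim : P.IsPrimitive) (hp : ∀ x, 0 < p x)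
    (hrev : ∀ x y, p x * P x y = p y * P y x) (hδ : δ ≤ spectralGap P) {v : EuclideanSpace ℂ Ω}
    (hv : inner ℂ (qsample p) v = 0) :
    ‖restrictA z (updateSwap U (inA z v))‖ ^ 2 ≤ (1 - δ) ^ 2 * ‖v‖ ^ 2 := by
  rw [inner_qsample] at hv
  have hre := congrArg Complex.re hv
  have him := congrArg Complex.im hv
  simp only [Complex.re_sum, Complex.im_sum, Complex.re_ofReal_mul, Complex.im_ofReal_mul,
    Complex.zero_re, Complex.zero_im] at hre him
  have hle_re := sum_sq_discriminant_mulVec_le hP hprim hp hrev hδ (fun x => (v x).re) hre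
  have hle_im := sum_sq_discriminant_mulVec_le hP hprim hp hrev hδ (fun x => (v x).im) him
  simp only [EuclideanSpace.norm_sq_eq, restrictA_updateSwap_inA hU, ← Complex.normSq_eq_norm_sq,
    Complex.normSq_apply, Complex.re_sum, Complex.im_sum, Complex.re_ofReal_mul,
    Complex.im_ofReal_mul, Finset.sum_add_distrib]
  simp only [Matrix.mulVec, dotProduct, sq] at hle_re hle_im
  simp only [sq]
  linarith

theorem updateSwap_inA_qsample (hU : IsQuantumUpdate z P U) (hp : ∀ x, 0 ≤ p x)
    (hrev : ∀ x y, p x * P x y = p y * P y x) :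
    updateSwap U (inA z (qsample p)) = inA z (qsample p) := by
  rw [updateSwap_apply, LinearIsometryEquiv.symm_apply_eq, update_inA hU]
  ext ⟨x, y⟩
  simp only [swapReg_apply, qsample_apply]
  rw [← Complex.ofReal_mul, ← Complex.ofReal_mul, ← Real.sqrt_mul (hp _),
    ← Real.sqrt_mul (hp _), hrev]

theorem walkOp_inA_qsample (hU : IsQuantumUpdate z P U) (hp : ∀ x, 0 ≤ p x)
    (hrev : ∀ x y, p x * P x y = p y * P y x) :
    walkOp z U (inA z (qsample p)) = inA z (qsample p) := by
  have hA := Submodule.reflection_mem_subspace_eq_self (inA_mem_spaceA z (qsample p))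
  have hX := updateSwap_inA_qsample hU hp hrev
  rw [walkOp_eq_reflectionWalk, reflectionWalk_apply_of_mem (updateSwap_involutive U)
    (inA_mem_spaceA z _), hX, hA, hX]

theorem norm_average_walkOp_pow_apply_le (hU : IsQuantumUpdate z P U) {δ : ℝ}
    (hP : P ∈ Matrix.rowStochastic ℝ Ω) (hprim : P.IsPrimitive) (hp : ∀ x, 0 < p x)
    (hrev : ∀ x y, p x * P x y = p y * P y x) (hδ0 : 0 < δ) (hδ : δ ≤ spectralGap P) {T : ℕ}
    (hT : 2 ≤ T * Real.sqrt δ) (r : ℕ) {v : EuclideanSpace ℂ Ω}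
    (hv : inner ℂ (qsample p) v = 0) :
    ‖(average (walkOp z U) T ^ r) (inA z v)‖ ≤ (1 / 2) ^ r * ‖v‖ := by
  rw [walkOp_eq_reflectionWalk, ← (inA z).norm_map v]
  refine norm_average_reflectionWalk_pow_apply_le (updateSwap_involutive U)
    (inA_mem_spaceA z (qsample p)) (updateSwap_inA_qsample hU (fun x => (hp x).le) hrev) hδ0
    (hδ.trans (spectralGap_le_one P)) (fun w hw hsw => ?_) hT r (inA_mem_spaceA z v)
    (by rw [LinearIsometry.inner_map_map, hv])
  rw [eq_inA_restrictA z hw] at hsw ⊢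
  rw [LinearIsometry.inner_map_map] at hsw
  rw [starProjection_spaceA, LinearIsometry.norm_map, LinearIsometry.norm_map]
  exact norm_sq_restrictA_updateSwap_le hU hP hprim hp hrev hδ hsw

end Walk

section PlaneRotation

theorem norm_planeRotation_sq (θ : ℝ) (v : EuclideanSpace ℂ (Fin 2)) :
    ‖(WithLp.toLp 2 ![(Real.cos θ : ℂ) * v 0 + (Real.sin θ : ℂ) * v 1,
      -(Real.sin θ : ℂ) * v 0 + (Real.cos θ : ℂ) * v 1] : EuclideanSpace ℂ (Fin 2))‖ ^ 2
      = ‖v‖ ^ 2 := by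
  simp only [EuclideanSpace.norm_sq_eq, Fin.sum_univ_two, ← Complex.normSq_eq_norm_sq,
    Complex.normSq_apply, Matrix.cons_val_zero, Matrix.cons_val_one, Complex.add_re,
    Complex.add_im, Complex.re_ofReal_mul, Complex.im_ofReal_mul, neg_mul, Complex.neg_re,
    Complex.neg_im]
  linear_combination (((v 0).re ^ 2 + (v 0).im ^ 2) + ((v 1).re ^ 2 + (v 1).im ^ 2))
    * Real.sin_sq_add_cos_sq θ

/-- The rotation of a qubit by the angle `-θ`. -/
def planeRotation (θ : ℝ) : EuclideanSpace ℂ (Fin 2) ≃ₗᵢ[ℂ] EuclideanSpace ℂ (Fin 2) :=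
  LinearIsometry.toLinearIsometryEquiv
    { toFun := fun v => WithLp.toLp 2
        ![(Real.cos θ : ℂ) * v 0 + (Real.sin θ : ℂ) * v 1,
          -(Real.sin θ : ℂ) * v 0 + (Real.cos θ : ℂ) * v 1]
      map_add' := fun v w => by ext j; fin_cases j <;> simp <;> ring
      map_smul' := fun r v => by ext j; fin_cases j <;> simp <;> ring
      norm_map' := fun v => by
        rw [← sq_eq_sq₀ (norm_nonneg _) (norm_nonneg _)]
        exact norm_planeRotation_sq θ v }
    rfl

theorem planeRotation_apply_zero (θ : ℝ) (v : EuclideanSpace ℂ (Fin 2)) :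
    planeRotation θ v 0 = (Real.cos θ : ℂ) * v 0 + (Real.sin θ : ℂ) * v 1 := rfl

theorem planeRotation_apply_one (θ : ℝ) (v : EuclideanSpace ℂ (Fin 2)) :
    planeRotation θ v 1 = -(Real.sin θ : ℂ) * v 0 + (Real.cos θ : ℂ) * v 1 := rfl

/-- The Pauli matrix `Z`. -/
def pauliZ : EuclideanSpace ℂ (Fin 2) ≃ₗᵢ[ℂ] EuclideanSpace ℂ (Fin 2) :=
  diagIso ![1, -1]

theorem pauliZ_mul_planeRotation_sq (θ : ℝ) : (pauliZ * planeRotation θ) ^ 2 = 1 := by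
  have hθ : (Real.sin θ : ℂ) ^ 2 + (Real.cos θ : ℂ) ^ 2 = 1 := by
    exact_mod_cast Real.sin_sq_add_cos_sq θ
  ext v a
  fin_cases a <;>
    simp only [sq, pauliZ, LinearIsometryEquiv.coe_mul, Function.comp_apply, diagIso_apply,
      Fin.zero_eta, Fin.mk_one, planeRotation_apply_zero, planeRotation_apply_one,
      Matrix.cons_val_zero, Matrix.cons_val_one, Circle.coe_one, Circle.coe_neg,
      LinearIsometryEquiv.coe_one, id_eq]
  · linear_combination v 0 * hθ
  · linear_combination v 1 * hθ

theorem planeRotation_arccos_sqrt_apply {y : ℝ} (hy : y ∈ Set.Icc 0 1)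
    (v : EuclideanSpace ℂ (Fin 2)) (a : Fin 2) :
    planeRotation (Real.arccos (Real.sqrt y)) v a
      = ∑ b : Fin 2, ((rotMatrix y a b : ℝ) : ℂ) * v b := by
  have hcos : Real.cos (Real.arccos (Real.sqrt y)) = Real.sqrt y :=
    Real.cos_arccos (by linarith [Real.sqrt_nonneg y]) (Real.sqrt_le_one.2 hy.2)
  have hsin : Real.sin (Real.arccos (Real.sqrt y)) = Real.sqrt (1 - y) := by
    rw [Real.sin_arccos, Real.sq_sqrt hy.1]
  fin_cases a
  · simp [planeRotation_apply_zero, hcos, hsin, rotMatrix]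
  · simp [planeRotation_apply_one, hcos, hsin, rotMatrix]

end PlaneRotation

section Circuits

variable {Ω : Type*} [Fintype Ω] {K : Type} [Fintype K] {ℓ : ℕ}

/-- Separates the qubit from the other registers. -/
def qubitEquiv (Ω K : Type*) : Conf Ω K ≃ ((Ω × Ω) × K) × Fin 2 where
  toFun c := ((c.1, c.2.2), c.2.1)
  invFun d := (d.1.1, (d.2, d.1.2))

/-- The angles of the rotation `V_i`. The form `arccos √y` makes sense also where `y` is not in
`[0, 1]`. -/
def rotationAngle (I : AnnealingData Ω) (i : ℕ) (x : Ω) : ℝ :=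
  Real.arccos (Real.sqrt (I.yval i x))

/-- The number of walks in a circuit. -/
def walkTotal (gs : List (Gate Ω K ℓ)) : ℕ := (gs.map Gate.walkCost).sum

/-- The number of rotations in a circuit. -/
def rotTotal (gs : List (Gate Ω K ℓ)) : ℕ := (gs.map Gate.rotCost).sum

theorem walkTotal_append (gs hs : List (Gate Ω K ℓ)) :
    walkTotal (gs ++ hs) = walkTotal gs + walkTotal hs := by simp [walkTotal]

theorem rotTotal_append (gs hs : List (Gate Ω K ℓ)) :
    rotTotal (gs ++ hs) = rotTotal gs + rotTotal hs := by simp [rotTotal]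

variable [DecidableEq Ω]

/-- The action of a gate as a unitary. -/
def gateIso (I : AnnealingData Ω) (z : Ω) (i : ℕ) :
    Gate Ω K ℓ → (EuclideanSpace ℂ (Conf Ω K) ≃ₗᵢ[ℂ] EuclideanSpace ℂ (Conf Ω K))
  | Gate.free F => F
  | Gate.walk j _ _ => blockIso (Equiv.prodComm (Ω × Ω) (Fin 2 × K)) fun c =>
      if c.1 = 1 then walkOp z (I.update j) else 1
  | Gate.rot => blockIso (qubitEquiv Ω K) fun c =>
      planeRotation (rotationAngle I i c.1.1)

theorem yval_mem_Icc {I : AnnealingData Ω} {z : Ω} {δ : ℝ} (hI : I.Admissible z ℓ δ) {i : ℕ}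
    (hi : i < ℓ) (s : Ω) : I.yval i s ∈ Set.Icc 0 1 := by
  refine ⟨(Real.exp_pos _).le, Real.exp_le_one_iff.2 ?_⟩
  rw [neg_mul, neg_nonpos]
  exact mul_nonneg (sub_nonneg.2 (hI.beta_mono i hi)) (hI.energy_nonneg s)

theorem act_eq_gateIso {I : AnnealingData Ω} {z : Ω} {δ : ℝ} {i : ℕ}
    (hI : I.Admissible z ℓ δ) (hi : i < ℓ) (g : Gate Ω K ℓ) (ψ : EuclideanSpace ℂ (Conf Ω K)) :
    g.act I z i ψ = gateIso I z i g ψ := by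
  cases g with
  | free F => rfl
  | walk j h1 h2 =>
    ext c
    simp only [Gate.act, controlled, gateIso, blockIso_apply, Equiv.prodComm_apply, Prod.fst_swap,
      Prod.snd_swap]
    by_cases h : c.2.1 = 1
    · simp only [h, if_true]
      rfl
    · simp only [h, if_false]
      rfl
  | rot =>
    ext c
    simp only [Gate.act, rotation, gateIso, blockIso_apply]
    rw [rotationAngle, planeRotation_arccos_sqrt_apply (yval_mem_Icc hI hi _)]
    rfl

/-- The action of a circuit as a unitary. -/
def run (I : AnnealingData Ω) (z : Ω) (i : ℕ) (gs : List (Gate Ω K ℓ)) :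
    EuclideanSpace ℂ (Conf Ω K) ≃ₗᵢ[ℂ] EuclideanSpace ℂ (Conf Ω K) :=
  (gs.reverse.map (gateIso I z i)).prod

theorem run_nil (I : AnnealingData Ω) (z : Ω) (i : ℕ) :
    run I z i ([] : List (Gate Ω K ℓ)) = 1 := rfl

theorem run_singleton (I : AnnealingData Ω) (z : Ω) (i : ℕ) (g : Gate Ω K ℓ) :
    run I z i [g] = gateIso I z i g := by
  simp [run]

theorem run_append (I : AnnealingData Ω) (z : Ω) (i : ℕ) (gs hs : List (Gate Ω K ℓ)) :
    run I z i (gs ++ hs) = run I z i hs * run I z i gs := by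
  simp [run]

theorem run_cons (I : AnnealingData Ω) (z : Ω) (i : ℕ) (g : Gate Ω K ℓ) (gs : List (Gate Ω K ℓ)) :
    run I z i (g :: gs) = run I z i gs * gateIso I z i g := by
  simp [run]

theorem foldl_act_eq_run {I : AnnealingData Ω} {z : Ω} {δ : ℝ} {i : ℕ}
    (hI : I.Admissible z ℓ δ) (hi : i < ℓ) (gs : List (Gate Ω K ℓ))
    (ψ : EuclideanSpace ℂ (Conf Ω K)) :
    gs.foldl (fun ψ g => g.act I z i ψ) ψ = run I z i gs ψ := by
  induction gs generalizing ψ with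
  | nil => rfl
  | cons g gs ih => rw [List.foldl_cons, ih, act_eq_gateIso hI hi, run_cons]; rfl

theorem reflection_mul_walkOp_sq (z : Ω) (U : TwoReg Ω ≃ₗᵢ[ℂ] TwoReg Ω) :
    ((spaceA z).reflection * walkOp z U) ^ 2 = 1 := by
  ext ψ : 1
  simp [sq, walkOp]

/-- A circuit for the inverse of a gate: the reflection about `𝒜` conjugates the walk to its
inverse, and so does the Pauli matrix `Z` with the rotation. -/
def invGate (z : Ω) : Gate Ω K ℓ → List (Gate Ω K ℓ)
  | Gate.free F => [Gate.free F⁻¹]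
  | Gate.walk j h1 h2 =>
      let R := blockIso (Equiv.prodComm (Ω × Ω) (Fin 2 × K)) fun _ => (spaceA z).reflection
      [Gate.free R, Gate.walk j h1 h2, Gate.free R]
  | Gate.rot =>
      let Z := blockIso (qubitEquiv Ω K) fun _ => pauliZ
      [Gate.free Z, Gate.rot, Gate.free Z]

theorem run_invGate (I : AnnealingData Ω) (z : Ω) (i : ℕ) (g : Gate Ω K ℓ) :
    run I z i (invGate z g) = (gateIso I z i g)⁻¹ := by
  rw [eq_inv_iff_mul_eq_one]
  cases g with
  | free F => simp [run, invGate, gateIso]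
  | walk j h1 h2 =>
    simp only [run, invGate, gateIso, List.reverse_cons, List.reverse_nil, List.nil_append,
      List.cons_append, List.map_cons, List.map_nil, List.prod_cons, List.prod_nil, mul_one,
      ← blockIso_mul, ← mul_assoc]
    refine (congrArg (blockIso _) (funext fun c => ?_)).trans (blockIso_one _)
    simp only [Pi.mul_apply, Pi.one_apply]
    by_cases h : c.1 = 1
    · simpa [h, sq, ← mul_assoc] using reflection_mul_walkOp_sq z (I.update j)
    · simp [h]
  | rot =>
    simp only [run, invGate, gateIso, List.reverse_cons, List.reverse_nil, List.nil_append,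
      List.cons_append, List.map_cons, List.map_nil, List.prod_cons, List.prod_nil, mul_one,
      ← blockIso_mul, ← mul_assoc]
    refine (congrArg (blockIso _) (funext fun c => ?_)).trans (blockIso_one _)
    simpa [sq, ← mul_assoc] using
      pauliZ_mul_planeRotation_sq (rotationAngle I i c.1.1)

/-- A circuit for the inverse of a circuit. -/
def invCircuit (z : Ω) (gs : List (Gate Ω K ℓ)) : List (Gate Ω K ℓ) :=
  gs.reverse.flatMap (invGate z)

theorem invCircuit_cons (z : Ω) (g : Gate Ω K ℓ) (gs : List (Gate Ω K ℓ)) :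
    invCircuit z (g :: gs) = invCircuit z gs ++ invGate z g := by
  simp [invCircuit]

theorem run_invCircuit (I : AnnealingData Ω) (z : Ω) (i : ℕ) (gs : List (Gate Ω K ℓ)) :
    run I z i (invCircuit z gs) = (run I z i gs)⁻¹ := by
  induction gs with
  | nil => simp [invCircuit, run_nil]
  | cons g gs ih => rw [invCircuit_cons, run_append, ih, run_invGate, run_cons, mul_inv_rev]

theorem walkTotal_invCircuit (z : Ω) (gs : List (Gate Ω K ℓ)) :
    walkTotal (invCircuit z gs) = walkTotal gs := by
  induction gs with
  | nil => rfl
  | cons g gs ih =>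
    rw [invCircuit_cons, walkTotal_append, ih]
    cases g <;> simp [walkTotal, invGate, Gate.walkCost, add_comm]

theorem rotTotal_invCircuit (z : Ω) (gs : List (Gate Ω K ℓ)) :
    rotTotal (invCircuit z gs) = rotTotal gs := by
  induction gs with
  | nil => rfl
  | cons g gs ih =>
    rw [invCircuit_cons, rotTotal_append, ih]
    cases g <;> simp [rotTotal, invGate, Gate.rotCost, add_comm]

section Implementable

variable {X : Type*} [NormedAddCommGroup X] [InnerProductSpace ℂ X]

/-- There is a circuit with at most `w` walks and `v` rotations which, on every admissible instance
`I`, acts as `o I` on the logical space embedded by `ι`, up to the error `e`. -/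
def Implementable (ℓ : ℕ) (δ : ℝ) (z : Ω) (i : ℕ) (ι : X →ₗᵢ[ℂ] EuclideanSpace ℂ (Conf Ω K))
    (o : AnnealingData Ω → (X ≃ₗᵢ[ℂ] X)) (w v : ℕ) (e : ℝ) : Prop :=
  ∃ gs : List (Gate Ω K ℓ), walkTotal gs ≤ w ∧ rotTotal gs ≤ v ∧
    ∀ I : AnnealingData Ω, I.Admissible z ℓ δ → ∀ x : X,
      ‖run I z i gs (ι x) - ι (o I x)‖ ≤ e * ‖x‖

namespace Implementable

variable {δ : ℝ} {z : Ω} {i : ℕ} {ι : X →ₗᵢ[ℂ] EuclideanSpace ℂ (Conf Ω K)}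
  {o o' : AnnealingData Ω → (X ≃ₗᵢ[ℂ] X)} {w w' v v' : ℕ} {e e' : ℝ}

theorem mul (h' : Implementable ℓ δ z i ι o' w' v' e') (h : Implementable ℓ δ z i ι o w v e) :
    Implementable ℓ δ z i ι (fun I => o' I * o I) (w' + w) (v' + v) (e' + e) := by
  obtain ⟨gs', hw', hv', hgs'⟩ := h'
  obtain ⟨gs, hw, hv, hgs⟩ := h
  refine ⟨gs ++ gs', by rw [walkTotal_append]; lia, by rw [rotTotal_append]; lia,
    fun I hI x => ?_⟩
  have hfst : ‖run I z i gs' (run I z i gs (ι x)) - run I z i gs' (ι (o I x))‖ ≤ e * ‖x‖ := by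
    rw [← map_sub, LinearIsometryEquiv.norm_map]
    exact hgs I hI x
  have hsnd : ‖run I z i gs' (ι (o I x)) - ι (o' I (o I x))‖ ≤ e' * ‖x‖ := by
    simpa only [LinearIsometryEquiv.norm_map] using hgs' I hI (o I x)
  rw [run_append]
  calc ‖run I z i gs' (run I z i gs (ι x)) - ι (o' I (o I x))‖
      ≤ e * ‖x‖ + e' * ‖x‖ :=
        (norm_sub_le_norm_sub_add_norm_sub _ _ _).trans (add_le_add hfst hsnd)
    _ = (e' + e) * ‖x‖ := by ring

theorem inv (h : Implementable ℓ δ z i ι o w v e) :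
    Implementable ℓ δ z i ι (fun I => (o I)⁻¹) w v e := by
  obtain ⟨gs, hw, hv, hgs⟩ := h
  refine ⟨invCircuit z gs, by rwa [walkTotal_invCircuit], by rwa [rotTotal_invCircuit],
    fun I hI x => ?_⟩
  obtain ⟨y, rfl⟩ := (o I).surjective x
  rw [run_invCircuit, ← (run I z i gs).norm_map, map_sub, norm_sub_rev]
  simpa using hgs I hI y

theorem mono (h : Implementable ℓ δ z i ι o w v e) (hw : w ≤ w') (hv : v ≤ v') (he : e ≤ e') :
    Implementable ℓ δ z i ι o w' v' e' := by
  obtain ⟨gs, hgw, hgv, hgs⟩ := h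
  exact ⟨gs, hgw.trans hw, hgv.trans hv, fun I hI x => (hgs I hI x).trans (by gcongr)⟩

theorem congr (h : Implementable ℓ δ z i ι o w v e)
    (ho : ∀ I : AnnealingData Ω, I.Admissible z ℓ δ → o I = o' I) :
    Implementable ℓ δ z i ι o' w v e := by
  obtain ⟨gs, hw, hv, hgs⟩ := h
  exact ⟨gs, hw, hv, fun I hI x => by rw [← ho I hI]; exact hgs I hI x⟩

theorem comp {Y : Type*} [NormedAddCommGroup Y] [InnerProductSpace ℂ Y]
    (h : Implementable ℓ δ z i ι o w v e) (τ : Y →ₗᵢ[ℂ] X) {u : AnnealingData Ω → (Y ≃ₗᵢ[ℂ] Y)}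
    (hu : ∀ I : AnnealingData Ω, I.Admissible z ℓ δ → ∀ y, o I (τ y) = τ (u I y)) :
    Implementable ℓ δ z i (ι.comp τ) u w v e := by
  obtain ⟨gs, hw, hv, hgs⟩ := h
  refine ⟨gs, hw, hv, fun I hI y => ?_⟩
  have hτ := hgs I hI (τ y)
  rwa [hu I hI, τ.norm_map] at hτ

theorem free (ℓ : ℕ) (δ : ℝ) (z : Ω) (i : ℕ) (ι : X →ₗᵢ[ℂ] EuclideanSpace ℂ (Conf Ω K))
    (F : X ≃ₗᵢ[ℂ] X) : Implementable ℓ δ z i ι (fun _ => F) 0 0 0 := by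
  obtain ⟨G, hG⟩ := exists_linearIsometryEquiv_comp_eq ι (ι.comp F.toLinearIsometry)
  refine ⟨[Gate.free G], le_rfl, le_rfl, fun I _ x => ?_⟩
  have hGx : gateIso I z i (Gate.free G : Gate Ω K ℓ) (ι x) = ι (F x) := hG x
  rw [run_singleton, hGx, sub_self, norm_zero, zero_mul]

end Implementable

end Implementable

end Circuits

section AverageCoefficients

open Polynomial

/-- The coefficient of `X ^ k` in the `r`-th power of `T⁻¹ (1 + X + ⋯ + X ^ (T - 1))`. -/
def averageCoeff (T r k : ℕ) : ℝ := (((∑ j ∈ Finset.range T, X ^ j : ℕ[X]) ^ r).coeff k : ℝ) / T ^ r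

theorem averageCoeff_nonneg (T r k : ℕ) : 0 ≤ averageCoeff T r k := by
  unfold averageCoeff
  positivity

theorem natDegree_sum_X_pow_pow_lt (T r : ℕ) :
    ((∑ j ∈ Finset.range T, X ^ j : ℕ[X]) ^ r).natDegree < r * (T - 1) + 1 := by
  refine Nat.lt_succ_of_le (natDegree_pow_le_of_le r ?_)
  refine natDegree_sum_le_of_forall_le _ _ fun j hj => ?_
  have := Finset.mem_range.1 hj
  rw [natDegree_X_pow]
  lia

theorem sum_averageCoeff (T r : ℕ) [NeZero T] :
    ∑ k : Fin (r * (T - 1) + 1), averageCoeff T r k = 1 := by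
  have heval : ((∑ j ∈ Finset.range T, X ^ j : ℕ[X]) ^ r).eval 1 = T ^ r := by
    simp [eval_finsetSum]
  rw [eval_eq_sum_range' (natDegree_sum_X_pow_pow_lt T r)] at heval
  simp only [one_pow, mul_one] at heval
  rw [Fin.sum_univ_eq_sum_range (fun k => averageCoeff T r k)]
  simp only [averageCoeff, ← Finset.sum_div]
  rw [← Nat.cast_sum, heval, Nat.cast_pow, div_self (pow_ne_zero r (NeZero.ne _))]

variable {E : Type*} [NormedAddCommGroup E] [InnerProductSpace ℂ E] (W : E ≃ₗᵢ[ℂ] E)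

theorem average_pow_eq_sum (T r : ℕ) :
    average W T ^ r
      = ∑ k : Fin (r * (T - 1) + 1), (averageCoeff T r k : ℂ) • toEnd W ^ (k : ℕ) := by
  have haeval : aeval (toEnd W) (∑ j ∈ Finset.range T, X ^ j : ℕ[X])
      = ∑ j ∈ Finset.range T, toEnd W ^ j := by simp
  rw [average, _root_.smul_pow, ← haeval, ← map_pow,
    aeval_eq_sum_range' (natDegree_sum_X_pow_pow_lt T r), Finset.smul_sum,
    Fin.sum_univ_eq_sum_range (fun k => (averageCoeff T r k : ℂ) • toEnd W ^ k)]
  refine Finset.sum_congr rfl fun k _ => ?_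
  rw [averageCoeff, ← Nat.cast_smul_eq_nsmul ℂ, smul_smul]
  push_cast
  rw [inv_pow, div_eq_inv_mul]

theorem average_pow_apply_of_fixed {W : E ≃ₗᵢ[ℂ] E} {x : E} (h : W x = x) (T r : ℕ) [NeZero T] :
    (average W T ^ r) x = x := by
  rw [average_pow_eq_sum, LinearMap.sum_apply]
  simp only [LinearMap.smul_apply, toEnd_pow_apply_of_fixed h, ← Finset.sum_smul]
  rw [← Complex.ofReal_sum, sum_averageCoeff, Complex.ofReal_one, one_smul]

theorem norm_qsample {Ω : Type*} [Fintype Ω] {p : Ω → ℝ} (hp : ∀ x, 0 ≤ p x)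
    (hsum : ∑ x, p x = 1) : ‖qsample p‖ = 1 := by
  rw [← sq_eq_sq₀ (norm_nonneg _) zero_le_one, EuclideanSpace.norm_sq_eq, one_pow, ← hsum]
  refine Finset.sum_congr rfl fun x _ => ?_
  rw [qsample_apply, Complex.norm_real, Real.norm_of_nonneg (Real.sqrt_nonneg _),
    Real.sq_sqrt (hp x)]

/-- The state of the counter register which turns a walk iterated under the control of the counter
into the `r`-th power of the average of `T` powers of the walk. -/
def counterState (T r : ℕ) : EuclideanSpace ℂ (Fin (r * (T - 1) + 1)) :=
  qsample fun k => averageCoeff T r k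

theorem norm_counterState (T r : ℕ) [NeZero T] : ‖counterState T r‖ = 1 :=
  norm_qsample (fun _ => averageCoeff_nonneg T r _) (sum_averageCoeff T r)

theorem sum_conj_counterState_smul (T r : ℕ) (x : E) :
    ∑ k, conj (counterState T r k) • counterState T r k • (toEnd W ^ (k : ℕ)) x
      = (average W T ^ r) x := by
  rw [average_pow_eq_sum, LinearMap.sum_apply]
  refine Finset.sum_congr rfl fun k _ => ?_
  rw [smul_smul, LinearMap.smul_apply, counterState, qsample_apply, Complex.conj_ofReal,
    ← Complex.ofReal_mul, Real.mul_self_sqrt (averageCoeff_nonneg T r k)]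

end AverageCoefficients

section Select

variable {Ω : Type*} [Fintype Ω] {K : Type}

/-- The vector with components `w k`, the qubit being in the state `a k` if the ancilla register
is in the state `k`. -/
def qubitState (a : K → Fin 2) (w : K → TwoReg Ω) : EuclideanSpace ℂ (Conf Ω K) :=
  WithLp.toLp 2 fun c => if c.2.1 = a c.2.2 then w c.2.2 c.1 else 0

theorem qubitState_sub (a : K → Fin 2) (w w' : K → TwoReg Ω) :
    qubitState a w - qubitState a w' = qubitState a fun k => w k - w' k := by
  ext c
  by_cases h : c.2.1 = a c.2.2 <;> simp [qubitState, h]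

variable [Fintype K]

theorem slice_qubitState (a : K → Fin 2) (w : K → TwoReg Ω) (b : Fin 2) (k : K) :
    slice (Equiv.prodComm (Ω × Ω) (Fin 2 × K)) (b, k) (qubitState a w)
      = if b = a k then w k else 0 := by
  ext q
  by_cases h : b = a k <;> simp [qubitState, h]

theorem norm_sq_qubitState (a : K → Fin 2) (w : K → TwoReg Ω) :
    ‖qubitState a w‖ ^ 2 = ∑ k, ‖w k‖ ^ 2 := by
  rw [norm_sq_eq_sum_slice (Equiv.prodComm (Ω × Ω) (Fin 2 × K)), Fintype.sum_prod_type_right]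
  refine Finset.sum_congr rfl fun k _ => ?_
  simp [slice_qubitState, apply_ite, ite_pow]

/-- The unitary which adds `f k` to the qubit if the ancilla register is in the state `k`. -/
def flipQubit (f : K → Fin 2) : EuclideanSpace ℂ (Conf Ω K) ≃ₗᵢ[ℂ] EuclideanSpace ℂ (Conf Ω K) :=
  LinearIsometryEquiv.piLpCongrLeft 2 ℂ ℂ <| (Equiv.refl _).prodCongr <|
    (Equiv.prodComm _ _).trans <|
      (Equiv.prodShear (Equiv.refl K) fun k => Equiv.addRight (f k)).trans (Equiv.prodComm _ _)

theorem flipQubit_qubitState (f a : K → Fin 2) (w : K → TwoReg Ω) :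
    flipQubit f (qubitState a w) = qubitState (a + f) w := by
  ext ⟨q, b, k⟩
  change (if b + -f k = a k then w k q else 0) = if b = a k + f k then w k q else 0
  simp only [← sub_eq_add_neg, sub_eq_iff_eq_add]

variable {ℓ : ℕ} {M : Type} [Fintype M] {d : ℕ}

/-- `n` rounds of walks, the `t`-th of which is controlled on the counter register being greater
than `t`. -/
def selectCircuit (M : Type) [Fintype M] (d : ℕ) {j : ℕ} (h1 : 1 ≤ j) (h2 : j < ℓ) :
    ℕ → List (Gate Ω (M × Fin (d + 1)) ℓ)
  | 0 => []
  | t + 1 => selectCircuit M d h1 h2 t ++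
      [Gate.free (flipQubit fun k => if t < (k.2 : ℕ) then 1 else 0), Gate.walk j h1 h2,
        Gate.free (flipQubit fun k => if t < (k.2 : ℕ) then 1 else 0)]

theorem walkTotal_selectCircuit {j : ℕ} (h1 : 1 ≤ j) (h2 : j < ℓ) (n : ℕ) :
    walkTotal (selectCircuit (Ω := Ω) M d h1 h2 n) = n := by
  induction n with
  | zero => rfl
  | succ n ih =>
    rw [selectCircuit, walkTotal_append, ih]
    rfl

theorem rotTotal_selectCircuit {j : ℕ} (h1 : 1 ≤ j) (h2 : j < ℓ) (n : ℕ) :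
    rotTotal (selectCircuit (Ω := Ω) M d h1 h2 n) = 0 := by
  induction n with
  | zero => rfl
  | succ n ih =>
    rw [selectCircuit, rotTotal_append, ih]
    rfl

/-- Separates the counter register from the other registers. -/
def counterEquiv (Ω M : Type*) (d : ℕ) :
    Conf Ω (M × Fin (d + 1)) ≃ ((Ω × Ω) × (Fin 2 × M)) × Fin (d + 1) where
  toFun c := ((c.1, (c.2.1, c.2.2.1)), c.2.2.2)
  invFun x := (x.1.1, (x.1.2.1, (x.1.2.2, x.2)))

/-- Multiplication by a phase along the state `χ` of the counter register. The phase depends on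
the content of the memory register `M`. -/
def counterPhase (Ω : Type*) [Fintype Ω] (χ : EuclideanSpace ℂ (Fin (d + 1))) (φ : M → Circle) :
    EuclideanSpace ℂ (Conf Ω (M × Fin (d + 1))) ≃ₗᵢ[ℂ]
      EuclideanSpace ℂ (Conf Ω (M × Fin (d + 1))) :=
  blockIso (counterEquiv Ω M d) fun x => phaseShift χ (φ x.2.2)

theorem counterPhase_qubitState {χ : EuclideanSpace ℂ (Fin (d + 1))} (hχ : ‖χ‖ = 1)
    (φ : M → Circle) (w : M × Fin (d + 1) → TwoReg Ω) :
    counterPhase Ω χ φ (qubitState 0 w)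
      = qubitState 0 fun k => w k + (((φ k.1 : ℂ) - 1) * χ k.2) •
          ∑ k', conj (χ k') • w (k.1, k') := by
  ext ⟨q, b, m, k⟩
  rw [counterPhase, blockIso_apply, phaseShift_apply hχ]
  by_cases hb : b = 0
  · subst hb
    simp only [counterEquiv, qubitState, PiLp.inner_apply]
    simp [Finset.mul_sum, mul_comm, mul_assoc, mul_left_comm]
  · simp [counterEquiv, qubitState, PiLp.inner_apply, hb]

variable [DecidableEq Ω]

theorem gateIso_walk_qubitState (I : AnnealingData Ω) (z : Ω) (i : ℕ) {j : ℕ} (h1 : 1 ≤ j)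
    (h2 : j < ℓ) (a : K → Fin 2) (w : K → TwoReg Ω) :
    gateIso I z i (Gate.walk j h1 h2 : Gate Ω K ℓ) (qubitState a w)
      = qubitState a fun k => if a k = 1 then walkOp z (I.update j) (w k) else w k := by
  ext ⟨q, b, k⟩
  have hslice := slice_qubitState a w b k
  rw [gateIso, blockIso_apply]
  simp only [Equiv.prodComm_apply, Prod.swap, hslice]
  by_cases hb : b = a k
  · by_cases h : a k = 1 <;> simp [qubitState, hb, h]
  · simp [qubitState, hb]

/-- The circuit `gs`, then the unitary `F`, then the inverse of `gs`. -/
def conjCircuit (z : Ω) (gs : List (Gate Ω K ℓ))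
    (F : EuclideanSpace ℂ (Conf Ω K) ≃ₗᵢ[ℂ] EuclideanSpace ℂ (Conf Ω K)) : List (Gate Ω K ℓ) :=
  gs ++ Gate.free F :: invCircuit z gs

section Conj

variable (z : Ω) (gs : List (Gate Ω K ℓ))
  (F : EuclideanSpace ℂ (Conf Ω K) ≃ₗᵢ[ℂ] EuclideanSpace ℂ (Conf Ω K))

theorem walkTotal_conjCircuit : walkTotal (conjCircuit z gs F) = 2 * walkTotal gs := by
  rw [conjCircuit, walkTotal_append, ← List.singleton_append, walkTotal_append,
    walkTotal_invCircuit]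
  simp [walkTotal, Gate.walkCost, two_mul]

theorem rotTotal_conjCircuit : rotTotal (conjCircuit z gs F) = 2 * rotTotal gs := by
  rw [conjCircuit, rotTotal_append, ← List.singleton_append, rotTotal_append, rotTotal_invCircuit]
  simp [rotTotal, Gate.rotCost, two_mul]

theorem norm_run_conjCircuit_sub (I : AnnealingData Ω) (i : ℕ)
    (ψ ψ' : EuclideanSpace ℂ (Conf Ω K)) :
    ‖run I z i (conjCircuit z gs F) ψ - ψ'‖ = ‖F (run I z i gs ψ) - run I z i gs ψ'‖ := by
  have hrun : run I z i (conjCircuit z gs F) ψ = (run I z i gs).symm (F (run I z i gs ψ)) := by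
    rw [conjCircuit, run_append, run_cons, run_invCircuit]
    rfl
  rw [hrun, ← (run I z i gs).norm_map, map_sub, LinearIsometryEquiv.apply_symm_apply]

end Conj

theorem run_selectCircuit (I : AnnealingData Ω) (z : Ω) (i : ℕ) {j : ℕ} (h1 : 1 ≤ j) (h2 : j < ℓ)
    (n : ℕ) (w : M × Fin (d + 1) → TwoReg Ω) :
    run I z i (selectCircuit M d h1 h2 n) (qubitState 0 w)
      = qubitState 0 fun k => (toEnd (walkOp z (I.update j)) ^ min (k.2 : ℕ) n) (w k) := by
  induction n with
  | zero => simp [selectCircuit, run_nil]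
  | succ n ih =>
    set f : M × Fin (d + 1) → Fin 2 := fun k => if n < (k.2 : ℕ) then 1 else 0 with hf
    have hff : f + f = 0 := funext fun k => by by_cases h : n < (k.2 : ℕ) <;> simp [hf, h]
    rw [selectCircuit, run_append, LinearIsometryEquiv.coe_mul, Function.comp_apply, ih, ← hf]
    change flipQubit f (gateIso I z i (Gate.walk j h1 h2 : Gate Ω _ ℓ)
      (flipQubit f (qubitState 0 _))) = _
    rw [flipQubit_qubitState, gateIso_walk_qubitState, flipQubit_qubitState, zero_add, hff]
    congr 1
    ext1 k
    by_cases h : n < (k.2 : ℕ)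
    · rw [min_eq_right (Nat.succ_le_of_lt h), min_eq_right h.le, pow_succ', Module.End.mul_apply,
        toEnd_apply]
      simp [hf, h]
    · rw [min_eq_left (not_lt.1 h), min_eq_left (by lia)]
      simp [hf, h]

/-- The embedding of the logical space of one `Ω`-register and a memory register `M` into the state
space of the circuit: second register `z`, qubit `0`, counter register in the state `χ`. -/
def logical (z : Ω) (M : Type) [Fintype M] {χ : EuclideanSpace ℂ (Fin (d + 1))} (hχ : ‖χ‖ = 1) :
    EuclideanSpace ℂ (Ω × M) →ₗᵢ[ℂ] EuclideanSpace ℂ (Conf Ω (M × Fin (d + 1))) where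
  toFun v := qubitState 0 fun k => χ k.2 • inA z (slice (Equiv.prodComm Ω M) k.1 v)
  map_add' v w := by
    ext c
    by_cases h : c.2.1 = 0 <;> simp [qubitState, h]
  map_smul' r v := by
    ext c
    by_cases h : c.2.1 = 0 <;> simp [qubitState, h, mul_left_comm]
  norm_map' v := by
    rw [← sq_eq_sq₀ (norm_nonneg _) (norm_nonneg _)]
    simp only [LinearMap.coe_mk, AddHom.coe_mk]
    rw [norm_sq_qubitState, norm_sq_eq_sum_slice (Equiv.prodComm Ω M), Fintype.sum_prod_type]
    refine Finset.sum_congr rfl fun m _ => ?_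
    simp only [norm_smul, mul_pow, LinearIsometry.norm_map]
    rw [← Finset.sum_mul, ← EuclideanSpace.norm_sq_eq, hχ, one_pow, one_mul]

theorem logical_apply (z : Ω) {χ : EuclideanSpace ℂ (Fin (d + 1))} (hχ : ‖χ‖ = 1)
    (v : EuclideanSpace ℂ (Ω × M)) :
    logical z M hχ v
      = qubitState 0 fun k => χ k.2 • inA z (slice (Equiv.prodComm Ω M) k.1 v) := rfl

end Select

section ControlledPhase

variable {Ω : Type*} [Fintype Ω] {M : Type} [Fintype M]

/-- Multiplication by a phase along the state `s`. The phase depends on the content of the memory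
register `M`. -/
def controlledPhase (s : EuclideanSpace ℂ Ω) (φ : M → Circle) :
    EuclideanSpace ℂ (Ω × M) ≃ₗᵢ[ℂ] EuclideanSpace ℂ (Ω × M) :=
  blockIso (Equiv.prodComm Ω M) fun m => phaseShift s (φ m)

theorem slice_controlledPhase {s : EuclideanSpace ℂ Ω} (hs : ‖s‖ = 1) (φ : M → Circle)
    (v : EuclideanSpace ℂ (Ω × M)) (m : M) :
    slice (Equiv.prodComm Ω M) m (controlledPhase s φ v)
      = slice (Equiv.prodComm Ω M) m v
        + (((φ m : ℂ) - 1) * inner ℂ s (slice (Equiv.prodComm Ω M) m v)) • s := by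
  rw [controlledPhase, slice_blockIso, phaseShift_apply hs]

theorem norm_qubitState_smul_le {d : ℕ} {χ : EuclideanSpace ℂ (Fin (d + 1))} (hχ : ‖χ‖ = 1)
    (φ : M → Circle) {D : M → TwoReg Ω} {v : EuclideanSpace ℂ (Ω × M)} {c : ℝ} (hc : 0 ≤ c)
    (hD : ∀ m, ‖D m‖ ≤ c * ‖slice (Equiv.prodComm Ω M) m v‖) :
    ‖qubitState 0 fun k : M × Fin (d + 1) => (((φ k.1 : ℂ) - 1) * χ k.2) • D k.1‖
      ≤ 2 * c * ‖v‖ := by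
  rw [← sq_le_sq₀ (norm_nonneg _) (by positivity), norm_sq_qubitState, Fintype.sum_prod_type,
    mul_pow, norm_sq_eq_sum_slice (Equiv.prodComm Ω M) v, Finset.mul_sum]
  refine Finset.sum_le_sum fun m _ => ?_
  have hφ : ‖(φ m : ℂ) - 1‖ ≤ 2 := (norm_sub_le _ _).trans_eq (by norm_num [Circle.norm_coe])
  calc ∑ k, ‖(((φ m : ℂ) - 1) * χ k) • D m‖ ^ 2 = (‖(φ m : ℂ) - 1‖ * ‖D m‖) ^ 2 := by
        simp only [norm_smul, norm_mul, mul_pow]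
        rw [← Finset.sum_mul, ← Finset.mul_sum, ← EuclideanSpace.norm_sq_eq, hχ, one_pow, mul_one]
    _ ≤ (2 * (c * ‖slice (Equiv.prodComm Ω M) m v‖)) ^ 2 := by gcongr; exact hD m
    _ = (2 * c) ^ 2 * ‖slice (Equiv.prodComm Ω M) m v‖ ^ 2 := by ring

variable [DecidableEq Ω] {ℓ : ℕ}

theorem counterPhase_run_selectCircuit_sub (I : AnnealingData Ω) (z : Ω) (i : ℕ) {j : ℕ}
    (h1 : 1 ≤ j) (h2 : j < ℓ) {s : EuclideanSpace ℂ Ω} (hs : ‖s‖ = 1)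
    (hfix : walkOp z (I.update j) (inA z s) = inA z s) (T r : ℕ) [NeZero T] (φ : M → Circle)
    (v : EuclideanSpace ℂ (Ω × M)) :
    counterPhase Ω (counterState T r) φ (run I z i (selectCircuit M (r * (T - 1)) h1 h2
          (r * (T - 1))) (logical z M (norm_counterState T r) v))
      - run I z i (selectCircuit M (r * (T - 1)) h1 h2 (r * (T - 1)))
          (logical z M (norm_counterState T r) (controlledPhase s φ v))
      = qubitState 0 fun k => (((φ k.1 : ℂ) - 1) * counterState T r k.2) •
          ((average (walkOp z (I.update j)) T ^ r) (inA z (slice (Equiv.prodComm Ω M) k.1 v))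
            - inner ℂ s (slice (Equiv.prodComm Ω M) k.1 v) • inA z s) := by
  have hmin (k : Fin (r * (T - 1) + 1)) : min (k : ℕ) (r * (T - 1)) = k :=
    min_eq_left (Nat.lt_succ_iff.1 k.2)
  rw [logical_apply, logical_apply, run_selectCircuit, run_selectCircuit,
    counterPhase_qubitState (norm_counterState T r), qubitState_sub]
  simp only [hmin, map_smul, sum_conj_counterState_smul, slice_controlledPhase hs, map_add,
    smul_add, toEnd_pow_apply_of_fixed hfix]
  congr 1
  ext1 k
  module

end ControlledPhase

section GibbsState

variable {Ω : Type*} [Fintype Ω]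

/-- The coherent version of the Boltzmann distribution `π_j`. -/
def gibbsState (I : AnnealingData Ω) (j : ℕ) : EuclideanSpace ℂ Ω :=
  qsample (boltzmann I.energy (I.beta j))

theorem partitionFn_pos [Nonempty Ω] (E : Ω → ℝ) (b : ℝ) : 0 < partitionFn E b :=
  Finset.sum_pos (fun _ _ => Real.exp_pos _) Finset.univ_nonempty

theorem boltzmann_pos [Nonempty Ω] (E : Ω → ℝ) (b : ℝ) (x : Ω) : 0 < boltzmann E b x :=
  div_pos (Real.exp_pos _) (partitionFn_pos E b)

theorem sum_boltzmann [Nonempty Ω] (E : Ω → ℝ) (b : ℝ) : ∑ x, boltzmann E b x = 1 := by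
  simp only [boltzmann, ← Finset.sum_div]
  exact div_self (partitionFn_pos E b).ne'

theorem norm_gibbsState [Nonempty Ω] (I : AnnealingData Ω) (j : ℕ) : ‖gibbsState I j‖ = 1 :=
  norm_qsample (fun x => (boltzmann_pos I.energy (I.beta j) x).le) (sum_boltzmann _ _)

variable [DecidableEq Ω] {ℓ : ℕ} {δ : ℝ} {z : Ω}

theorem gibbsState_zero {I : AnnealingData Ω} (hI : I.Admissible z ℓ δ) :
    gibbsState I 0 = qsample fun _ => (Fintype.card Ω : ℝ)⁻¹ := by
  ext x
  simp [gibbsState, boltzmann, partitionFn, hI.beta_zero]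

variable {T : ℕ} [NeZero T]

theorem walkOp_inA_gibbsState {I : AnnealingData Ω} (hI : I.Admissible z ℓ δ) {j : ℕ} (h1 : 1 ≤ j)
    (h2 : j < ℓ) : walkOp z (I.update j) (inA z (gibbsState I j)) = inA z (gibbsState I j) :=
  have : Nonempty Ω := ⟨z⟩
  walkOp_inA_qsample (hI.isUpdate j h1 h2) (fun x => (boltzmann_pos I.energy (I.beta j) x).le)
    (hI.reversible j h1 h2)

theorem norm_average_walkOp_pow_sub_le {I : AnnealingData Ω} (hI : I.Admissible z ℓ δ) {j : ℕ}
    (h1 : 1 ≤ j) (h2 : j < ℓ) (hδ : 0 < δ) (hT : 2 ≤ T * Real.sqrt δ) (r : ℕ)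
    (v : EuclideanSpace ℂ Ω) :
    ‖(average (walkOp z (I.update j)) T ^ r) (inA z v)
        - inner ℂ (gibbsState I j) v • inA z (gibbsState I j)‖ ≤ (1 / 2) ^ r * ‖v‖ := by
  have : Nonempty Ω := ⟨z⟩
  set s := gibbsState I j
  set u := v - inner ℂ s v • s with hu
  have hsu : inner ℂ s u = 0 := by
    rw [hu, inner_sub_right, inner_smul_right, inner_self_eq_norm_sq_to_K, norm_gibbsState]
    simp
  have hdec : (average (walkOp z (I.update j)) T ^ r) (inA z v) - inner ℂ s v • inA z s
      = (average (walkOp z (I.update j)) T ^ r) (inA z u) := by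
    rw [hu, map_sub, map_smul, map_sub, map_smul,
      average_pow_apply_of_fixed (walkOp_inA_gibbsState hI h1 h2)]
  have hle : ‖u‖ ≤ ‖v‖ := by
    have horth : inner ℂ (inner ℂ s v • s) u = 0 := by rw [inner_smul_left, hsu, mul_zero]
    have hpyth := norm_add_sq_eq_norm_sq_add_norm_sq_of_inner_eq_zero _ _ horth
    rw [hu, add_sub_cancel, ← hu] at hpyth
    nlinarith [norm_nonneg u, norm_nonneg v, mul_self_nonneg ‖inner ℂ s v • s‖]
  rw [hdec]
  calc ‖(average (walkOp z (I.update j)) T ^ r) (inA z u)‖ ≤ (1 / 2) ^ r * ‖u‖ :=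
        norm_average_walkOp_pow_apply_le (hI.isUpdate j h1 h2) (hI.stochastic j h1 h2)
          (hI.ergodic j h1 h2) (boltzmann_pos _ _) (hI.reversible j h1 h2) hδ (hI.gap_ge j h1 h2)
          hT r hsu
    _ ≤ (1 / 2) ^ r * ‖v‖ := by gcongr

variable {M : Type} [Fintype M]

theorem implementable_gibbsPhase_of_pos {i j : ℕ} (h1 : 1 ≤ j) (h2 : j < ℓ) (hδ : 0 < δ)
    (hT : 2 ≤ T * Real.sqrt δ) (r : ℕ) (φ : M → Circle) :
    Implementable ℓ δ z i (logical z M (norm_counterState T r))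
      (fun I => controlledPhase (gibbsState I j) φ) (2 * (r * (T - 1))) 0 (2 * (1 / 2) ^ r) := by
  have : Nonempty Ω := ⟨z⟩
  refine ⟨conjCircuit z (selectCircuit M (r * (T - 1)) h1 h2 (r * (T - 1)))
    (counterPhase Ω (counterState T r) φ), ?_, ?_, fun I hI v => ?_⟩
  · rw [walkTotal_conjCircuit, walkTotal_selectCircuit]
  · rw [rotTotal_conjCircuit, rotTotal_selectCircuit]
  rw [norm_run_conjCircuit_sub, counterPhase_run_selectCircuit_sub I z i h1 h2
    (norm_gibbsState I j) (walkOp_inA_gibbsState hI h1 h2)]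
  have hbound := norm_qubitState_smul_le (norm_counterState T r) φ (c := (1 / 2) ^ r)
    (by positivity) fun m => norm_average_walkOp_pow_sub_le hI h1 h2 hδ hT r
      (slice (Equiv.prodComm Ω M) m v)
  convert hbound using 3

theorem implementable_gibbsPhase {i j : ℕ} (hj : j < ℓ) (hδ : 0 < δ) (hT : 2 ≤ T * Real.sqrt δ)
    (r : ℕ) (φ : M → Circle) :
    Implementable ℓ δ z i (logical z M (norm_counterState T r))
      (fun I => controlledPhase (gibbsState I j) φ) (2 * (r * (T - 1))) 0 (2 * (1 / 2) ^ r) := by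
  rcases Nat.eq_zero_or_pos j with rfl | hpos
  · refine ((Implementable.free ℓ δ z i _ (controlledPhase
      (qsample fun _ : Ω => (Fintype.card Ω : ℝ)⁻¹) φ)).congr fun I hI => ?_).mono
        (Nat.zero_le _) le_rfl (by positivity)
    rw [gibbsState_zero hI]
  · exact implementable_gibbsPhase_of_pos hpos hj hδ hT r φ

end GibbsState

section Preparation

variable {Ω : Type*} [Fintype Ω] {M : Type} [Fintype M]

/-- The embedding `v ↦ v ⊗ a`, which adjoins a memory register in the state `a`. -/
def withMemory (Ω : Type*) [Fintype Ω] {a : EuclideanSpace ℂ M} (ha : ‖a‖ = 1) :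
    EuclideanSpace ℂ Ω →ₗᵢ[ℂ] EuclideanSpace ℂ (Ω × M) where
  toFun v := WithLp.toLp 2 fun q => v q.1 * a q.2
  map_add' v w := by ext q; simp [add_mul]
  map_smul' c v := by ext q; simp [mul_assoc]
  norm_map' v := by
    rw [← sq_eq_sq₀ (norm_nonneg _) (norm_nonneg _), EuclideanSpace.norm_sq_eq,
      EuclideanSpace.norm_sq_eq v, Fintype.sum_prod_type]
    refine Finset.sum_congr rfl fun x _ => ?_
    simp only [LinearMap.coe_mk, AddHom.coe_mk, norm_mul, mul_pow]
    rw [← Finset.mul_sum, ← EuclideanSpace.norm_sq_eq, ha, one_pow, mul_one]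

@[simp] theorem withMemory_apply {a : EuclideanSpace ℂ M} (ha : ‖a‖ = 1) (v : EuclideanSpace ℂ Ω)
    (q : Ω × M) : withMemory Ω ha v q = v q.1 * a q.2 := rfl

theorem slice_withMemory {a : EuclideanSpace ℂ M} (ha : ‖a‖ = 1) (v : EuclideanSpace ℂ Ω)
    (m : M) : slice (Equiv.prodComm Ω M) m (withMemory Ω ha v) = a m • v := by
  ext x
  simp [mul_comm]

theorem controlledPhase_const_withMemory (s : EuclideanSpace ℂ Ω) (ω : Circle)
    {a : EuclideanSpace ℂ M} (ha : ‖a‖ = 1) (v : EuclideanSpace ℂ Ω) :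
    controlledPhase s (fun _ => ω) (withMemory Ω ha v) = withMemory Ω ha (phaseShift s ω v) := by
  ext q
  rw [controlledPhase, blockIso_apply, slice_withMemory, map_smul]
  simp [mul_comm]

theorem le_norm_inner_qsample_sq {p q : Ω → ℝ} (hq : ∀ x, 0 ≤ q x) (hsum : ∑ x, q x = 1) {c : ℝ}
    (hc : 0 ≤ c) (h : ∀ x, c * q x ≤ p x) : c ≤ ‖inner ℂ (qsample q) (qsample p)‖ ^ 2 := by
  have hle (x : Ω) : Real.sqrt c * q x ≤ Real.sqrt (q x) * Real.sqrt (p x) := by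
    calc Real.sqrt c * q x = Real.sqrt (q x) * Real.sqrt (c * q x) := by
          rw [Real.sqrt_mul hc, mul_left_comm, Real.mul_self_sqrt (hq x)]
      _ ≤ Real.sqrt (q x) * Real.sqrt (p x) := by gcongr; exact h x
  have hinner : inner ℂ (qsample q) (qsample p)
      = ((∑ x, Real.sqrt (q x) * Real.sqrt (p x) : ℝ) : ℂ) := by
    simp [inner_qsample]
  have hsqrt : Real.sqrt c ≤ ∑ x, Real.sqrt (q x) * Real.sqrt (p x) := by
    calc Real.sqrt c = ∑ x, Real.sqrt c * q x := by rw [← Finset.mul_sum, hsum, mul_one]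
      _ ≤ ∑ x, Real.sqrt (q x) * Real.sqrt (p x) := Finset.sum_le_sum fun x _ => hle x
  rw [hinner, Complex.norm_real, Real.norm_eq_abs, sq_abs]
  calc c = Real.sqrt c ^ 2 := (Real.sq_sqrt hc).symm
    _ ≤ (∑ x, Real.sqrt (q x) * Real.sqrt (p x)) ^ 2 := by gcongr

/-- The composition of the fixed-point searches `π_0 → π_1 → … → π_j`, each with `m` iterations. -/
def prepare (I : AnnealingData Ω) (m : ℕ) : ℕ → (EuclideanSpace ℂ Ω ≃ₗᵢ[ℂ] EuclideanSpace ℂ Ω)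
  | 0 => 1
  | j + 1 => fixedPoint (gibbsState I j) (gibbsState I (j + 1)) m * prepare I m j

variable [DecidableEq Ω] {ℓ : ℕ} {δ : ℝ} {z : Ω}

theorem half_mul_boltzmann_succ_le {I : AnnealingData Ω} (hI : I.Admissible z ℓ δ) {j : ℕ}
    (hj : j < ℓ) (x : Ω) : 1 / 2 * boltzmann I.energy (I.beta (j + 1)) x
      ≤ boltzmann I.energy (I.beta j) x := by
  have : Nonempty Ω := ⟨z⟩
  have hZ := partitionFn_pos I.energy (I.beta j)
  have hZ' := partitionFn_pos I.energy (I.beta (j + 1))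
  calc 1 / 2 * boltzmann I.energy (I.beta (j + 1)) x
      ≤ I.ratio j * boltzmann I.energy (I.beta (j + 1)) x :=
        mul_le_mul_of_nonneg_right (hI.ratio_ge j hj) (boltzmann_pos _ _ x).le
    _ = Real.exp (-I.beta (j + 1) * I.energy x) / partitionFn I.energy (I.beta j) := by
        simp only [boltzmann, AnnealingData.ratio]; field_simp
    _ ≤ boltzmann I.energy (I.beta j) x := by
        unfold boltzmann
        gcongr
        exacts [hI.energy_nonneg x, hI.beta_mono j hj]

theorem half_le_norm_inner_gibbsState_sq {I : AnnealingData Ω} (hI : I.Admissible z ℓ δ) {j : ℕ}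
    (hj : j < ℓ) : 1 / 2 ≤ ‖inner ℂ (gibbsState I (j + 1)) (gibbsState I j)‖ ^ 2 :=
  have : Nonempty Ω := ⟨z⟩
  le_norm_inner_qsample_sq (fun x => (boltzmann_pos _ _ x).le) (sum_boltzmann _ _) (by norm_num)
    (half_mul_boltzmann_succ_le hI hj)

theorem exists_norm_fixedPoint_gibbsState_sub_le {I : AnnealingData Ω} (hI : I.Admissible z ℓ δ)
    (m : ℕ) {j : ℕ} (hj : j < ℓ) :
    ∃ c : Circle, ‖fixedPoint (gibbsState I j) (gibbsState I (j + 1)) m (gibbsState I j)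
      - c • gibbsState I (j + 1)‖ ≤ Real.sqrt (2 * (1 / 2) ^ 3 ^ m) := by
  have : Nonempty Ω := ⟨z⟩
  have hinner : ‖inner ℂ (gibbsState I (j + 1)) (gibbsState I j)‖ ≤ 1 := by
    simpa only [norm_gibbsState, one_mul] using
      norm_inner_le_norm (𝕜 := ℂ) (gibbsState I (j + 1)) (gibbsState I j)
  have hfail : 1 - ‖inner ℂ (gibbsState I (j + 1))
      (fixedPoint (gibbsState I j) (gibbsState I (j + 1)) m (gibbsState I j))‖ ^ 2
        ≤ (1 / 2) ^ 3 ^ m := by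
    rw [one_sub_norm_inner_fixedPoint (norm_gibbsState I j) (norm_gibbsState I (j + 1))]
    gcongr
    · exact sub_nonneg.2 (pow_le_one₀ (norm_nonneg _) hinner)
    · linarith [half_le_norm_inner_gibbsState_sq hI hj]
  obtain ⟨c, hc⟩ := exists_circle_norm_sub_smul_sq_le
    (by rw [LinearIsometryEquiv.norm_map, norm_gibbsState]) (norm_gibbsState I (j + 1)) hfail
  exact ⟨c, Real.le_sqrt_of_sq_le hc⟩

theorem exists_norm_prepare_sub_le {I : AnnealingData Ω} (hI : I.Admissible z ℓ δ) (m : ℕ) {j : ℕ}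
    (hj : j < ℓ) :
    ∃ c : Circle, ‖prepare I m j (gibbsState I 0) - c • gibbsState I j‖
      ≤ j * Real.sqrt (2 * (1 / 2) ^ 3 ^ m) := by
  induction j with
  | zero => exact ⟨1, by simp [prepare]⟩
  | succ j ih =>
    obtain ⟨c, hc⟩ := ih (Nat.lt_of_succ_lt hj)
    obtain ⟨c', hc'⟩ := exists_norm_fixedPoint_gibbsState_sub_le hI m (Nat.lt_of_succ_lt hj)
    set U := fixedPoint (gibbsState I j) (gibbsState I (j + 1)) m with hU
    refine ⟨c * c', ?_⟩
    have hsplit : prepare I m (j + 1) (gibbsState I 0) - (c * c') • gibbsState I (j + 1)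
        = U (prepare I m j (gibbsState I 0) - c • gibbsState I j)
          + c • (U (gibbsState I j) - c' • gibbsState I (j + 1)) := by
      simp only [prepare, ← hU, LinearIsometryEquiv.coe_mul, Function.comp_apply, map_sub,
        Circle.smul_def, map_smul, smul_sub, smul_smul, Circle.coe_mul]
      abel
    calc ‖prepare I m (j + 1) (gibbsState I 0) - (c * c') • gibbsState I (j + 1)‖
        ≤ ‖prepare I m j (gibbsState I 0) - c • gibbsState I j‖
          + ‖U (gibbsState I j) - c' • gibbsState I (j + 1)‖ := by
          rw [hsplit]
          refine (norm_add_le _ _).trans_eq ?_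
          rw [LinearIsometryEquiv.norm_map, Circle.smul_def c (_ - _), norm_smul, Circle.norm_coe,
            one_mul]
      _ ≤ (j + 1 : ℕ) * Real.sqrt (2 * (1 / 2) ^ 3 ^ m) := by push_cast; linarith

variable {X : Type*} [NormedAddCommGroup X] [InnerProductSpace ℂ X]
  {K : Type} [Fintype K] {i : ℕ}

theorem Implementable.fixedPoint {ι : X →ₗᵢ[ℂ] EuclideanSpace ℂ (Conf Ω K)}
    {s t : AnnealingData Ω → X} {w : ℕ} {e : ℝ}
    (hs : Implementable ℓ δ z i ι (fun I => phaseShift (s I) sixthRoot) w 0 e)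
    (ht : Implementable ℓ δ z i ι (fun I => phaseShift (t I) sixthRoot) w 0 e) (m : ℕ) :
    Implementable ℓ δ z i ι (fun I => fixedPoint (s I) (t I) m) ((3 ^ m - 1) * w) 0
      ((3 ^ m - 1) * e) := by
  induction m with
  | zero => exact (Implementable.free ℓ δ z i ι 1).mono (Nat.zero_le _) le_rfl (by simp)
  | succ m ih =>
    obtain ⟨n, hn⟩ := Nat.exists_eq_add_of_le' (Nat.one_le_pow m 3 three_pos)
    have hcount : 3 ^ (m + 1) - 1 = 3 * n + 2 := by rw [pow_succ, hn]; lia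
    refine (((((ih.mul hs).mul ih.inv).mul ht).mul ih).congr fun I _ => ?_).mono ?_ le_rfl
      (le_of_eq ?_)
    · rw [QPartition.fixedPoint, QPartition.fixedPoint, Function.iterate_succ_apply',
        fixedPointStep]
    · rw [hcount, hn, Nat.add_sub_cancel]
      exact le_of_eq (by ring)
    · rw [pow_succ]; ring

theorem implementable_prepare {w : ℕ} {e : ℝ}
    {ι : EuclideanSpace ℂ Ω →ₗᵢ[ℂ] EuclideanSpace ℂ (Conf Ω K)}
    (h : ∀ j < ℓ, Implementable ℓ δ z i ι (fun I => phaseShift (gibbsState I j) sixthRoot) w 0 e)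
    (m : ℕ) {j : ℕ} (hj : j < ℓ) :
    Implementable ℓ δ z i ι (fun I => prepare I m j) (j * ((3 ^ m - 1) * w)) 0
      (j * ((3 ^ m - 1) * e)) := by
  induction j with
  | zero => exact (Implementable.free ℓ δ z i ι 1).mono (Nat.zero_le _) le_rfl (by simp)
  | succ j ih =>
    have hstep := (h j (Nat.lt_of_succ_lt hj)).fixedPoint (h (j + 1) hj) m
    exact (hstep.mul (ih (Nat.lt_of_succ_lt hj))).mono (le_of_eq (by ring)) le_rfl
      (le_of_eq (by push_cast; ring))

end Preparation

section Grover

variable {Y : Type*} [NormedAddCommGroup Y] [InnerProductSpace ℂ Y]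

/-- The Grover iterate for the initial state `V s`: the reflection `F` followed by the reflection
about `V s`. -/
def grover (F V : Y ≃ₗᵢ[ℂ] Y) (s : Y) : Y ≃ₗᵢ[ℂ] Y :=
  LinearIsometryEquiv.neg ℂ * (V * phaseShift s (-1) * V⁻¹) * F

theorem grover_apply (F V : Y ≃ₗᵢ[ℂ] Y) {s : Y} (hs : ‖s‖ = 1) (y : Y) :
    grover F V s y = (2 * inner ℂ (V s) (F y)) • V s - F y := by
  have hneg : grover F V s y = -(V * phaseShift s (-1) * V⁻¹) (F y) := rfl
  have hcoe : ((-1 : Circle) : ℂ) = -1 := rfl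
  rw [hneg, conj_phaseShift_apply hs, hcoe]
  module

theorem grover_add_inv_apply {F : Y ≃ₗᵢ[ℂ] Y} (hF : F * F = 1) (V : Y ≃ₗᵢ[ℂ] Y) {s : Y}
    (hs : ‖s‖ = 1) :
    grover F V s (V s) + (grover F V s)⁻¹ (V s) = (2 * inner ℂ (V s) (F (V s))) • V s := by
  have hFF : F (F (V s)) = V s := DFunLike.congr_fun hF (V s)
  have hinv : (grover F V s)⁻¹ (V s) = F (V s) := by
    rw [LinearIsometryEquiv.coe_inv, LinearIsometryEquiv.symm_apply_eq, grover_apply F V hs, hFF,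
      inner_self_eq_norm_sq_to_K, V.norm_map, hs]
    simp only [map_one, one_pow]
    module
  rw [hinv, grover_apply F V hs, sub_add_cancel]

end Grover

theorem val_add_one_or_add_one_eq_zero {n : ℕ} [NeZero n] (k : Fin n) :
    ((k + 1 : Fin n) : ℕ) = k + 1 ∨ k + 1 = 0 ∧ (k : ℕ) + 1 = n := by
  obtain ⟨m, rfl⟩ := Nat.exists_eq_succ_of_ne_zero (NeZero.ne n)
  rw [Fin.val_add_one]
  split_ifs with h
  · exact Or.inr ⟨by rw [h, Fin.last_add_one], by rw [h, Fin.val_last]⟩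
  · exact Or.inl rfl

section Window

variable {p : ℕ}

/-- The tent-shaped amplitudes `0, 1, …, 2p, …, 1` on the cycle of length `4p`. -/
def tent (p : ℕ) (k : Fin (4 * p)) : ℝ := (min (k : ℕ) (4 * p - k) : ℕ)

theorem abs_tent_add_one_sub_le [NeZero p] (k : Fin (4 * p)) : |tent p (k + 1) - tent p k| ≤ 1 := by
  have hk := k.2
  rw [tent, tent, abs_sub_le_iff, sub_le_iff_le_add, sub_le_iff_le_add]
  rcases val_add_one_or_add_one_eq_zero k with h | ⟨h, hn⟩
  · rw [h]
    constructor <;> exact_mod_cast by omega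
  · rw [h, Fin.val_zero]
    constructor <;> exact_mod_cast by omega

theorem two_mul_pow_three_le_sum_tent_sq (p : ℕ) : 2 * (p : ℝ) ^ 3 ≤ ∑ k, tent p k ^ 2 := by
  set f : ℕ → ℝ := fun k => (min k (4 * p - k) : ℕ)
  have hsubset : Finset.Ico p (3 * p) ⊆ Finset.range (4 * p) := fun k hk => by
    rw [Finset.mem_Ico] at hk
    rw [Finset.mem_range]
    omega
  have hmid (k : ℕ) (hk : k ∈ Finset.Ico p (3 * p)) : (p : ℝ) ^ 2 ≤ f k ^ 2 := by
    rw [Finset.mem_Ico] at hk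
    exact pow_le_pow_left₀ (Nat.cast_nonneg _) (Nat.cast_le.2 (by omega)) 2
  have hcard : (Finset.Ico p (3 * p)).card = 2 * p := by rw [Nat.card_Ico]; omega
  calc 2 * (p : ℝ) ^ 3 = (Finset.Ico p (3 * p)).card • (p : ℝ) ^ 2 := by
        rw [hcard, nsmul_eq_mul]; push_cast; ring
    _ ≤ ∑ k ∈ Finset.Ico p (3 * p), f k ^ 2 := Finset.card_nsmul_le_sum _ _ _ hmid
    _ ≤ ∑ k ∈ Finset.range (4 * p), f k ^ 2 :=
        Finset.sum_le_sum_of_subset_of_nonneg hsubset fun k _ _ => sq_nonneg _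
    _ = ∑ k, tent p k ^ 2 := (Fin.sum_univ_eq_sum_range (fun k => f k ^ 2) _).symm

theorem exists_window (p : ℕ) [NeZero p] :
    ∃ a : Fin (4 * p) → ℝ, a 0 = 0 ∧ ∑ k, a k ^ 2 = 1 ∧
      ∀ k, (a (k + 1) - a k) ^ 2 ≤ 1 / (2 * (p : ℝ) ^ 3) := by
  have hp : (0 : ℝ) < p := Nat.cast_pos.2 (NeZero.pos p)
  have hle := two_mul_pow_three_le_sum_tent_sq p
  set S := ∑ k, tent p k ^ 2
  have hS : 0 < S := lt_of_lt_of_le (by positivity) hle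
  refine ⟨fun k => tent p k / Real.sqrt S, by simp [tent], ?_, fun k => ?_⟩
  · simp only [div_pow, Real.sq_sqrt hS.le]
    rw [← Finset.sum_div, div_self hS.ne']
  · rw [← sub_div, div_pow, Real.sq_sqrt hS.le, ← sq_abs]
    gcongr
    exact pow_le_one₀ (abs_nonneg _) (abs_tent_add_one_sub_le k)

end Window

section CyclicShift

variable {n : ℕ} [NeZero n]

/-- The cyclic shift of the coordinates. -/
def cyclicShift (n : ℕ) [NeZero n] : EuclideanSpace ℂ (Fin n) ≃ₗᵢ[ℂ] EuclideanSpace ℂ (Fin n) :=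
  LinearIsometryEquiv.piLpCongrLeft 2 ℂ ℂ (Equiv.addRight (1 : Fin n))

theorem cyclicShift_apply (v : EuclideanSpace ℂ (Fin n)) (k : Fin n) :
    cyclicShift n v k = v (k - 1) := by
  rw [sub_eq_add_neg]; rfl

theorem cyclicShift_inv_apply (v : EuclideanSpace ℂ (Fin n)) (k : Fin n) :
    (cyclicShift n)⁻¹ v k = v (k + 1) := by
  have h := cyclicShift_apply ((cyclicShift n)⁻¹ v) (k + 1)
  rw [add_sub_cancel_right] at h
  rw [← h]
  exact congrArg (· (k + 1)) ((cyclicShift n).apply_symm_apply v)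

/-- The self-adjoint part of the cyclic shift. Its eigenvalues are cosines, and its eigenbasis is
used in place of the Fourier basis. -/
def shiftCos (n : ℕ) [NeZero n] : EuclideanSpace ℂ (Fin n) →ₗ[ℂ] EuclideanSpace ℂ (Fin n) :=
  (1 / 2 : ℂ) • (toEnd (cyclicShift n) + toEnd (cyclicShift n)⁻¹)

theorem shiftCos_apply (v : EuclideanSpace ℂ (Fin n)) (k : Fin n) :
    shiftCos n v k = 1 / 2 * (v (k - 1) + v (k + 1)) := by
  simp only [shiftCos, LinearMap.smul_apply, LinearMap.add_apply, toEnd_apply, PiLp.smul_apply,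
    PiLp.add_apply, cyclicShift_apply, cyclicShift_inv_apply, smul_eq_mul]

theorem shiftCos_isSymmetric (n : ℕ) [NeZero n] : (shiftCos n).IsSymmetric := by
  intro v w
  have hshift : inner ℂ (cyclicShift n v) w = inner ℂ v ((cyclicShift n)⁻¹ w) :=
    LinearIsometryEquiv.inner_map_eq_flip _ v w
  have hinv : inner ℂ ((cyclicShift n)⁻¹ v) w = inner ℂ v (cyclicShift n w) :=
    LinearIsometryEquiv.inner_map_eq_flip _ v w
  have hconj : conj (1 / 2 : ℂ) = 1 / 2 := by rw [map_div₀, map_one, Complex.conj_ofNat]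
  simp only [shiftCos, LinearMap.smul_apply, LinearMap.add_apply, toEnd_apply, inner_smul_left,
    inner_smul_right, inner_add_left, inner_add_right, hshift, hinv, hconj]
  rw [add_comm]

/-- The eigenvalues of `shiftCos`. -/
def shiftEigenvalue (n : ℕ) [NeZero n] : Fin n → ℝ :=
  (shiftCos_isSymmetric n).eigenvalues finrank_euclideanSpace_fin

/-- Coordinates in an eigenbasis of `shiftCos`. -/
def shiftBasis (n : ℕ) [NeZero n] : EuclideanSpace ℂ (Fin n) ≃ₗᵢ[ℂ] EuclideanSpace ℂ (Fin n) :=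
  ((shiftCos_isSymmetric n).eigenvectorBasis finrank_euclideanSpace_fin).repr

theorem sum_shiftEigenvalue_sub_sq (v : EuclideanSpace ℂ (Fin n)) (c : ℝ) :
    ∑ k, (shiftEigenvalue n k - c) ^ 2 * ‖shiftBasis n v k‖ ^ 2
      = ‖shiftCos n v - (c : ℂ) • v‖ ^ 2 := by
  rw [← (shiftBasis n).norm_map (shiftCos n v - (c : ℂ) • v), EuclideanSpace.norm_sq_eq]
  refine Finset.sum_congr rfl fun k _ => ?_
  have hdiag : shiftBasis n (shiftCos n v) k = (shiftEigenvalue n k : ℂ) * shiftBasis n v k :=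
    (shiftCos_isSymmetric n).eigenvectorBasis_apply_self_apply finrank_euclideanSpace_fin v k
  rw [map_sub, map_smul, PiLp.sub_apply, PiLp.smul_apply, hdiag, smul_eq_mul, ← sub_mul, norm_mul,
    mul_pow, ← Complex.ofReal_sub, Complex.norm_real, Real.norm_eq_abs, sq_abs]

/-- Change of basis of an index register to the eigenbasis of `shiftCos`. -/
def readIndex {C J : Type*} [Fintype C] [Fintype J] (e : C ≃ Fin n × J) :
    EuclideanSpace ℂ C ≃ₗᵢ[ℂ] EuclideanSpace ℂ C :=
  blockIso (e.trans (Equiv.prodComm _ _)) fun _ => shiftBasis n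

theorem sum_readIndex {C J : Type*} [Fintype C] [Fintype J] (e : C ≃ Fin n × J) (c : ℝ)
    (Ψ : EuclideanSpace ℂ C) :
    ∑ q, (shiftEigenvalue n (e q).1 - c) ^ 2 * ‖readIndex e Ψ q‖ ^ 2
      = ∑ k, ‖(1 / 2 : ℂ) • (slice e (k - 1) Ψ + slice e (k + 1) Ψ)
          - (c : ℂ) • slice e k Ψ‖ ^ 2 := by
  set e' := e.trans (Equiv.prodComm _ _) with he'
  have hrow (y : J) : ∑ k, (shiftEigenvalue n k - c) ^ 2 * ‖readIndex e Ψ (e'.symm (y, k))‖ ^ 2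
      = ∑ k, ‖(shiftCos n (slice e' y Ψ) - (c : ℂ) • slice e' y Ψ) k‖ ^ 2 := by
    rw [← EuclideanSpace.norm_sq_eq, ← sum_shiftEigenvalue_sub_sq]
    simp only [readIndex, ← he', blockIso_apply, Equiv.apply_symm_apply]
  calc ∑ q, (shiftEigenvalue n (e q).1 - c) ^ 2 * ‖readIndex e Ψ q‖ ^ 2
      = ∑ y, ∑ k, (shiftEigenvalue n k - c) ^ 2 * ‖readIndex e Ψ (e'.symm (y, k))‖ ^ 2 := by
        rw [← Equiv.sum_comp e'.symm, Fintype.sum_prod_type]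
        simp [he']
    _ = ∑ k, ∑ y, ‖(shiftCos n (slice e' y Ψ) - (c : ℂ) • slice e' y Ψ) k‖ ^ 2 := by
        simp only [hrow]
        exact Finset.sum_comm
    _ = _ := by simp [EuclideanSpace.norm_sq_eq, shiftCos_apply, he', mul_add]

end CyclicShift

section WindowOrbit

variable {n : ℕ} {Y : Type*} [NormedAddCommGroup Y] [InnerProductSpace ℂ Y]

/-- The orbit of `ψ` under the powers of `g`, weighted by the amplitudes `a`. -/
def windowOrbit (g : Y ≃ₗᵢ[ℂ] Y) (a : Fin n → ℝ) (ψ : Y) (k : Fin n) : Y :=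
  (a k : ℂ) • (g ^ (k : ℕ)) ψ

theorem apply_add_inv_apply_windowOrbit {g : Y ≃ₗᵢ[ℂ] Y} {ψ : Y} {c : ℂ}
    (h : g ψ + g⁻¹ ψ = c • ψ) (a : Fin n → ℝ) (k : Fin n) :
    g (windowOrbit g a ψ k) + g⁻¹ (windowOrbit g a ψ k) = c • windowOrbit g a ψ k := by
  have hg : g ((g ^ (k : ℕ)) ψ) = (g ^ (k : ℕ)) (g ψ) :=
    DFunLike.congr_fun (Commute.self_pow g k).eq ψ
  have hinv : g⁻¹ ((g ^ (k : ℕ)) ψ) = (g ^ (k : ℕ)) (g⁻¹ ψ) :=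
    DFunLike.congr_fun ((Commute.refl g).inv_left.pow_right k).eq ψ
  rw [windowOrbit, map_smul, map_smul, hg, hinv, ← smul_add, ← map_add, h, map_smul, smul_comm]

variable [NeZero n]

theorem norm_windowOrbit_add_one_sub (g : Y ≃ₗᵢ[ℂ] Y) {a : Fin n → ℝ} (ha : a 0 = 0) {ψ : Y}
    (hψ : ‖ψ‖ = 1) (k : Fin n) :
    ‖windowOrbit g a ψ (k + 1) - g (windowOrbit g a ψ k)‖ = |a (k + 1) - a k| := by
  have hg : g (windowOrbit g a ψ k) = (a k : ℂ) • (g ^ ((k : ℕ) + 1)) ψ := by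
    rw [windowOrbit, map_smul, pow_succ']
    rfl
  rw [hg, windowOrbit]
  rcases val_add_one_or_add_one_eq_zero k with h | ⟨h, -⟩
  · rw [h, ← sub_smul, norm_smul, LinearIsometryEquiv.norm_map, hψ, mul_one, ← Complex.ofReal_sub,
      Complex.norm_real, Real.norm_eq_abs]
  · simp [h, ha, norm_smul, hψ]

theorem norm_windowOrbit_sub_one_sub (g : Y ≃ₗᵢ[ℂ] Y) {a : Fin n → ℝ} (ha : a 0 = 0) {ψ : Y}
    (hψ : ‖ψ‖ = 1) (k : Fin n) :
    ‖windowOrbit g a ψ (k - 1) - g⁻¹ (windowOrbit g a ψ k)‖ = |a k - a (k - 1)| := by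
  have h := norm_windowOrbit_add_one_sub g ha hψ (k - 1)
  rw [sub_add_cancel] at h
  rw [← g.norm_map, map_sub, ← h, norm_sub_rev]
  congr 2
  exact g.apply_symm_apply _

theorem sum_norm_windowOrbit_sub_sq_le {g : Y ≃ₗᵢ[ℂ] Y} {ψ : Y} (hψ : ‖ψ‖ = 1) {c : ℂ}
    (h : g ψ + g⁻¹ ψ = (2 * c) • ψ) {a : Fin n → ℝ} (ha0 : a 0 = 0) {A : ℝ}
    (ha : ∀ k, (a (k + 1) - a k) ^ 2 ≤ A) :
    ∑ k, ‖(1 / 2 : ℂ) • (windowOrbit g a ψ (k - 1) + windowOrbit g a ψ (k + 1))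
      - c • windowOrbit g a ψ k‖ ^ 2 ≤ n * A := by
  refine (Finset.sum_le_card_nsmul Finset.univ _ A fun k _ => ?_).trans_eq (by simp)
  set v := windowOrbit g a ψ with hv
  have hdown : ‖v (k - 1) - g⁻¹ (v k)‖ ^ 2 ≤ A := by
    rw [hv, norm_windowOrbit_sub_one_sub g ha0 hψ, sq_abs]
    simpa only [sub_add_cancel] using ha (k - 1)
  have hup : ‖v (k + 1) - g (v k)‖ ^ 2 ≤ A := by
    rw [hv, norm_windowOrbit_add_one_sub g ha0 hψ, sq_abs]
    exact ha k
  have hc : c • v k = (1 / 2 : ℂ) • (g (v k) + g⁻¹ (v k)) := by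
    rw [hv, apply_add_inv_apply_windowOrbit h]
    module
  have hsplit : (1 / 2 : ℂ) • (v (k - 1) + v (k + 1)) - c • v k
      = (1 / 2 : ℂ) • ((v (k - 1) - g⁻¹ (v k)) + (v (k + 1) - g (v k))) := by
    rw [hc]; module
  have hnorm : ‖(1 / 2 : ℂ) • (v (k - 1) + v (k + 1)) - c • v k‖
      ≤ 1 / 2 * (‖v (k - 1) - g⁻¹ (v k)‖ + ‖v (k + 1) - g (v k)‖) := by
    rw [hsplit, norm_smul]
    exact mul_le_mul (by norm_num) (norm_add_le _ _) (norm_nonneg _) (by norm_num)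
  nlinarith [norm_nonneg ((1 / 2 : ℂ) • (v (k - 1) + v (k + 1)) - c • v k),
    sq_nonneg (‖v (k - 1) - g⁻¹ (v k)‖ - ‖v (k + 1) - g (v k)‖)]

end WindowOrbit

section Estimation

variable {Ω : Type*} [Fintype Ω] {n : ℕ}

/-- Separates the index register of the amplitude estimation from the system and the memory bit. -/
def indexEquiv (Ω : Type*) (n : ℕ) : Ω × (Fin 2 × Fin n) ≃ Fin n × (Ω × Fin 2) where
  toFun c := (c.2.2, (c.1, c.2.1))
  invFun c := (c.2.1, (c.2.2, c.1))

/-- The embedding `v ↦ v ⊗ |0⟩`, which adjoins a bit. -/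
def zeroBit (Ω : Type*) [Fintype Ω] :
    EuclideanSpace ℂ Ω →ₗᵢ[ℂ] EuclideanSpace ℂ (Ω × Fin 2) :=
  withMemory Ω (a := EuclideanSpace.single 0 1) (by simp)

/-- The reflection that changes the sign of the bit value `0`. -/
def markBit (Ω : Type*) [Fintype Ω] :
    EuclideanSpace ℂ (Ω × Fin 2) ≃ₗᵢ[ℂ] EuclideanSpace ℂ (Ω × Fin 2) :=
  diagIso fun c => if c.2 = 0 then -1 else 1

theorem markBit_mul_self (Ω : Type*) [Fintype Ω] : markBit Ω * markBit Ω = 1 := by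
  ext ψ ⟨x, b⟩
  by_cases hb : b = 0 <;> simp [markBit, hb]

/-- The rotation of the bit by the angle `θ x`, controlled on the system. -/
def bitRotation (θ : Ω → ℝ) :
    EuclideanSpace ℂ (Ω × Fin 2) ≃ₗᵢ[ℂ] EuclideanSpace ℂ (Ω × Fin 2) :=
  blockIso (Equiv.refl (Ω × Fin 2)) fun x => planeRotation (θ x)

theorem bitRotation_zeroBit_apply_zero (θ : Ω → ℝ) (s : EuclideanSpace ℂ Ω) (x : Ω) :
    bitRotation θ (zeroBit Ω s) (x, 0) = Real.cos (θ x) * s x := by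
  simp [bitRotation, blockIso_apply, planeRotation_apply_zero, zeroBit]

theorem bitRotation_zeroBit_apply_one (θ : Ω → ℝ) (s : EuclideanSpace ℂ Ω) (x : Ω) :
    bitRotation θ (zeroBit Ω s) (x, 1) = -(Real.sin (θ x) * s x) := by
  simp [bitRotation, blockIso_apply, planeRotation_apply_one, zeroBit]

theorem inner_bitRotation_markBit (θ : Ω → ℝ) {s : EuclideanSpace ℂ Ω} (hs : ‖s‖ = 1) :
    inner ℂ (bitRotation θ (zeroBit Ω s)) (markBit Ω (bitRotation θ (zeroBit Ω s)))
      = ((1 - 2 * ∑ x, ‖s x‖ ^ 2 * Real.cos (θ x) ^ 2 : ℝ) : ℂ) := by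
  set ψ := bitRotation θ (zeroBit Ω s) with hψ
  have hmark (x : Ω) : ∑ b, inner ℂ (ψ (x, b)) (markBit Ω ψ (x, b))
      = ((‖ψ (x, 1)‖ ^ 2 - ‖ψ (x, 0)‖ ^ 2 : ℝ) : ℂ) := by
    simp [markBit, Fin.sum_univ_two, Complex.mul_conj, Complex.normSq_eq_norm_sq]
    ring
  have hnorm (x : Ω) : ‖ψ (x, 1)‖ ^ 2 - ‖ψ (x, 0)‖ ^ 2
      = ‖s x‖ ^ 2 - 2 * (‖s x‖ ^ 2 * Real.cos (θ x) ^ 2) := by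
    rw [hψ, bitRotation_zeroBit_apply_zero, bitRotation_zeroBit_apply_one, norm_neg, norm_mul,
      norm_mul, Complex.norm_real, Complex.norm_real, mul_pow, mul_pow, Real.norm_eq_abs,
      Real.norm_eq_abs, sq_abs, sq_abs, Real.sin_sq]
    ring
  rw [PiLp.inner_apply, Fintype.sum_prod_type]
  simp only [hmark, hnorm]
  rw [← Complex.ofReal_sum, Finset.sum_sub_distrib, ← Finset.mul_sum,
    ← EuclideanSpace.norm_sq_eq, hs, one_pow]

/-- The Grover iterate for the state `s`, rotated by the angles `θ`, and the marked bit `0`. -/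
def groverStep (θ : Ω → ℝ) (s : EuclideanSpace ℂ Ω) :
    EuclideanSpace ℂ (Ω × Fin 2) ≃ₗᵢ[ℂ] EuclideanSpace ℂ (Ω × Fin 2) :=
  grover (markBit Ω) (bitRotation θ) (zeroBit Ω s)

theorem groverStep_add_inv_apply (θ : Ω → ℝ) {s : EuclideanSpace ℂ Ω} (hs : ‖s‖ = 1) :
    groverStep θ s (bitRotation θ (zeroBit Ω s)) + (groverStep θ s)⁻¹ (bitRotation θ (zeroBit Ω s))
      = (2 * ((1 - 2 * ∑ x, ‖s x‖ ^ 2 * Real.cos (θ x) ^ 2 : ℝ) : ℂ))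
          • bitRotation θ (zeroBit Ω s) := by
  rw [groverStep, grover_add_inv_apply (markBit_mul_self Ω) _
    (by rw [LinearIsometry.norm_map, hs]), inner_bitRotation_markBit θ hs]

/-- The rotation of the memory bit by the angle `θ x`. -/
def memoryRotation (θ : Ω → ℝ) (n : ℕ) :
    EuclideanSpace ℂ (Ω × (Fin 2 × Fin n)) ≃ₗᵢ[ℂ] EuclideanSpace ℂ (Ω × (Fin 2 × Fin n)) :=
  blockIso (indexEquiv Ω n) fun _ => bitRotation θ

/-- Amplitude estimation: the memory bit is rotated, `k` Grover iterates are applied for the index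
value `k`, and the index register is read out in the eigenbasis of `shiftCos`. -/
def estimate (θ : Ω → ℝ) (s : EuclideanSpace ℂ Ω) (n : ℕ) [NeZero n] :
    EuclideanSpace ℂ (Ω × (Fin 2 × Fin n)) ≃ₗᵢ[ℂ] EuclideanSpace ℂ (Ω × (Fin 2 × Fin n)) :=
  readIndex (indexEquiv Ω n) * blockIso (indexEquiv Ω n) (fun k => groverStep θ s ^ (k : ℕ))
    * memoryRotation θ n

/-- The memory state with bit `0` and index amplitudes `a`. -/
def windowState (a : Fin n → ℝ) : EuclideanSpace ℂ (Fin 2 × Fin n) :=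
  WithLp.toLp 2 fun m => if m.1 = 0 then (a m.2 : ℂ) else 0

theorem norm_windowState {a : Fin n → ℝ} (ha : ∑ k, a k ^ 2 = 1) : ‖windowState a‖ = 1 := by
  rw [← sq_eq_sq₀ (norm_nonneg _) zero_le_one, EuclideanSpace.norm_sq_eq, Fintype.sum_prod_type]
  simp [windowState, ha]

theorem slice_indexEquiv_withMemory_windowState {a : Fin n → ℝ} (ha : ‖windowState a‖ = 1)
    (s : EuclideanSpace ℂ Ω) (k : Fin n) :
    slice (indexEquiv Ω n) k (withMemory Ω ha s) = (a k : ℂ) • zeroBit Ω s := by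
  ext ⟨x, b⟩
  by_cases hb : b = 0 <;> simp [hb, indexEquiv, windowState, zeroBit, mul_comm]

theorem sum_estimate_le [NeZero n] (θ : Ω → ℝ) {s : EuclideanSpace ℂ Ω} (hs : ‖s‖ = 1)
    {a : Fin n → ℝ} (ha0 : a 0 = 0) (ha1 : ‖windowState a‖ = 1) {A : ℝ}
    (ha : ∀ k, (a (k + 1) - a k) ^ 2 ≤ A) :
    ∑ q, (shiftEigenvalue n q.2.2 - (1 - 2 * ∑ x, ‖s x‖ ^ 2 * Real.cos (θ x) ^ 2)) ^ 2
      * ‖estimate θ s n (withMemory Ω ha1 s) q‖ ^ 2 ≤ n * A := by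
  have hψ : ‖bitRotation θ (zeroBit Ω s)‖ = 1 := by
    rw [LinearIsometryEquiv.norm_map, LinearIsometry.norm_map, hs]
  set Ψ := (blockIso (indexEquiv Ω n) (fun k => groverStep θ s ^ (k : ℕ)) * memoryRotation θ n)
    (withMemory Ω ha1 s) with hΨ
  have hslice (k : Fin n) : slice (indexEquiv Ω n) k Ψ
      = windowOrbit (groverStep θ s) a (bitRotation θ (zeroBit Ω s)) k := by
    rw [hΨ, memoryRotation, ← blockIso_mul, slice_blockIso,
      slice_indexEquiv_withMemory_windowState, map_smul]
    rfl
  have hread := sum_readIndex (indexEquiv Ω n)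
    (1 - 2 * ∑ x, ‖s x‖ ^ 2 * Real.cos (θ x) ^ 2) Ψ
  simp only [hslice] at hread
  exact hread.trans_le (sum_norm_windowOrbit_sub_sq_le hψ (groverStep_add_inv_apply θ hs) ha0 ha)

end Estimation

section EstimationCircuit

variable {Ω : Type*} [Fintype Ω] {n : ℕ}

/-- The phase `-1` on the memory bit `0` for the indices larger than `t`. -/
def markPhase (n t : ℕ) (m : Fin 2 × Fin n) : Circle := if m.1 = 0 ∧ t < (m.2 : ℕ) then -1 else 1

theorem controlledPhase_markPhase {s : EuclideanSpace ℂ Ω} (hs : ‖s‖ = 1) (n t : ℕ) :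
    controlledPhase s (markPhase n t) = blockIso (indexEquiv Ω n) fun k =>
      if t < (k : ℕ) then phaseShift (zeroBit Ω s) (-1) else 1 := by
  have hs' : ‖zeroBit Ω s‖ = 1 := by rw [LinearIsometry.norm_map, hs]
  ext Ψ ⟨x, b, k⟩
  rw [controlledPhase, blockIso_apply, blockIso_apply, phaseShift_apply hs]
  by_cases ht : t < (k : ℕ)
  · have hinner : inner ℂ (zeroBit Ω s) (slice (indexEquiv Ω n) k Ψ)
        = inner ℂ s (slice (Equiv.prodComm Ω (Fin 2 × Fin n)) (0, k) Ψ) := by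
      simp [PiLp.inner_apply, Fintype.sum_prod_type, zeroBit, indexEquiv]
    simp only [indexEquiv, Equiv.coe_fn_mk, ht, if_true, phaseShift_apply hs']
    rw [← indexEquiv, hinner]
    fin_cases b <;> simp [ht, markPhase, zeroBit, indexEquiv]
  · simp [ht, markPhase, indexEquiv]

theorem blockIso_groverStep (θ : Ω → ℝ) {s : EuclideanSpace ℂ Ω} (hs : ‖s‖ = 1) (n t : ℕ) :
    (blockIso (indexEquiv Ω n) fun k => if t < (k : ℕ) then groverStep θ s else 1)
      = blockIso (indexEquiv Ω n) (fun k => if t < (k : ℕ) then LinearIsometryEquiv.neg ℂ else 1)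
        * (memoryRotation θ n * controlledPhase s (markPhase n t) * (memoryRotation θ n)⁻¹)
        * blockIso (indexEquiv Ω n) (fun k => if t < (k : ℕ) then markBit Ω else 1) := by
  rw [controlledPhase_markPhase hs, memoryRotation, ← blockIso_inv, ← blockIso_mul,
    ← blockIso_mul, ← blockIso_mul, ← blockIso_mul]
  congr 1
  funext k
  by_cases ht : t < (k : ℕ) <;> simp [ht, groverStep, grover]

variable [DecidableEq Ω] {K : Type} [Fintype K] {ℓ i : ℕ} {δ : ℝ} {z : Ω}

theorem Implementable.blockIso_pow {C J : Type*} [Fintype C] [Fintype J]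
    {ι : EuclideanSpace ℂ C →ₗᵢ[ℂ] EuclideanSpace ℂ (Conf Ω K)} {e : C ≃ Fin n × J}
    {g : AnnealingData Ω → (EuclideanSpace ℂ J ≃ₗᵢ[ℂ] EuclideanSpace ℂ J)} {w v : ℕ} {ε : ℝ}
    (h : ∀ t, Implementable ℓ δ z i ι
      (fun I => blockIso e fun k => if t < (k : ℕ) then g I else 1) w v ε) :
    Implementable ℓ δ z i ι (fun I => blockIso e fun k => g I ^ (k : ℕ))
      (n * w) (n * v) (n * ε) := by
  have hmin (t : ℕ) : Implementable ℓ δ z i ι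
      (fun I => blockIso e fun k => g I ^ min (k : ℕ) t) (t * w) (t * v) (t * ε) := by
    induction t with
    | zero =>
      refine ((Implementable.free ℓ δ z i ι 1).congr fun I _ => ?_).mono
        (Nat.zero_le _) (Nat.zero_le _) (by simp)
      simp only [min_zero, pow_zero]
      exact (blockIso_one e).symm
    | succ t ih =>
      refine (((h t).mul ih).congr fun I _ => ?_).mono (by lia) (by lia) (by push_cast; linarith)
      rw [← blockIso_mul]
      congr 1
      funext k
      by_cases ht : t < (k : ℕ)
      · simp [ht, min_eq_right ht.le, pow_succ']
      · simp [ht, min_eq_left (not_lt.1 ht), min_eq_left ((not_lt.1 ht).trans t.le_succ)]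
  refine (hmin n).congr fun I _ => ?_
  simp only [min_eq_left (Fin.is_lt _).le]

/-- Exchanges the qubit and the memory bit. -/
def exchangeEquiv (Ω : Type*) (n d : ℕ) :
    Conf Ω ((Fin 2 × Fin n) × Fin (d + 1)) ≃ Conf Ω ((Fin 2 × Fin n) × Fin (d + 1)) :=
  Function.Involutive.toPerm (fun c => (c.1, (c.2.2.1.1, ((c.2.1, c.2.2.1.2), c.2.2.2))))
    fun _ => rfl

variable {d : ℕ} {χ : EuclideanSpace ℂ (Fin (d + 1))} {hχ : ‖χ‖ = 1}

theorem run_exchange_rot_exchange (I : AnnealingData Ω) (z : Ω) (i : ℕ)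
    (v : EuclideanSpace ℂ (Ω × (Fin 2 × Fin n))) :
    run I z i [(Gate.free (LinearIsometryEquiv.piLpCongrLeft 2 ℂ ℂ (exchangeEquiv Ω n d)) :
        Gate Ω ((Fin 2 × Fin n) × Fin (d + 1)) ℓ), Gate.rot,
        Gate.free (LinearIsometryEquiv.piLpCongrLeft 2 ℂ ℂ (exchangeEquiv Ω n d))]
      (logical z (Fin 2 × Fin n) hχ v)
      = logical z (Fin 2 × Fin n) hχ (memoryRotation (rotationAngle I i) n v) := by
  set X := LinearIsometryEquiv.piLpCongrLeft 2 ℂ ℂ (exchangeEquiv Ω n d)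
  ext ⟨⟨x, y⟩, b', ⟨b, k⟩, κ⟩
  have hrun : run I z i [(Gate.free X : Gate Ω ((Fin 2 × Fin n) × Fin (d + 1)) ℓ), Gate.rot,
        Gate.free X] (logical z (Fin 2 × Fin n) hχ v) ((x, y), (b', ((b, k), κ)))
      = planeRotation (rotationAngle I i x) (WithLp.toLp 2 fun b'' =>
          logical z (Fin 2 × Fin n) hχ v ((x, y), (b', ((b'', k), κ)))) b := by
    simp only [run_cons]
    exact blockIso_apply (qubitEquiv Ω ((Fin 2 × Fin n) × Fin (d + 1)))
      (fun c => planeRotation (rotationAngle I i c.1.1)) (X (logical z (Fin 2 × Fin n) hχ v))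
      ((x, y), (b, ((b', k), κ)))
  rw [hrun]
  by_cases hb : b' = 0 ∧ y = z
  · obtain ⟨rfl, rfl⟩ := hb
    have h1 : (WithLp.toLp 2 fun b'' =>
        logical y (Fin 2 × Fin n) hχ v ((x, y), (0, ((b'', k), κ))) : EuclideanSpace ℂ (Fin 2))
        = χ κ • WithLp.toLp 2 fun b'' => v (x, (b'', k)) := by
      ext b''
      simp [logical_apply, qubitState]
    rw [h1, map_smul]
    simp only [logical_apply, qubitState, memoryRotation, bitRotation, blockIso_apply,
      PiLp.smul_apply, inA_apply, slice_apply, if_true]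
    rfl
  · have h1 : (WithLp.toLp 2 fun b'' =>
        logical z (Fin 2 × Fin n) hχ v ((x, y), (b', ((b'', k), κ))) : EuclideanSpace ℂ (Fin 2))
        = 0 := by
      ext b''
      rcases not_and_or.1 hb with h | h <;> simp [logical_apply, qubitState, h]
    rw [h1, map_zero]
    rcases not_and_or.1 hb with h | h <;> simp [logical_apply, qubitState, h]

theorem implementable_memoryRotation :
    Implementable ℓ δ z i (logical z (Fin 2 × Fin n) hχ)
      (fun I => memoryRotation (rotationAngle I i) n) 0 1 0 := by
  set X : EuclideanSpace ℂ (Conf Ω ((Fin 2 × Fin n) × Fin (d + 1))) ≃ₗᵢ[ℂ] _ :=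
    LinearIsometryEquiv.piLpCongrLeft 2 ℂ ℂ (exchangeEquiv Ω n d)
  refine ⟨[Gate.free X, Gate.rot, Gate.free X], by simp [walkTotal, Gate.walkCost],
    by simp [rotTotal, Gate.rotCost], fun I _ v => ?_⟩
  rw [run_exchange_rot_exchange, sub_self, norm_zero, zero_mul]

theorem implementable_estimate [NeZero n] {w : ℕ} {e : ℝ}
    (h : ∀ φ : Fin 2 × Fin n → Circle, Implementable ℓ δ z i (logical z (Fin 2 × Fin n) hχ)
      (fun I => controlledPhase (gibbsState I i) φ) w 0 e) :
    Implementable ℓ δ z i (logical z (Fin 2 × Fin n) hχ)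
      (fun I => estimate (rotationAngle I i) (gibbsState I i) n) (n * w) (2 * n + 1) (n * e) := by
  have : Nonempty Ω := ⟨z⟩
  have hrot := implementable_memoryRotation (ℓ := ℓ) (δ := δ) (z := z) (i := i) (n := n) (hχ := hχ)
  have hfree := Implementable.free ℓ δ z i (logical z (Fin 2 × Fin n) hχ)
  have hgrover (t : ℕ) : Implementable ℓ δ z i (logical z (Fin 2 × Fin n) hχ)
      (fun I => blockIso (indexEquiv Ω n) fun k =>
        if t < (k : ℕ) then groverStep (rotationAngle I i) (gibbsState I i) else 1) w 2 e :=
    ((((hfree _).mul ((hrot.mul (h (markPhase n t))).mul hrot.inv)).mul (hfree _)).congr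
      fun I _ => (blockIso_groverStep _ (norm_gibbsState I i) n t).symm).mono
        (by lia) (by lia) (by linarith)
  exact (((hfree _).mul (Implementable.blockIso_pow hgrover)).mul hrot).mono
    (by lia) (by lia) (by linarith)

end EstimationCircuit

section Measurement

variable {C : Type*} [Fintype C]

theorem one_sub_le_sum_filter_norm_sq (p : C → Prop) [DecidablePred p] {ξ : EuclideanSpace ℂ C}
    (hξ : ‖ξ‖ = 1) (ζ : EuclideanSpace ℂ C) :
    1 - 2 * (∑ c with ¬p c, ‖ζ c‖ ^ 2 + ‖ξ - ζ‖ ^ 2) ≤ ∑ c with p c, ‖ξ c‖ ^ 2 := by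
  have htotal : ∑ c with p c, ‖ξ c‖ ^ 2 + ∑ c with ¬p c, ‖ξ c‖ ^ 2 = 1 := by
    rw [Finset.sum_filter_add_sum_filter_not, ← EuclideanSpace.norm_sq_eq, hξ, one_pow]
  have hpoint (c : C) : ‖ξ c‖ ^ 2 ≤ 2 * (‖ζ c‖ ^ 2 + ‖(ξ - ζ) c‖ ^ 2) := by
    have hle : ‖ξ c‖ ≤ ‖ζ c‖ + ‖(ξ - ζ) c‖ := by
      rw [PiLp.sub_apply]
      exact norm_le_norm_add_norm_sub' _ _
    exact (pow_le_pow_left₀ (norm_nonneg _) hle 2).trans add_sq_le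
  have hdist : ∑ c with ¬p c, ‖(ξ - ζ) c‖ ^ 2 ≤ ‖ξ - ζ‖ ^ 2 := by
    rw [EuclideanSpace.norm_sq_eq]
    exact Finset.sum_le_univ_sum_of_nonneg fun _ => sq_nonneg _
  have hbad := Finset.sum_le_sum fun c (_ : c ∈ Finset.univ.filter fun c => ¬p c) => hpoint c
  rw [← Finset.mul_sum, Finset.sum_add_distrib] at hbad
  linarith

theorem mul_sum_filter_le (p : C → Prop) [DecidablePred p] {ε : ℝ} (hε : 0 ≤ ε) (f w : C → ℝ)
    (hw : ∀ c, 0 ≤ w c) (hp : ∀ c, |f c| ≤ ε → p c) :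
    ε ^ 2 * ∑ c with ¬p c, w c ≤ ∑ c, f c ^ 2 * w c := by
  rw [Finset.mul_sum]
  refine (Finset.sum_le_sum fun c hc => ?_).trans
    (Finset.sum_le_univ_sum_of_nonneg fun c => mul_nonneg (sq_nonneg (f c)) (hw c))
  have hlt : ε < |f c| := not_le.1 fun h => (Finset.mem_filter.1 hc).2 (hp c h)
  rw [← sq_abs (f c)]
  exact mul_le_mul_of_nonneg_right (pow_le_pow_left₀ hε hlt.le 2) (hw c)

end Measurement

section Assembly

variable {Ω : Type*} [Fintype Ω] [DecidableEq Ω] {z : Ω} {ℓ i : ℕ} {δ : ℝ}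

theorem sum_mul_norm_sq_logical {M : Type} [Fintype M] {d : ℕ} (z : Ω)
    {χ : EuclideanSpace ℂ (Fin (d + 1))} (hχ : ‖χ‖ = 1) (f : M → ℝ)
    (v : EuclideanSpace ℂ (Ω × M)) :
    ∑ c, f c.2.2.1 ^ 2 * ‖logical z M hχ v c‖ ^ 2 = ∑ q, f q.2 ^ 2 * ‖v q‖ ^ 2 := by
  set u : EuclideanSpace ℂ (Ω × M) := WithLp.toLp 2 fun q => (f q.2 : ℂ) * v q
  have hlogical (c : Conf Ω (M × Fin (d + 1))) :
      logical z M hχ u c = f c.2.2.1 * logical z M hχ v c := by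
    obtain ⟨⟨x, y⟩, b, m, k⟩ := c
    by_cases hb : b = 0 <;> by_cases hy : y = z <;>
      simp [u, logical_apply, qubitState, hb, hy, mul_left_comm]
  have hnorm := congrArg (· ^ 2) ((logical z M hχ).norm_map u)
  simpa only [EuclideanSpace.norm_sq_eq, hlogical, u, norm_mul, mul_pow, Complex.norm_real,
    Real.norm_eq_abs, sq_abs] using hnorm

theorem sum_norm_gibbsState_mul_cos_sq {I : AnnealingData Ω} (hI : I.Admissible z ℓ δ)
    (hi : i < ℓ) :
    ∑ x, ‖gibbsState I i x‖ ^ 2 * Real.cos (rotationAngle I i x) ^ 2 = I.ratio i := by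
  have : Nonempty Ω := ⟨z⟩
  rw [AnnealingData.ratio, eq_div_iff (partitionFn_pos _ _).ne', Finset.sum_mul,
    partitionFn.eq_def I.energy (I.beta (i + 1))]
  refine Finset.sum_congr rfl fun x _ => ?_
  obtain ⟨hy0, hy1⟩ := yval_mem_Icc hI hi x
  have hcos : Real.cos (rotationAngle I i x) ^ 2 = I.yval i x := by
    rw [rotationAngle, Real.cos_arccos (by linarith [Real.sqrt_nonneg (I.yval i x)])
      (Real.sqrt_le_one.2 hy1), Real.sq_sqrt hy0]
  have hamp : ‖gibbsState I i x‖ ^ 2 = boltzmann I.energy (I.beta i) x := by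
    rw [gibbsState, qsample_apply, Complex.norm_real, Real.norm_eq_abs, sq_abs,
      Real.sq_sqrt (boltzmann_pos _ _ _).le]
  rw [hcos, hamp, mul_right_comm, boltzmann, div_mul_cancel₀ _ (partitionFn_pos _ _).ne',
    AnnealingData.yval, ← Real.exp_add]
  ring_nf

variable {n : ℕ} [NeZero n] {d : ℕ} {χ : EuclideanSpace ℂ (Fin (d + 1))} {hχ : ‖χ‖ = 1}

theorem mul_sum_filter_estimate_le (hi : i < ℓ) {a : Fin n → ℝ} (ha0 : a 0 = 0)
    (ha1 : ‖windowState a‖ = 1) {A : ℝ} (ha : ∀ k, (a (k + 1) - a k) ^ 2 ≤ A)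
    {I : AnnealingData Ω} (hI : I.Admissible z ℓ δ) {ε : ℝ} (hε : 0 ≤ ε)
    (p : Conf Ω ((Fin 2 × Fin n) × Fin (d + 1)) → Prop) [DecidablePred p]
    (hp : ∀ c, |shiftEigenvalue n c.2.2.1.2 - (1 - 2 * I.ratio i)| ≤ ε → p c) :
    ε ^ 2 * ∑ c with ¬p c, ‖logical z (Fin 2 × Fin n) hχ
      (estimate (rotationAngle I i) (gibbsState I i) n (withMemory Ω ha1 (gibbsState I i))) c‖ ^ 2
      ≤ n * A := by
  have : Nonempty Ω := ⟨z⟩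
  refine (mul_sum_filter_le p hε _ _ (fun _ => sq_nonneg _) hp).trans ?_
  rw [sum_mul_norm_sq_logical z hχ
    fun m : Fin 2 × Fin n => shiftEigenvalue n m.2 - (1 - 2 * I.ratio i),
    ← sum_norm_gibbsState_mul_cos_sq hI hi]
  exact sum_estimate_le (rotationAngle I i) (norm_gibbsState I i) ha0 ha1 ha

theorem three_quarters_le_sum_filter_estimate (hi : i < ℓ) {a : Fin n → ℝ} (ha0 : a 0 = 0)
    (ha1 : ‖windowState a‖ = 1) {A : ℝ} (ha : ∀ k, (a (k + 1) - a k) ^ 2 ≤ A) {ε : ℝ}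
    (hA : n * A ≤ ε ^ 2 / 16) {I : AnnealingData Ω} (hI : I.Admissible z ℓ δ) (hε : 0 < ε)
    {ξ : EuclideanSpace ℂ (Conf Ω ((Fin 2 × Fin n) × Fin (d + 1)))} (hξ : ‖ξ‖ = 1) {c : Circle}
    (hdist : ‖ξ - c • logical z (Fin 2 × Fin n) hχ (estimate (rotationAngle I i) (gibbsState I i) n
      (withMemory Ω ha1 (gibbsState I i)))‖ ≤ 1 / 4)
    (p : Conf Ω ((Fin 2 × Fin n) × Fin (d + 1)) → Prop) {_ : DecidablePred p}
    (hp : ∀ q, |shiftEigenvalue n q.2.2.1.2 - (1 - 2 * I.ratio i)| ≤ ε → p q) :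
    3 / 4 ≤ ∑ q with p q, ‖ξ q‖ ^ 2 := by
  have hbad := (mul_sum_filter_estimate_le (hχ := hχ) hi ha0 ha1 ha hI hε.le p hp).trans hA
  set ζ := logical z (Fin 2 × Fin n) hχ (estimate (rotationAngle I i) (gibbsState I i) n
    (withMemory Ω ha1 (gibbsState I i)))
  have hphase (q) : ‖(c • ζ) q‖ = ‖ζ q‖ := by
    rw [Circle.smul_def, PiLp.smul_apply, norm_smul, Circle.norm_coe, one_mul]
  have hmass := one_sub_le_sum_filter_norm_sq p hξ (c • ζ)
  simp only [hphase] at hmass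
  have hdist := pow_le_pow_left₀ (norm_nonneg _) hdist 2
  have hbad : ∑ q with ¬p q, ‖ζ q‖ ^ 2 ≤ 1 / 16 :=
    le_of_mul_le_mul_left (hbad.trans_eq (by ring)) (pow_pos hε 2)
  linarith

theorem norm_run_append_sub_le {X : Type*} [NormedAddCommGroup X] [InnerProductSpace ℂ X]
    {K : Type} [Fintype K] {I : AnnealingData Ω} (hI : I.Admissible z ℓ δ) (hi : i < ℓ)
    {ι : X →ₗᵢ[ℂ] EuclideanSpace ℂ (Conf Ω K)} (τ : EuclideanSpace ℂ Ω →ₗᵢ[ℂ] X) (o : X ≃ₗᵢ[ℂ] X)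
    {gs₁ gs₂ : List (Gate Ω K ℓ)} {m : ℕ} {e₁ e₂ : ℝ}
    (h₁ : ∀ v, ‖run I z i gs₁ (ι.comp τ v) - ι.comp τ (prepare I m i v)‖ ≤ e₁ * ‖v‖)
    (h₂ : ∀ x, ‖run I z i gs₂ (ι x) - ι (o x)‖ ≤ e₂ * ‖x‖) :
    ∃ c : Circle, ‖run I z i (gs₁ ++ gs₂) (ι (τ (gibbsState I 0))) - c • ι (o (τ (gibbsState I i)))‖
      ≤ e₁ + i * Real.sqrt (2 * (1 / 2) ^ 3 ^ m) + e₂ := by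
  have : Nonempty Ω := ⟨z⟩
  obtain ⟨c, hc⟩ := exists_norm_prepare_sub_le hI m hi
  set x := τ (c • gibbsState I i) with hx
  have hx1 : ‖x‖ = 1 := by
    rw [LinearIsometry.norm_map, Circle.smul_def, norm_smul, Circle.norm_coe, norm_gibbsState,
      one_mul]
  have hphase : c • ι (o (τ (gibbsState I i))) = ι (o x) := by
    simp only [hx, Circle.smul_def, map_smul]
  have hrun : ‖run I z i gs₁ (ι (τ (gibbsState I 0))) - ι (τ (prepare I m i (gibbsState I 0)))‖
      ≤ e₁ := by
    have h := h₁ (gibbsState I 0)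
    rwa [norm_gibbsState, mul_one] at h
  have hprepare : ‖ι (τ (prepare I m i (gibbsState I 0))) - ι x‖
      ≤ i * Real.sqrt (2 * (1 / 2) ^ 3 ^ m) := by
    rwa [hx, ← map_sub, ← map_sub, LinearIsometry.norm_map, LinearIsometry.norm_map]
  have hfst : ‖run I z i (gs₁ ++ gs₂) (ι (τ (gibbsState I 0))) - run I z i gs₂ (ι x)‖
      ≤ e₁ + i * Real.sqrt (2 * (1 / 2) ^ 3 ^ m) := by
    have happend : run I z i (gs₁ ++ gs₂) (ι (τ (gibbsState I 0)))
        = run I z i gs₂ (run I z i gs₁ (ι (τ (gibbsState I 0)))) := by rw [run_append]; rfl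
    rw [happend, ← map_sub, LinearIsometryEquiv.norm_map]
    exact (norm_sub_le_norm_sub_add_norm_sub _ _ _).trans (add_le_add hrun hprepare)
  refine ⟨c, ?_⟩
  rw [hphase]
  refine (norm_sub_le_norm_sub_add_norm_sub _ (run I z i gs₂ (ι x)) _).trans (add_le_add hfst ?_)
  simpa only [hx1, mul_one] using h₂ x

theorem exists_estimation_circuit (hi : i < ℓ) (hδ : 0 < δ) {T : ℕ} [NeZero T]
    (hT : 2 ≤ T * Real.sqrt δ) (r m : ℕ) {a : Fin n → ℝ} (ha : ‖windowState a‖ = 1) :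
    ∃ gs : List (Gate Ω ((Fin 2 × Fin n) × Fin (r * (T - 1) + 1)) ℓ),
      walkTotal gs ≤ (ℓ * 3 ^ m + n) * (2 * (r * (T - 1))) ∧ rotTotal gs ≤ 2 * n + 1 ∧
      ∀ I : AnnealingData Ω, I.Admissible z ℓ δ → ∃ c : Circle,
        ‖run I z i gs (logical z _ (norm_counterState T r) (withMemory Ω ha (gibbsState I 0)))
          - c • logical z _ (norm_counterState T r) (estimate (rotationAngle I i) (gibbsState I i) n
            (withMemory Ω ha (gibbsState I i)))‖
          ≤ ℓ * Real.sqrt (2 * (1 / 2) ^ 3 ^ m) + (ℓ * 3 ^ m + n) * (2 * (1 / 2) ^ r) := by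
  set ι := logical z (Fin 2 × Fin n) (norm_counterState T r)
  set τ := withMemory Ω ha
  have hphase (j : ℕ) (hj : j < ℓ) (φ : Fin 2 × Fin n → Circle) :=
    implementable_gibbsPhase (i := i) (z := z) hj hδ hT r φ
  have hprepare := implementable_prepare (ι := ι.comp τ) (fun j hj =>
    (hphase j hj fun _ => sixthRoot).comp τ fun I _ v =>
      controlledPhase_const_withMemory (gibbsState I j) sixthRoot ha v) m hi
  have hℓ : (i : ℝ) ≤ ℓ := Nat.cast_le.2 hi.le
  have hpow : (0 : ℝ) ≤ 3 ^ m - 1 := sub_nonneg.2 (one_le_pow₀ (by norm_num))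
  obtain ⟨gs₁, hw₁, hv₁, hg₁⟩ := hprepare.mono
    (w' := ℓ * 3 ^ m * (2 * (r * (T - 1)))) (e' := ℓ * 3 ^ m * (2 * (1 / 2) ^ r))
    (by rw [mul_assoc]; gcongr; exact Nat.sub_le _ _) le_rfl
    (by rw [mul_assoc]; gcongr; exact sub_le_self _ zero_le_one)
  obtain ⟨gs₂, hw₂, hv₂, hg₂⟩ := implementable_estimate (hphase i hi)
  refine ⟨gs₁ ++ gs₂, by rw [walkTotal_append, add_mul]; exact add_le_add hw₁ hw₂,
    by rw [rotTotal_append]; lia, fun I hI => ?_⟩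
  obtain ⟨c, hc⟩ := norm_run_append_sub_le hI hi τ
    (estimate (rotationAngle I i) (gibbsState I i) n) (hg₁ I hI) (hg₂ I hI)
  have hsqrt := mul_le_mul_of_nonneg_right hℓ (Real.sqrt_nonneg (2 * (1 / 2) ^ 3 ^ m))
  exact ⟨c, by linarith only [hc, hsqrt]⟩

open Classical in
theorem exists_scheme_of_circuit {K : Type} [Fintype K] (hi : i < ℓ)
    {ψ : EuclideanSpace ℂ (Conf Ω K)} (hψ : ‖ψ‖ = 1) (gs : List (Gate Ω K ℓ)) (f : Conf Ω K → ℝ) :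
    ∃ A : Scheme Ω ℓ, A.walkCount = walkTotal gs ∧ A.rotCount = rotTotal gs ∧
      ∀ I : AnnealingData Ω, I.Admissible z ℓ δ → ∀ S : Set ℝ,
        A.prob I z i S = ∑ c with f c ∈ S, ‖run I z i gs ψ c‖ ^ 2 := by
  have : Nonempty (Conf Ω K) := by
    by_contra! h
    simp [Subsingleton.elim ψ 0] at hψ
  obtain ⟨init⟩ := this
  have hinit : ‖EuclideanSpace.single init (1 : ℂ)‖ = 1 := by simp
  obtain ⟨F, hF⟩ := exists_linearIsometryEquiv_comp_eq
    (LinearIsometry.toSpanSingleton ℂ _ hinit) (LinearIsometry.toSpanSingleton ℂ _ hψ)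
  have hF1 : F (EuclideanSpace.single init 1) = ψ := by simpa using hF 1
  refine ⟨{ Anc := K, init := init, gates := Gate.free F :: gs, output := f },
    Nat.zero_add _, Nat.zero_add _, fun I hI S => ?_⟩
  refine Finset.sum_congr rfl fun c _ => ?_
  rw [Scheme.finalState, foldl_act_eq_run hI hi, run_cons]
  change ‖run I z i gs (F (EuclideanSpace.single init 1)) c‖ ^ 2 = _
  rw [hF1]

theorem exists_scheme (z : Ω) (hi : i < ℓ) (hδ : 0 < δ) {ε : ℝ} (hε : 0 < ε) {T : ℕ} [NeZero T]
    (hT : 2 ≤ T * Real.sqrt δ) {r m p : ℕ} (hp : 6 ≤ p * ε)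
    (herr : ℓ * Real.sqrt (2 * (1 / 2) ^ 3 ^ m)
      + (ℓ * 3 ^ m + 4 * p : ℝ) * (2 * (1 / 2) ^ r) ≤ 1 / 4) :
    ∃ A : Scheme Ω ℓ, A.walkCount ≤ (ℓ * 3 ^ m + 4 * p) * (2 * (r * (T - 1))) ∧
      A.rotCount ≤ 8 * p + 1 ∧ ∀ I : AnnealingData Ω, I.Admissible z ℓ δ →
        3 / 4 ≤ A.prob I z i (Set.Icc ((1 - ε) * I.ratio i) ((1 + ε) * I.ratio i)) := by
  classical
  have : Nonempty Ω := ⟨z⟩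
  have hp0 : p ≠ 0 := by
    rintro rfl
    norm_num at hp
  have : (0 : ℝ) < p := by positivity
  have : NeZero p := ⟨hp0⟩
  obtain ⟨a, ha0, ha1, ha⟩ := exists_window p
  have ha1 := norm_windowState ha1
  obtain ⟨gs, hw, hv, hgs⟩ := exists_estimation_circuit (z := z) hi hδ hT r m ha1
  set ψ := logical z (Fin 2 × Fin (4 * p)) (norm_counterState T r)
    (withMemory Ω ha1 (qsample fun _ => (Fintype.card Ω : ℝ)⁻¹))
  have hψ : ‖ψ‖ = 1 := by
    rw [LinearIsometry.norm_map, LinearIsometry.norm_map]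
    exact norm_qsample (fun _ => by positivity) (by simp)
  obtain ⟨A, hAw, hAv, hA⟩ := exists_scheme_of_circuit (z := z) (δ := δ) hi hψ gs
    fun c => (1 - shiftEigenvalue (4 * p) c.2.2.1.2) / 2
  refine ⟨A, hAw.trans_le hw, by lia, fun I hI => ?_⟩
  obtain ⟨c, hc⟩ := hgs I hI
  rw [gibbsState_zero hI] at hc
  have hξ : ‖run I z i gs ψ‖ = 1 := by rw [LinearIsometryEquiv.norm_map, hψ]
  rw [hA I hI]
  refine three_quarters_le_sum_filter_estimate hi ha0 ha1 ha ?_ hI hε hξ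
    (hc.trans (by exact_mod_cast herr)) _ fun q hq => ?_
  · have hA : ((4 * p : ℕ) : ℝ) * (1 / (2 * (p : ℝ) ^ 3)) = 2 / p ^ 2 := by
      push_cast
      field_simp
      norm_num
    rw [hA, div_le_iff₀ (by positivity)]
    nlinarith
  · have hr := hI.ratio_ge i hi
    rw [abs_le] at hq
    constructor <;> nlinarith

end Assembly

section Parameters

theorem exists_le_three_pow_le {n : ℕ} (hn : n ≠ 0) : ∃ m : ℕ, n ≤ 3 ^ m ∧ 3 ^ m ≤ 3 * n := by
  refine ⟨Nat.log 3 n + 1, (Nat.lt_pow_succ_log_self (by norm_num) n).le, ?_⟩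
  rw [pow_succ']
  exact Nat.mul_le_mul_left 3 (Nat.pow_log_le_self 3 hn)

theorem natLog_two_mul_log_two_le (n : ℕ) : Nat.log 2 n * Real.log 2 ≤ Real.log n := by
  rw [← le_div_iff₀ (Real.log_pos one_lt_two)]
  exact_mod_cast Real.natLog_le_logb n 2

theorem mul_sqrt_two_mul_half_pow_le {n k : ℕ} (hk : 11 + 2 * Nat.log 2 n ≤ k) :
    n * Real.sqrt (2 * (1 / 2) ^ k) ≤ 1 / 16 := by
  have hn : (n : ℝ) ≤ 2 ^ (Nat.log 2 n + 1) := by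
    exact_mod_cast (Nat.lt_pow_succ_log_self (by norm_num) n).le
  have hpow : (n : ℝ) ^ 2 * 2 ^ 9 ≤ 2 ^ k :=
    calc (n : ℝ) ^ 2 * 2 ^ 9 ≤ (2 ^ (Nat.log 2 n + 1)) ^ 2 * 2 ^ 9 := by gcongr
      _ = 2 ^ (11 + 2 * Nat.log 2 n) := by ring
      _ ≤ 2 ^ k := pow_le_pow_right₀ one_le_two hk
  rw [← Real.sqrt_sq (Nat.cast_nonneg n), ← Real.sqrt_mul (sq_nonneg _), Real.sqrt_le_left
    (by norm_num), div_pow, one_pow, mul_one_div, ← mul_div_assoc, div_le_iff₀ (by positivity)]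
  linarith

theorem exists_levels {ℓ : ℕ} (hℓ : ℓ ≠ 0) :
    ∃ m : ℕ, ℓ * Real.sqrt (2 * (1 / 2) ^ 3 ^ m) ≤ 1 / 16 ∧ 3 ^ m ≤ 39 * ℓ ∧
      (2 ≤ ℓ → (3 : ℝ) ^ m ≤ 57 * Real.log ℓ) := by
  obtain ⟨m, hle, hge⟩ := exists_le_three_pow_le (n := 11 + 2 * Nat.log 2 ℓ) (by lia)
  refine ⟨m, mul_sqrt_two_mul_half_pow_le hle, ?_, fun hℓ2 => ?_⟩
  · have := Nat.log_lt_self 2 hℓ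
    lia
  · have hlog : Real.log 2 ≤ Real.log ℓ :=
      Real.log_le_log (by norm_num) (by exact_mod_cast hℓ2)
    have hpow : (3 : ℝ) ^ m ≤ 3 * (11 + 2 * Nat.log 2 ℓ) := by exact_mod_cast hge
    have hmul : (3 : ℝ) ^ m * Real.log 2 ≤ 39 * Real.log ℓ := by
      linarith [mul_le_mul_of_nonneg_right hpow (Real.log_nonneg one_le_two),
        natLog_two_mul_log_two_le ℓ]
    have hpos : (0 : ℝ) < 3 ^ m := by positivity
    nlinarith [Real.log_two_gt_d9]

theorem natClog_two_mul_log_two_le {n : ℕ} (hn : n ≠ 0) :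
    Nat.clog 2 n * Real.log 2 ≤ Real.log n + Real.log 2 := by
  rcases Nat.lt_or_ge 1 n with hn1 | hn1
  · have hpow : ((2 ^ (Nat.clog 2 n).pred : ℕ) : ℝ) ≤ n := by
      exact_mod_cast (Nat.pow_pred_clog_lt_self one_lt_two hn1).le
    have hlog := Real.log_le_log (by positivity) hpow
    rw [Nat.cast_pow, Real.log_pow, Nat.cast_ofNat, Nat.pred_eq_sub_one,
      Nat.cast_pred (Nat.clog_pos one_lt_two hn1)] at hlog
    linarith
  · obtain rfl : n = 1 := by lia
    simp [Real.log_nonneg]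

theorem exists_exponent {N : ℕ} (hN : N ≠ 0) :
    ∃ r : ℕ, (N : ℝ) * (2 * (1 / 2) ^ r) ≤ 1 / 6 ∧
      ∀ q : ℝ, 2 ≤ q → (N : ℝ) ≤ 67 * q ^ 2 → (r : ℝ) ≤ 19 * Real.log q := by
  refine ⟨Nat.clog 2 (12 * N), ?_, fun q hq hNq => ?_⟩
  · have hclog : (12 * N : ℝ) ≤ 2 ^ Nat.clog 2 (12 * N) := by
      exact_mod_cast Nat.le_pow_clog one_lt_two (12 * N)
    rw [div_pow, one_pow, mul_one_div, ← mul_div_assoc, div_le_iff₀ (by positivity)]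
    linarith
  · have hclog := natClog_two_mul_log_two_le (mul_ne_zero (by norm_num : 12 ≠ 0) hN)
    have hlogN : Real.log ((12 * N : ℕ) : ℝ) ≤ 10 * Real.log 2 + 2 * Real.log q := by
      have hN' : ((12 * N : ℕ) : ℝ) ≤ 2 ^ 10 * q ^ 2 := by
        push_cast
        nlinarith
      calc Real.log ((12 * N : ℕ) : ℝ) ≤ Real.log (2 ^ 10 * q ^ 2) :=
            Real.log_le_log (by positivity) hN'
        _ = 10 * Real.log 2 + 2 * Real.log q := by
            rw [Real.log_mul (by positivity) (by positivity), Real.log_pow, Real.log_pow]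
            norm_num
    have hlog : Real.log 2 ≤ Real.log q := Real.log_le_log (by norm_num) hq
    have : (0 : ℝ) ≤ Nat.clog 2 (12 * N) := Nat.cast_nonneg _
    nlinarith [Real.log_two_gt_d9]

theorem log_max_mul_le {a b : ℝ} (ha : 2 ≤ a) (hb : 1 < b) :
    Real.log (max a b) * (57 * (a * Real.log a) + 28 * b)
      ≤ 114 * (a * Real.log a ^ 2 + b * Real.log b) := by
  have hloga : 1 / 2 < Real.log a :=
    lt_of_lt_of_le (by linarith [Real.log_two_gt_d9]) (Real.log_le_log (by norm_num) ha)
  have hlogb : 0 < Real.log b := Real.log_pos hb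
  have haloga : 0 ≤ a * Real.log a ^ 2 := by positivity
  have hblogb : 0 ≤ b * Real.log b := by positivity
  rcases le_total b a with h | h
  · rw [max_eq_left h]
    have hab : Real.log a * b ≤ Real.log a * a := by gcongr
    have hsq : a * Real.log a ≤ 2 * (a * Real.log a ^ 2) := by
      have : 0 ≤ a * Real.log a := by positivity
      nlinarith
    linarith
  · rw [max_eq_right h]
    rcases le_total b (a ^ 2) with hsq | hsq
    · have hlog : Real.log b ≤ 2 * Real.log a := by
        simpa using Real.log_le_log (by linarith) hsq
      have : Real.log b * (a * Real.log a) ≤ 2 * Real.log a * (a * Real.log a) := by gcongr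
      linarith
    · have hlogle : Real.log a ≤ a := (Real.log_le_sub_one_of_pos (by linarith)).trans (by linarith)
      have hle : a * Real.log a ≤ b := by nlinarith
      have : Real.log b * (a * Real.log a) ≤ Real.log b * b := by gcongr
      linarith

theorem mul_two_mul_mul_le {a b c N r t : ℝ} (ha : 2 ≤ a) (hb : 1 < b) (hc : 0 < c) (hr₀ : 0 ≤ r)
    (ht₀ : 0 ≤ t) (hN : N ≤ 57 * (a * Real.log a) + 28 * b)
    (hr : r ≤ 19 * Real.log (max a b)) (ht : t ≤ 2 / c) :
    N * (2 * (r * t)) ≤ 10000 * (a / c * Real.log a ^ 2 + b / c * Real.log b) := by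
  have hloga : 0 ≤ Real.log a := Real.log_nonneg (by linarith)
  have hlogb : 0 ≤ Real.log b := Real.log_nonneg hb.le
  have hlog : 0 ≤ Real.log (max a b) := Real.log_nonneg (hb.le.trans (le_max_right _ _))
  calc N * (2 * (r * t))
      ≤ (57 * (a * Real.log a) + 28 * b) * (2 * (19 * Real.log (max a b) * (2 / c))) := by gcongr
    _ = 76 / c * (Real.log (max a b) * (57 * (a * Real.log a) + 28 * b)) := by ring
    _ ≤ 76 / c * (114 * (a * Real.log a ^ 2 + b * Real.log b)) :=
        mul_le_mul_of_nonneg_left (log_max_mul_le ha hb) (by positivity)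
    _ = 8664 * (a / c * Real.log a ^ 2 + b / c * Real.log b) := by ring
    _ ≤ _ := mul_le_mul_of_nonneg_right (by norm_num) (by positivity)

theorem exists_counter_size {c : ℝ} (hc : 0 < c) :
    ∃ T : ℕ, T ≠ 0 ∧ 2 ≤ T * c ∧ ((T - 1 : ℕ) : ℝ) ≤ 2 / c := by
  have hT := Nat.ceil_pos.2 (by positivity : 0 < 2 / c)
  refine ⟨⌈2 / c⌉₊, hT.ne', (div_le_iff₀ hc).1 (Nat.le_ceil _), ?_⟩
  rw [Nat.cast_pred hT, sub_le_iff_le_add]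
  exact (Nat.ceil_lt_add_one (by positivity)).le

theorem exists_window_size {ε : ℝ} (hε : 0 < ε) (hε1 : ε < 1) :
    ∃ p : ℕ, 6 ≤ p * ε ∧ (p : ℝ) ≤ 7 * (1 / ε) := by
  have hceil : (⌈6 / ε⌉₊ : ℝ) ≤ 6 / ε + 1 := (Nat.ceil_lt_add_one (by positivity)).le
  have hone : 1 < 1 / ε := one_lt_one_div hε hε1
  refine ⟨⌈6 / ε⌉₊, (div_le_iff₀ hε).1 (Nat.le_ceil _), ?_⟩
  linarith [div_eq_mul_one_div 6 ε]

theorem exists_parameters {ℓ : ℕ} (hℓ : ℓ ≠ 0) {δ ε : ℝ} (hδ : 0 < δ) (hε : 0 < ε) (hε1 : ε < 1) :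
    ∃ T r m p : ℕ, T ≠ 0 ∧ 2 ≤ T * Real.sqrt δ ∧ 6 ≤ p * ε ∧
      ℓ * Real.sqrt (2 * (1 / 2) ^ 3 ^ m)
        + (ℓ * 3 ^ m + 4 * p : ℝ) * (2 * (1 / 2) ^ r) ≤ 1 / 4 ∧
      8 * p + 1 ≤ 10000 / ε ∧
      (2 ≤ ℓ → (ℓ * 3 ^ m + 4 * p) * (2 * (r * ((T - 1 : ℕ) : ℝ)))
        ≤ 10000 * ((ℓ : ℝ) / Real.sqrt δ * Real.log ℓ ^ 2
          + 1 / (ε * Real.sqrt δ) * Real.log (1 / ε))) := by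
  have hb : 1 < 1 / ε := one_lt_one_div hε hε1
  obtain ⟨m, hm, hm_le, hm_log⟩ := exists_levels hℓ
  obtain ⟨p, hp, hp_le⟩ := exists_window_size hε hε1
  obtain ⟨T, hT0, hT, hT_le⟩ := exists_counter_size (Real.sqrt_pos.2 hδ)
  obtain ⟨r, hr, hr_log⟩ := exists_exponent (N := ℓ * 3 ^ m + 4 * p) (by positivity)
  push_cast at hr hr_log
  refine ⟨T, r, m, p, hT0, hT, hp, by linarith, ?_, fun hℓ2 => ?_⟩
  · linarith [div_eq_mul_one_div 10000 ε]
  · have ha : (2 : ℝ) ≤ ℓ := by exact_mod_cast hℓ2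
    have hmaxℓ : (ℓ : ℝ) ≤ max (ℓ : ℝ) (1 / ε) := le_max_left _ _
    have hmaxε : 1 / ε ≤ max (ℓ : ℝ) (1 / ε) := le_max_right _ _
    have hquad : (ℓ * 3 ^ m + 4 * p : ℝ) ≤ 67 * max (ℓ : ℝ) (1 / ε) ^ 2 := by
      have : (ℓ * 3 ^ m : ℝ) ≤ ℓ * (39 * ℓ) := by gcongr; exact_mod_cast hm_le
      nlinarith
    have hN : (ℓ * 3 ^ m + 4 * p : ℝ) ≤ 57 * (ℓ * Real.log ℓ) + 28 * (1 / ε) := by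
      have : (ℓ * 3 ^ m : ℝ) ≤ ℓ * (57 * Real.log ℓ) := by gcongr; exact hm_log hℓ2
      linarith
    rw [← div_div]
    exact mul_two_mul_mul_le ha hb (Real.sqrt_pos.2 hδ) r.cast_nonneg (Nat.cast_nonneg _) hN
      (hr_log _ (ha.trans hmaxℓ) hquad) hT_le

end Parameters

section Main

variable {Ω : Type*} [Fintype Ω] {ℓ : ℕ}

theorem walkCount_eq_zero (hℓ : ℓ ≤ 1) (A : Scheme Ω ℓ) : A.walkCount = 0 := by
  refine List.sum_eq_zero_iff.2 (List.forall_mem_map.2 fun g _ => ?_)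
  cases g with
  | free F => rfl
  | walk j h1 h2 => lia
  | rot => rfl

end Main

end QPartition

end

/-- There is a universal constant `C` such that for every finite state space with a reference
state, every `ℓ`, `i < ℓ`, `δ > 0` and `ε ∈ (0,1)`, one scheme, with the stated number of controlled
walks (and of uses of `V_i`), works for all admissible instances. -/
theorem lemma5 :
    ∃ C : ℝ, 0 < C ∧
      ∀ (Ω : Type*) [Fintype Ω] [DecidableEq Ω] (z : Ω) (ℓ i : ℕ), i < ℓ →
        ∀ δ ε : ℝ, 0 < δ → 0 < ε → ε < 1 →
          ∃ A : QPartition.Scheme Ω ℓ,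
            (A.walkCount : ℝ) ≤
              C * ((ℓ : ℝ) / Real.sqrt δ * Real.log ℓ ^ 2
                + 1 / (ε * Real.sqrt δ) * Real.log (1 / ε)) ∧
            (A.rotCount : ℝ) ≤ C / ε ∧
            ∀ I : QPartition.AnnealingData Ω, I.Admissible z ℓ δ →
              3 / 4 ≤ A.prob I z i
                (Set.Icc ((1 - ε) * I.ratio i) ((1 + ε) * I.ratio i)) := by
  refine ⟨10000, by norm_num, fun Ω _ _ z ℓ i hi δ ε hδ hε hε1 => ?_⟩
  obtain ⟨T, r, m, p, hT0, hT, hp, herr, hrot, hwalk⟩ :=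
    QPartition.exists_parameters (Nat.ne_zero_of_lt hi) hδ hε hε1
  have : NeZero T := ⟨hT0⟩
  obtain ⟨A, hAwalk, hArot, hA⟩ := QPartition.exists_scheme z hi hδ hε hT hp herr
  refine ⟨A, ?_, (by exact_mod_cast hArot : (A.rotCount : ℝ) ≤ 8 * p + 1).trans hrot, hA⟩
  rcases Nat.lt_or_ge 1 ℓ with hℓ | hℓ
  · exact le_trans (by exact_mod_cast hAwalk) (hwalk hℓ)
  · have : 0 ≤ Real.log (1 / ε) := Real.log_nonneg (one_lt_one_div hε hε1).le
    rw [QPartition.walkCount_eq_zero hℓ, Nat.cast_zero]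
    positivity
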